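/- Let $p$ be a prime and let $A$ be a complete discrete valuation ring with maximal ideal $\mathfrak p_A$ and residue field $\bar A$ of characteristic $p$. An $\mathbf F_p$-algebra is *perfect* if its Frobenius endomorphism $x\mapsto x^p$ is bijective; $R^{\mathrm{pf}}$ denotes the perfection (the universal perfect algebra under $R$), and $\mathrm{PAlg}_R$ the category of perfect $R$-algebras. Let $\mathrm{CRP}_A$ (*complete residual perfections* of $A$) be the full subcategory of the category of $A$-algebras consisting of those $B$ that are flat over $A$, complete (and separated) for the ideal $\mathfrak p_B=\mathfrak p_AB$, and such that $\bar B=B/\mathfrak p_B$ is perfect. For such $B$ let $s_B:\bar B\to B$ be the unique multiplicative section of $B\to\bar B$. Fix a uniformizer $\pi$ of $A$ and a subset $T\subset A$ that lifts a $p$-basis of $\bar A$. Every element $x$ of an object $B$ of $\mathrm{CRP}_A$ is uniquely $\sum_{j\ge 0}s_B(x_j)\pi^j$ with $x_j\in\bar B$, its *coefficients*. Let $R_T=\bar A[u_{t,j}\mid t\in T,\ j\ge 1]$. *The functor $U:\mathrm{CRP}_A\to\mathrm{PAlg}_{R_T^{\mathrm{pf}}}$.* $U(B)$ is $\bar B$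 with the unique $R_T^{\mathrm{pf}}$-algebra structure that extends its $\bar A$-algebra structure and sends $u_{t,j}$ to the $j$-th coefficient of the image of $t$ in $B$. *The functor $V:\mathrm{PAlg}_{R_T^{\mathrm{pf}}}\to\mathrm{CRP}_A$.* (a) If $A$ has equal characteristic, then for every perfect $R_T^{\mathrm{pf}}$-algebra $S$ there is a unique ring map $A\to S[\![\tilde\pi]\!]$ with $\pi\mapsto\tilde\pi$, with $t\mapsto\bar t+\sum_{j\ge1}u_{t,j}\tilde\pi^j$ for all $t\in T$, and whose reduction modulo $\tilde\pi$ is $A\to\bar A\to S$. Let $V(S)=S[\![\tilde\pi]\!]$ with this $A$-algebra structure. (b) If $A$ has mixed characteristic, there is a unique subring $C\subset A$ that contains $T$, is a complete discrete valuation ring with maximal ideal $pC$, and maps onto $\bar A$ (the Cohen subring determined by $T$). For every perfect $R_T^{\mathrm{pf}}$-algebra $S$, with Witt vectors $W=W(S)$ and Teichmüller map $s_W:S\to W$, there is a unique ring map $C[X]\to W[\![\tilde\pi]\!]$ with $X\mapsto\tilde\pi$, with $t\mapsto s_W(\bar t)+\sum_{j\ge1}s_W(u_{t,j})\tilde\pi^j$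 for all $t\in T$, and whose restriction to $C$ reduces modulo $(p,\tilde\pi)$ to $C\to\bar A\to S$. Let $V(S)=A\otimes_{C[X]}W[\![\tilde\pi]\!]$, where $A$ is a $C[X]$-algebra by $X\mapsto\pi$. In both cases $V(S)$ is an object of $\mathrm{CRP}_A$, and $\langle V,U;\eta,\varepsilon\rangle$ is an adjoint equivalence between $\mathrm{PAlg}_{R_T^{\mathrm{pf}}}$ and $\mathrm{CRP}_A$ ($V$ is left adjoint to $U$, with unit $\eta:1\to UV$ and counit $\varepsilon:VU\to1$ both isomorphisms). Here $\eta(S):S\to UV(S)$ sends $x$ to the class of the constant series $x$ in case (a), and of $1\otimes s_W(x)$ in case (b). In case (a), $\varepsilon(B):\bar B[\![\tilde\pi]\!]\to B$ is $\sum b_j\tilde\pi^j\mapsto\sum s_B(b_j)\pi^j$. In case (b), $\varepsilon(B)$ is the $A$-linear map with $1\otimes\sum w_j\tilde\pi^j\mapsto\sum\theta(w_j)\pi^j$, where $\theta:W(\bar B)\to B$ is the unique ring map that reduces to the identity of $\bar B$. Consequently: (i) $\mathrm{CRP}_A$ has an initial object $A^{\mathrm u}$ (the universal residual perfection), and the unique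 morphism $A^{\mathrm u}\to V(R_T^{\mathrm{pf}})$ is an isomorphism. (ii) $\overline{A^{\mathrm u}}$ is a domain. The generic residual perfection $A^{\mathrm g}$, that is, the object of $\mathrm{CRP}_A$ for which $\overline{A^{\mathrm u}}\to\overline{A^{\mathrm g}}$ is a fraction field of $\overline{A^{\mathrm u}}$, exists and is isomorphic to $V(\mathrm{Fr}(R_T^{\mathrm{pf}}))$ by a unique isomorphism of $A$-algebras. -/

import Mathlib

open CategoryTheory
open scoped TensorProduct

universe u

namespace ResidualPerfection

noncomputable section

/-! ### Perfect algebras and `p`-bases -/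

/-- `S` is a perfect `𝔽_p`-algebra: `p = 0` in `S` and `x ↦ x ^ p` is bijective.
(The zero ring is allowed, so Mathlib's `PerfectRing`, which excludes it, is not used.) -/
def IsPerfect (p : ℕ) (S : Type*) [CommRing S] : Prop :=
  (p : S) = 0 ∧ Function.Bijective (fun x : S => x ^ p)

/-- The property of an `R`-algebra of being perfect. -/
def isPerfectAlg (p : ℕ) (R : Type u) [CommRing R] : ObjectProperty (CommAlgCat.{u} R) :=
  fun S => IsPerfect p S

/-- The full subcategory of the category of `R`-algebras whose objects are perfect. -/
abbrev PAlg (p : ℕ) (R : Type u) [CommRing R] := (isPerfectAlg p R).FullSubcategory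

/-- A family `b` in a field `k` of characteristic `p` is a `p`-basis if the monomials in `b` with
all exponents `< p` form a basis of `k` over its subfield `k ^ p` of `p`-th powers. -/
structure IsPBasis (p : ℕ) {k : Type*} [Field k] [ExpChar k p] {ι : Type*} (b : ι → k) :
    Prop where
  linearIndependent : LinearIndependent (frobenius k p).fieldRange
    (fun α : {α : ι →₀ ℕ // ∀ i, α i < p} => α.1.prod fun i e => b i ^ e)
  span_eq_top : Submodule.span (frobenius k p).fieldRange
    (Set.range fun α : {α : ι →₀ ℕ // ∀ i, α i < p} => α.1.prod fun i e => b i ^ e) = ⊤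

/-- A ring map from a ring of characteristic `p` to a perfect `𝔽_p`-algebra extends uniquely to
the perfection. -/
theorem existsUnique_perfectClosure_lift (p : ℕ) [Fact p.Prime] {R : Type*} [CommRing R]
    [CharP R p] {S : Type*} [CommRing S] (hS : IsPerfect p S) (f : R →+* S) :
    ∃! g : PerfectClosure R p →+* S, g.comp (PerfectClosure.of R p) = f := by
  rcases subsingleton_or_nontrivial S with h | h
  · refine ⟨⟨⟨⟨fun _ => 0, Subsingleton.elim _ _⟩, fun _ _ => Subsingleton.elim _ _⟩,
      Subsingleton.elim _ _, fun _ _ => Subsingleton.elim _ _⟩, ?_, ?_⟩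
    · ext; exact Subsingleton.elim _ _
    · intro g _; ext; exact Subsingleton.elim _ _
  · have : CharP S p := by
      rcases CharP.exists S with ⟨q, hq⟩
      have h1 : q ∣ p := (CharP.cast_eq_zero_iff S q p).1 hS.1
      rcases (Nat.dvd_prime Fact.out).1 h1 with rfl | rfl
      · exact absurd rfl (CharP.char_ne_one S 1)
      · exact hq
    have : PerfectRing S p := ⟨hS.2⟩
    refine ⟨PerfectClosure.lift R p S f, (PerfectClosure.lift R p S).symm_apply_apply f, ?_⟩
    intro g hg
    rw [← hg]
    exact ((PerfectClosure.lift R p S).apply_symm_apply g).symm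

/-- The extension of a ring map to the perfection. -/
def perfectLift (p : ℕ) [Fact p.Prime] {R : Type*} [CommRing R] [CharP R p] {S : Type*}
    [CommRing S] (hS : IsPerfect p S) (f : R →+* S) : PerfectClosure R p →+* S :=
  (existsUnique_perfectClosure_lift p hS f).choose

theorem perfectLift_comp_of (p : ℕ) [Fact p.Prime] {R : Type*} [CommRing R] [CharP R p]
    {S : Type*} [CommRing S] (hS : IsPerfect p S) (f : R →+* S) :
    (perfectLift p hS f).comp (PerfectClosure.of R p) = f :=
  (existsUnique_perfectClosure_lift p hS f).choose_spec.1

theorem perfectClosure_hom_ext (p : ℕ) [Fact p.Prime] {R : Type*} [CommRing R] [CharP R p]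
    {S : Type*} [CommRing S] (hS : IsPerfect p S) {g g' : PerfectClosure R p →+* S}
    (h : g.comp (PerfectClosure.of R p) = g'.comp (PerfectClosure.of R p)) : g = g' :=
  (existsUnique_perfectClosure_lift p hS (g'.comp (PerfectClosure.of R p))).unique h rfl

theorem isPerfect_perfectClosure (p : ℕ) [Fact p.Prime] (R : Type*) [CommRing R] [CharP R p] :
    IsPerfect p (PerfectClosure R p) :=
  ⟨CharP.cast_eq_zero _ _, PerfectRing.bijective_frobenius (p := p)⟩

instance isDomain_perfectClosure (p : ℕ) [Fact p.Prime] (R : Type*) [CommRing R] [CharP R p]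
    [IsDomain R] : IsDomain (PerfectClosure R p) := by
  have : NoZeroDivisors (PerfectClosure R p) := ⟨by
    intro a b hab
    induction a using PerfectClosure.induction_on with
    | _ x =>
      induction b using PerfectClosure.induction_on with
      | _ y =>
        obtain ⟨m, x⟩ := x
        obtain ⟨n, y⟩ := y
        rw [PerfectClosure.mk_mul_mk, ← PerfectClosure.mk_zero_right R p 0,
          PerfectClosure.eq_iff] at hab
        simp only [← coe_iterateFrobenius, map_mul, map_zero, mul_eq_zero,
          iterateFrobenius_def] at hab
        rcases hab with h | h
        · left
          rw [eq_zero_of_pow_eq_zero (eq_zero_of_pow_eq_zero h), PerfectClosure.mk_zero_right]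
        · right
          rw [eq_zero_of_pow_eq_zero (eq_zero_of_pow_eq_zero h), PerfectClosure.mk_zero_right]⟩
  exact NoZeroDivisors.to_isDomain _

theorem isPerfect_fractionRing (p : ℕ) [Fact p.Prime] {D : Type*} [CommRing D] [IsDomain D]
    (hD : IsPerfect p D) : IsPerfect p (FractionRing D) := by
  have h0 : (p : FractionRing D) = 0 := by
    rw [← map_natCast (algebraMap D (FractionRing D)), hD.1, map_zero]
  have : CharP (FractionRing D) p := by
    rcases CharP.exists (FractionRing D) with ⟨q, hq⟩
    have h1 : q ∣ p := (CharP.cast_eq_zero_iff (FractionRing D) q p).1 h0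
    rcases (Nat.dvd_prime Fact.out).1 h1 with rfl | rfl
    · exact absurd rfl (CharP.char_ne_one (FractionRing D) 1)
    · exact hq
  refine ⟨h0, frobenius_inj (FractionRing D) p, fun x => ?_⟩
  obtain ⟨a, b, hb, rfl⟩ := IsFractionRing.div_surjective (A := D) x
  obtain ⟨a, rfl⟩ := hD.2.2 a
  obtain ⟨b, rfl⟩ := hD.2.2 b
  exact ⟨algebraMap D _ a / algebraMap D _ b, by simp [div_pow]⟩

/-! ### Algebras given by ring maps -/

/-- The target of a ring map `R → S`, as an `R`-algebra. -/
def algOfRingHom {R S : Type u} [CommRing R] [CommRing S] (f : R →+* S) : CommAlgCat.{u} R :=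
  letI := f.toAlgebra
  CommAlgCat.of R S

/-- A ring map compatible with the maps from `R`, as a morphism of `R`-algebras. -/
def algHomOfRingHom {R S S' : Type u} [CommRing R] [CommRing S] [CommRing S'] {f : R →+* S}
    {f' : R →+* S'} (h : S →+* S') (hh : h.comp f = f') : algOfRingHom f ⟶ algOfRingHom f' :=
  letI := f.toAlgebra
  letI := f'.toAlgebra
  CommAlgCat.ofHom (R := R) (X := S) (Y := S')
    { toRingHom := h, commutes' := fun r => RingHom.congr_fun hh r }

/-- The tensor product `A ⊗_P D` of the targets of two ring maps `P → A` and `P → D`. -/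
def TensorRing {P A D : Type u} [CommRing P] [CommRing A] [CommRing D] (f : P →+* A)
    (g : P →+* D) : Type u :=
  letI := f.toAlgebra
  letI := g.toAlgebra
  TensorProduct P A D

namespace TensorRing

variable {P A D D' : Type u} [CommRing P] [CommRing A] [CommRing D] [CommRing D']

instance (f : P →+* A) (g : P →+* D) : CommRing (TensorRing f g) :=
  letI := f.toAlgebra
  letI := g.toAlgebra
  (inferInstance : CommRing (TensorProduct P A D))

instance (f : P →+* A) (g : P →+* D) : Algebra A (TensorRing f g) :=
  letI := f.toAlgebra
  letI := g.toAlgebra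
  (inferInstance : Algebra A (TensorProduct P A D))

/-- The map `d ↦ 1 ⊗ d`. -/
def inr (f : P →+* A) (g : P →+* D) : D →+* TensorRing f g :=
  letI := f.toAlgebra
  letI := g.toAlgebra
  (Algebra.TensorProduct.includeRight : D →ₐ[P] TensorProduct P A D).toRingHom

/-- The map `A ⊗_P D → A ⊗_P D'` induced by a map `D → D'` compatible with the maps from `P`. -/
def map (f : P →+* A) {g : P →+* D} {g' : P →+* D'} (h : D →+* D') (hh : h.comp g = g') :
    TensorRing f g →ₐ[A] TensorRing f g' :=
  letI := f.toAlgebra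
  letI := g.toAlgebra
  letI := g'.toAlgebra
  (Algebra.TensorProduct.map (AlgHom.id A A)
    ({ toRingHom := h, commutes' := fun r => RingHom.congr_fun hh r } : D →ₐ[P] D') :
    TensorProduct P A D →ₐ[A] TensorProduct P A D')

theorem map_inr (f : P →+* A) {g : P →+* D} {g' : P →+* D'} (h : D →+* D')
    (hh : h.comp g = g') (d : D) : map f h hh (inr f g d) = inr f g' (h d) := by
  let := f.toAlgebra
  let := g.toAlgebra
  let := g'.toAlgebra
  exact Algebra.TensorProduct.map_tmul (R := P) (S := A) (AlgHom.id A A)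
    ({ toRingHom := h, commutes' := fun r => RingHom.congr_fun hh r } : D →ₐ[P] D') 1 d

theorem algHom_ext {f : P →+* A} {g : P →+* D} {E : Type u} [CommRing E] [Algebra A E]
    {k k' : TensorRing f g →ₐ[A] E} (h : ∀ d, k (inr f g d) = k' (inr f g d)) : k = k' := by
  let := f.toAlgebra
  let := g.toAlgebra
  refine AlgHom.ext fun x => ?_
  induction x using TensorProduct.induction_on with
  | zero => exact (map_zero k).trans (map_zero k').symm
  | tmul a d =>
    have e : (a ⊗ₜ[P] d : TensorProduct P A D) = a • (1 ⊗ₜ[P] d : TensorProduct P A D) := by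
      rw [TensorProduct.smul_tmul', smul_eq_mul, mul_one]
    rw [e]
    exact (map_smul k a (inr f g d)).trans ((congrArg (a • ·) (h d)).trans
      (map_smul k' a (inr f g d)).symm)
  | add x y hx hy => exact (map_add k x y).trans ((congrArg₂ (· + ·) hx hy).trans
      (map_add k' x y).symm)

end TensorRing

/-! ### Expansions and multiplicative sections -/

/-- The series `∑ cᵢ ϖ ^ i` converges to `x` in the `I`-adic topology of `B`
(for `ϖ ∈ I`). -/
def IsAdicSum {B : Type*} [CommRing B] (I : Ideal B) (ϖ : B) (c : ℕ → B) (x : B) : Prop :=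
  ∀ n : ℕ, x - ∑ i ∈ Finset.range n, c i * ϖ ^ i ∈ I ^ n

theorem eq_of_forall_sub_mem {B : Type*} [CommRing B] (I : Ideal B) [IsHausdorff I B] {x y : B}
    (h : ∀ n, x - y ∈ I ^ n) : x = y := by
  rw [IsHausdorff.eq_iff_smodEq (I := I)]
  intro n
  rw [SModEq.sub_mem]
  simpa using h n

theorem pow_sub_pow_mem {p : ℕ} {B : Type*} [CommRing B] {I : Ideal B} (hp : (p : B) ∈ I)
    {x y : B} (h : x - y ∈ I) (n : ℕ) : x ^ p ^ n - y ^ p ^ n ∈ I ^ (n + 1) := by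
  have h' : x ≡ y [SMOD I ^ 1] := by
    rw [SModEq.sub_mem]; simpa using h
  exact (SModEq.sub_mem).1 (SModEq.pow_pow_add_one hp (m := n) (by simpa using h'))

/-- Two multiplicative maps out of a perfect ring that agree modulo `I` are equal. -/
theorem multiplicative_ext {p : ℕ} {B : Type*} [CommRing B] {I : Ideal B} [IsHausdorff I B]
    (hp : (p : B) ∈ I) {S : Type*} [CommRing S] (hS : IsPerfect p S) {s s' : S →* B}
    (h : ∀ x, s x - s' x ∈ I) : s = s' := by
  ext x
  refine eq_of_forall_sub_mem I fun n => ?_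
  have hx : ∃ y, y ^ p ^ n = x := by
    induction n generalizing x with
    | zero => exact ⟨x, by simp⟩
    | succ n ih =>
      obtain ⟨z, rfl⟩ := hS.2.2 x
      obtain ⟨y, rfl⟩ := ih z
      exact ⟨y, by rw [pow_succ, pow_mul]⟩
  obtain ⟨y, rfl⟩ := hx
  rw [map_pow, map_pow]
  exact Ideal.pow_le_pow_right (Nat.le_succ n) (pow_sub_pow_mem hp (h y) n)

theorem existsUnique_multSection {p : ℕ} [Fact p.Prime] {B : Type*} [CommRing B] (I : Ideal B)
    [IsAdicComplete I B] (hI : IsPerfect p (B ⧸ I)) :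
    ∃! s : (B ⧸ I) →* B, ∀ x, Ideal.Quotient.mk I (s x) = x := by
  have hp : (p : B) ∈ I := by
    rw [← Ideal.Quotient.eq_zero_iff_mem, map_natCast]; exact hI.1
  refine existsUnique_of_exists_of_unique ?_ ?_
  · rcases subsingleton_or_nontrivial (B ⧸ I) with h | h
    · exact ⟨1, fun x => Subsingleton.elim _ _⟩
    · have : CharP (B ⧸ I) p := by
        rcases CharP.exists (B ⧸ I) with ⟨q, hq⟩
        have h1 : q ∣ p := (CharP.cast_eq_zero_iff (B ⧸ I) q p).1 hI.1
        rcases (Nat.dvd_prime Fact.out).1 h1 with rfl | rfl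
        · exact absurd rfl (CharP.char_ne_one (B ⧸ I) 1)
        · exact hq
      have : PerfectRing (B ⧸ I) p := ⟨hI.2⟩
      let l := Perfection.lift p (B ⧸ I) (B ⧸ I) (RingHom.id _)
      refine ⟨(Perfection.teichmuller p I).comp l.toMonoidHom, fun x => ?_⟩
      have h2 : Ideal.Quotient.mk I (Perfection.teichmuller p I (l x)) =
          Perfection.coeff (B ⧸ I) p 0 (l x) := by
        obtain ⟨y, hy⟩ := Ideal.Quotient.mk_surjective (Perfection.coeff (B ⧸ I) p 0 (l x))
        have := Perfection.teichmuller_sModEq (n := 0) hy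
        rw [← hy, Ideal.Quotient.eq]
        rw [SModEq.sub_mem] at this
        simpa using this
      change Ideal.Quotient.mk I (Perfection.teichmuller p I (l x)) = x
      rw [h2]
      exact RingHom.congr_fun ((Perfection.lift p (B ⧸ I) (B ⧸ I)).symm_apply_apply
        (RingHom.id _)) x
  · intro s s' hs hs'
    refine multiplicative_ext hp hI fun x => ?_
    rw [← Ideal.Quotient.eq_zero_iff_mem, map_sub, hs, hs', sub_self]

theorem existsUnique_coeffs {B : Type*} [CommRing B] {I : Ideal B} {ϖ : B}
    (hI : I = Ideal.span {ϖ}) (hϖ : ∀ x y : B, ϖ * x = ϖ * y → x = y)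
    {s : B ⧸ I → B} (hs : ∀ x, Ideal.Quotient.mk I (s x) = x) (x : B) :
    ∃! c : ℕ → B ⧸ I, IsAdicSum I ϖ (fun i => s (c i)) x := by
  have hdiv : ∀ y : B, ∃ z : B, y = s (Ideal.Quotient.mk I y) + ϖ * z := by
    intro y
    have : y - s (Ideal.Quotient.mk I y) ∈ I := by
      rw [← Ideal.Quotient.eq_zero_iff_mem, map_sub, hs, sub_self]
    have := Ideal.mem_span_singleton'.1 (hI.le this)
    obtain ⟨z, hz⟩ := this
    exact ⟨z, by rw [mul_comm, hz]; ring⟩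
  have hpow : ∀ n : ℕ, I ^ n = Ideal.span {ϖ ^ n} := by
    intro n
    rw [hI, Ideal.span_singleton_pow]
  have hcancel : ∀ (n : ℕ) (a b : B), ϖ ^ n * a = ϖ ^ n * b → a = b := by
    intro n
    induction n with
    | zero => intro a b h; simpa using h
    | succ n ih =>
      intro a b h
      exact hϖ _ _ (ih _ _ (by rw [← mul_assoc, ← mul_assoc, ← pow_succ, h]))
  refine existsUnique_of_exists_of_unique ?_ ?_
  · choose r hr using hdiv
    let q : ℕ → B := fun n => r^[n] x
    refine ⟨fun n => Ideal.Quotient.mk I (q n), fun n => ?_⟩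
    have key : x - ∑ i ∈ Finset.range n, s (Ideal.Quotient.mk I (q i)) * ϖ ^ i = ϖ ^ n * q n := by
      induction n with
      | zero => simp [q]
      | succ n ih =>
        rw [Finset.sum_range_succ, ← sub_sub, ih]
        have h1 : q (n + 1) = r (q n) := Function.iterate_succ_apply' r n x
        have h2 := hr (q n)
        rw [h1]
        calc _ = ϖ ^ n * (q n - s (Ideal.Quotient.mk I (q n))) := by ring
          _ = ϖ ^ n * (ϖ * r (q n)) := by congr 1; exact sub_eq_iff_eq_add'.2 h2
          _ = _ := by ring
    rw [key, hpow]
    exact Ideal.mul_mem_right _ _ (Ideal.mem_span_singleton_self _)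
  · intro c c' hc hc'
    funext n
    induction n using Nat.strong_induction_on with
    | _ n ih =>
      have h1 := sub_mem (hc' (n + 1)) (hc (n + 1))
      have h2 : ∑ i ∈ Finset.range n, s (c i) * ϖ ^ i =
          ∑ i ∈ Finset.range n, s (c' i) * ϖ ^ i :=
        Finset.sum_congr rfl fun i hi => by rw [ih i (Finset.mem_range.1 hi)]
      rw [Finset.sum_range_succ, Finset.sum_range_succ, h2, hpow,
        Ideal.mem_span_singleton'] at h1
      obtain ⟨z, hz⟩ := h1
      have h3 : s (c n) - s (c' n) = ϖ * z := by
        apply hcancel n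
        rw [pow_succ] at hz
        linear_combination -hz
      rw [← hs (c n), ← hs (c' n), Ideal.Quotient.eq, h3, hI]
      exact Ideal.mul_mem_right _ _ (Ideal.mem_span_singleton_self _)

/-! ### Complete residual perfections -/

section CRP

variable (p : ℕ) {A : Type u} [CommRing A] [IsLocalRing A]

/-- The ideal `𝔭_B = 𝔭_A B` of an `A`-algebra `B`. -/
abbrev pIdeal (A : Type*) [CommRing A] [IsLocalRing A] (B : Type*) [CommRing B] [Algebra A B] :
    Ideal B :=
  (IsLocalRing.maximalIdeal A).map (algebraMap A B)

/-- The reduction `B / 𝔭_B` of an `A`-algebra `B`. -/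
abbrev Red (A : Type*) [CommRing A] [IsLocalRing A] (B : Type*) [CommRing B] [Algebra A B] :
    Type _ :=
  B ⧸ pIdeal A B

/-- The reduction of a map of `A`-algebras. -/
def redMap {B C : Type*} [CommRing B] [Algebra A B] [CommRing C] [Algebra A C] (f : B →ₐ[A] C) :
    Red A B →+* Red A C :=
  Ideal.quotientMap (pIdeal A C) f.toRingHom (by
    rw [← Ideal.map_le_iff_le_comap, Ideal.map_map]
    exact le_of_eq (congrArg (Ideal.map · _) f.comp_algebraMap))

@[simp]
theorem redMap_mk {B C : Type*} [CommRing B] [Algebra A B] [CommRing C] [Algebra A C]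
    (f : B →ₐ[A] C) (b : B) :
    redMap f (Ideal.Quotient.mk (pIdeal A B) b) = Ideal.Quotient.mk (pIdeal A C) (f b) := rfl

/-- The map from the residue field of `A` to the reduction of an `A`-algebra. -/
def resToRed (A : Type*) [CommRing A] [IsLocalRing A] (B : Type*) [CommRing B] [Algebra A B] :
    IsLocalRing.ResidueField A →+* Red A B :=
  Ideal.quotientMap (pIdeal A B) (algebraMap A B) Ideal.le_comap_map

/-- An `A`-algebra `B` is a complete residual perfection of `A` if it is flat over `A`, complete
with respect to `𝔭_A B`, and `B / 𝔭_A B` is perfect. -/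
structure IsCRP (B : CommAlgCat.{u} A) : Prop where
  flat : Module.Flat A B
  complete : IsAdicComplete (pIdeal A B) B
  perfect : IsPerfect p (Red A B)

/-- Being a complete residual perfection, as a property of objects. -/
def isCRP (A : Type u) [CommRing A] [IsLocalRing A] : ObjectProperty (CommAlgCat.{u} A) :=
  fun B => IsCRP p B

/-- The category of complete residual perfections of `A`, a full subcategory of the category of
`A`-algebras. -/
abbrev CRP (A : Type u) [CommRing A] [IsLocalRing A] := (isCRP p A).FullSubcategory

variable {p}

/-- The map of `A`-algebras underlying a morphism of complete residual perfections. -/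
abbrev CRP.toAlgHom {B C : CRP p A} (f : B ⟶ C) : B.obj →ₐ[A] C.obj := f.hom.hom

theorem CRP.p_mem (B : CRP p A) : (p : B.obj) ∈ pIdeal A B.obj := by
  rw [← Ideal.Quotient.eq_zero_iff_mem, map_natCast]
  exact B.property.perfect.1

variable [Fact p.Prime]

theorem CRP.existsUnique_section (B : CRP p A) :
    ∃! s : Red A B.obj →* B.obj, ∀ x, Ideal.Quotient.mk (pIdeal A B.obj) (s x) = x :=
  have := B.property.complete
  existsUnique_multSection (pIdeal A B.obj) B.property.perfect

/-- The unique multiplicative section `s_B` of the reduction map `B → B / 𝔭_B`. -/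
def CRP.sec (B : CRP p A) : Red A B.obj →* B.obj := B.existsUnique_section.choose

theorem CRP.mk_sec (B : CRP p A) (x : Red A B.obj) :
    Ideal.Quotient.mk (pIdeal A B.obj) (B.sec x) = x :=
  B.existsUnique_section.choose_spec.1 x

theorem CRP.map_sec {B C : CRP p A} (f : B ⟶ C) (x : Red A B.obj) :
    toAlgHom f (B.sec x) = C.sec (redMap (toAlgHom f) x) := by
  have := C.property.complete
  refine DFunLike.congr_fun (multiplicative_ext C.p_mem B.property.perfect
    (s := ((toAlgHom f : B.obj →* C.obj)).comp B.sec)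
    (s' := C.sec.comp (redMap (toAlgHom f) : Red A B.obj →* Red A C.obj)) fun y => ?_) x
  rw [← Ideal.Quotient.eq_zero_iff_mem, map_sub, sub_eq_zero]
  change Ideal.Quotient.mk _ (toAlgHom f (B.sec y)) =
    Ideal.Quotient.mk _ (C.sec (redMap (toAlgHom f) y))
  rw [C.mk_sec, ← redMap_mk, B.mk_sec]

end CRP

section Coeffs

variable {p : ℕ} [Fact p.Prime] {A : Type u} [CommRing A] [IsDomain A]
  [IsDiscreteValuationRing A] {π : A}

theorem pIdeal_eq_span (hπ : Irreducible π) (B : Type*) [CommRing B] [Algebra A B] :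
    pIdeal A B = Ideal.span {algebraMap A B π} := by
  rw [pIdeal, hπ.maximalIdeal_eq, Ideal.map_span, Set.image_singleton]

theorem CRP.existsUnique_coeff (B : CRP p A) (hπ : Irreducible π) (x : B.obj) :
    ∃! c : ℕ → Red A B.obj,
      IsAdicSum (pIdeal A B.obj) (algebraMap A B.obj π) (fun i => B.sec (c i)) x := by
  refine existsUnique_coeffs (pIdeal_eq_span hπ _) (fun a b hab => ?_) B.mk_sec x
  have := B.property.flat
  have h : IsSMulRegular B.obj π :=
    Module.Flat.isSMulRegular_of_isRegular (IsRegular.of_ne_zero hπ.ne_zero)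
  exact h (by simpa [Algebra.smul_def] using hab)

/-- The coefficients of `x ∈ B` with respect to the uniformizer `π`: the unique sequence `(xᵢ)` in
`B / 𝔭_B` such that `x = ∑ s_B(xᵢ) π ^ i`. -/
def CRP.coeff (B : CRP p A) (hπ : Irreducible π) (x : B.obj) : ℕ → Red A B.obj :=
  (B.existsUnique_coeff hπ x).choose

theorem CRP.isAdicSum_coeff (B : CRP p A) (hπ : Irreducible π) (x : B.obj) :
    IsAdicSum (pIdeal A B.obj) (algebraMap A B.obj π) (fun i => B.sec (B.coeff hπ x i)) x :=
  (B.existsUnique_coeff hπ x).choose_spec.1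

theorem CRP.redMap_coeff {B C : CRP p A} (f : B ⟶ C) (hπ : Irreducible π) (x : B.obj) (i : ℕ) :
    redMap (toAlgHom f) (B.coeff hπ x i) = C.coeff hπ (toAlgHom f x) i := by
  have h : IsAdicSum (pIdeal A C.obj) (algebraMap A C.obj π)
      (fun i => C.sec (redMap (toAlgHom f) (B.coeff hπ x i))) (toAlgHom f x) := by
    intro n
    have h1 := Ideal.mem_map_of_mem (toAlgHom f).toRingHom (B.isAdicSum_coeff hπ x n)
    rw [Ideal.map_pow, Ideal.map_map] at h1
    have h2 : (toAlgHom f).toRingHom.comp (algebraMap A B.obj) = algebraMap A C.obj :=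
      (toAlgHom f).comp_algebraMap
    rw [h2] at h1
    simpa [CRP.map_sec] using h1
  exact congrFun ((C.existsUnique_coeff hπ _).unique h (C.isAdicSum_coeff hπ _)) i

end Coeffs

/-! ### The ring `R_T^pf` and the functor `U` -/

section Explicit

variable (p : ℕ) [Fact p.Prime] {A : Type u} [CommRing A] [IsDomain A]
  [IsDiscreteValuationRing A] [CharP (IsLocalRing.ResidueField A) p]

/-- The polynomial ring over the residue field of `A` in the variables `u_{t,j}`, for `t ∈ T` and
`j > 0`. -/
abbrev RT (T : Set A) : Type u := MvPolynomial (T × ℕ+) (IsLocalRing.ResidueField A)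

/-- The perfection of `R_T`. -/
abbrev RTpf (T : Set A) : Type u := PerfectClosure (RT T) p

/-- The inclusion of the residue field of `A` in `R_T^pf`. -/
def resToRTpf (T : Set A) : IsLocalRing.ResidueField A →+* RTpf p T :=
  (PerfectClosure.of (RT T) p).comp MvPolynomial.C

/-- The elements `t̄, u_{t,1}, u_{t,2}, …` of `R_T^pf`. -/
def uCoeff (T : Set A) (t : T) (j : ℕ) : RTpf p T :=
  if hj : 0 < j then PerfectClosure.of (RT T) p (MvPolynomial.X (t, ⟨j, hj⟩))
  else resToRTpf p T (IsLocalRing.residue A t)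

/-- `R_T^pf` as a perfect algebra over itself. -/
def RTpfObj (T : Set A) : PAlg p (RTpf p T) :=
  ⟨CommAlgCat.of (RTpf p T) (RTpf p T), isPerfect_perfectClosure p (RT T)⟩

/-- The fraction field of `R_T^pf` as a perfect `R_T^pf`-algebra. -/
def FrRTpfObj (T : Set A) : PAlg p (RTpf p T) :=
  ⟨CommAlgCat.of (RTpf p T) (FractionRing (RTpf p T)),
    isPerfect_fractionRing p (isPerfect_perfectClosure p (RT T))⟩

variable {p} {π : A}

/-- The map `R_T^pf → B / 𝔭_B` that on the residue field of `A` is the canonical one and sends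
`u_{t,j}` to the `j`-th coefficient of the image of `t` in `B`. -/
def CRP.structureMap (hπ : Irreducible π) (T : Set A) (B : CRP p A) :
    RTpf p T →+* Red A B.obj :=
  perfectLift p B.property.perfect
    (MvPolynomial.eval₂Hom (resToRed A B.obj)
      (fun tj : T × ℕ+ => B.coeff hπ (algebraMap A B.obj tj.1) tj.2))

theorem CRP.redMap_comp_structureMap (hπ : Irreducible π) (T : Set A) {B C : CRP p A}
    (f : B ⟶ C) :
    (redMap (toAlgHom f)).comp (B.structureMap hπ T) = C.structureMap hπ T := by
  refine perfectClosure_hom_ext p C.property.perfect ?_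
  rw [RingHom.comp_assoc, structureMap, structureMap, perfectLift_comp_of, perfectLift_comp_of]
  refine MvPolynomial.ringHom_ext (fun r => ?_) (fun tj => ?_)
  · obtain ⟨a, rfl⟩ := IsLocalRing.residue_surjective r
    simp only [RingHom.comp_apply, MvPolynomial.coe_eval₂Hom, MvPolynomial.eval₂_C]
    exact congrArg (Ideal.Quotient.mk (pIdeal A C.obj)) ((toAlgHom f).commutes a)
  · simp [CRP.redMap_coeff]

/-- The functor `U`: it sends `B` to `B / 𝔭_B` with the above structure of an `R_T^pf`-algebra. -/
def U (hπ : Irreducible π) (T : Set A) : CRP p A ⥤ PAlg p (RTpf p T) where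
  obj B := ⟨algOfRingHom (B.structureMap hπ T), B.property.perfect⟩
  map f := ObjectProperty.homMk
    (algHomOfRingHom (redMap (CRP.toAlgHom f)) (CRP.redMap_comp_structureMap hπ T f))
  map_id B := ObjectProperty.hom_ext _ (CommAlgCat.hom_ext (AlgHom.ext fun x => by
    obtain ⟨x, rfl⟩ := Ideal.Quotient.mk_surjective x
    rfl))
  map_comp f g := ObjectProperty.hom_ext _ (CommAlgCat.hom_ext (AlgHom.ext fun x => by
    obtain ⟨x, rfl⟩ := Ideal.Quotient.mk_surjective x
    rfl))

/-- The identification of the ring underlying `U(B)` with `B / 𝔭_B`. -/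
def U.toRed (hπ : Irreducible π) (T : Set A) (B : CRP p A) :
    ((U hπ T).obj B).obj ≃+* Red A B.obj :=
  RingEquiv.refl (Red A B.obj)

/-! ### The functor `V` in equal characteristic -/

variable (p)

/-- The conditions on the structure map `A → S⟦π̃⟧` in equal characteristic: it sends `π` to `π̃`,
it reduces modulo `π̃` to the given map from the residue field of `A` to `S`, and it sends every
`t ∈ T` to `t̄ + ∑ u_{t,j} π̃ ^ j`. -/
structure IsEqualMap (π : A) (T : Set A) (S : Type u) [CommRing S] [Algebra (RTpf p T) S]
    (φ : A →+* PowerSeries S) : Prop where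
  map_uniformizer : φ π = PowerSeries.X
  reduction : ∀ a : A, PowerSeries.constantCoeff (φ a) =
    algebraMap (RTpf p T) S (resToRTpf p T (IsLocalRing.residue A a))
  map_lift : ∀ t : T, φ t = PowerSeries.mk fun j => algebraMap (RTpf p T) S (uCoeff p T t j)

/-- There is exactly one such map for every perfect `R_T^pf`-algebra. -/
def EqualMapsExistUnique (π : A) (T : Set A) : Prop :=
  ∀ S : PAlg p (RTpf p T), ∃! φ : A →+* PowerSeries S.obj, IsEqualMap p π T S.obj φ

variable {p}

theorem IsEqualMap.map {T : Set A} {S S' : Type u} [CommRing S] [Algebra (RTpf p T) S]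
    [CommRing S'] [Algebra (RTpf p T) S'] {φ : A →+* PowerSeries S}
    (h : IsEqualMap p π T S φ) (f : S →ₐ[RTpf p T] S') :
    IsEqualMap p π T S' ((PowerSeries.map f.toRingHom).comp φ) where
  map_uniformizer := by simp [h.map_uniformizer]
  reduction a := by
    have := congrArg f (h.reduction a)
    rw [f.commutes] at this
    rw [← this, RingHom.comp_apply, ← PowerSeries.coeff_zero_eq_constantCoeff_apply,
      PowerSeries.coeff_map, PowerSeries.coeff_zero_eq_constantCoeff_apply]
    rfl
  map_lift t := by
    ext j
    simp [h.map_lift]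

/-- The structure map `A → S⟦π̃⟧`. -/
def equalMap {T : Set A} (h : EqualMapsExistUnique p π T) (S : PAlg p (RTpf p T)) :
    A →+* PowerSeries S.obj := (h S).choose

theorem map_comp_equalMap {T : Set A} (h : EqualMapsExistUnique p π T) {S S' : PAlg p (RTpf p T)}
    (f : S ⟶ S') :
    (PowerSeries.map f.hom.hom.toRingHom).comp (equalMap h S) = equalMap h S' :=
  (h S').unique ((h S).choose_spec.1.map f.hom.hom) (h S').choose_spec.1

/-- The functor `V` in equal characteristic, with values in the category of `A`-algebras:
`V(S) = S⟦π̃⟧` with the above structure map. -/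
def VEqual {T : Set A} (h : EqualMapsExistUnique p π T) :
    PAlg p (RTpf p T) ⥤ CommAlgCat.{u} A where
  obj S := algOfRingHom (equalMap h S)
  map f := algHomOfRingHom (PowerSeries.map f.hom.hom.toRingHom) (map_comp_equalMap h f)
  map_id S := CommAlgCat.hom_ext (AlgHom.ext fun x =>
    PowerSeries.ext (R := S.obj) fun n => PowerSeries.coeff_map _ n _)
  map_comp {S S' S''} f g := CommAlgCat.hom_ext (AlgHom.ext fun x =>
    PowerSeries.ext (R := S''.obj) fun n => by
      refine (PowerSeries.coeff_map _ n _).trans (Eq.symm ?_)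
      refine (PowerSeries.coeff_map _ n _).trans ?_
      exact congrArg g.hom.hom (PowerSeries.coeff_map _ n _))

/-- The identification of `S⟦π̃⟧` with `V(S)` in equal characteristic. -/
def VEqual.ofSeries {T : Set A} (h : EqualMapsExistUnique p π T) (S : PAlg p (RTpf p T)) :
    PowerSeries S.obj ≃+* (VEqual h).obj S :=
  RingEquiv.refl (PowerSeries S.obj)

/-! ### The functor `V` in mixed characteristic -/

variable (p)

/-- The Cohen subring of `A` determined by `T`: a subring of `A` that contains `T`, is a complete
discrete valuation ring with maximal ideal generated by `p`, and has the same residue field as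
`A`. -/
structure IsCohenSubring (T : Set A) (C : Subring A) : Prop where
  subset : T ⊆ C
  [isDVR : IsDiscreteValuationRing C]
  maximalIdeal_eq : IsLocalRing.maximalIdeal C = Ideal.span {(p : C)}
  complete : IsAdicComplete (IsLocalRing.maximalIdeal C) C
  residue_surjective : ∀ x : IsLocalRing.ResidueField A, ∃ c : C, IsLocalRing.residue A c = x

/-- The map `C[X] → A` that is the inclusion on `C` and sends `X` to `π`. -/
def polyToA (π : A) (C : Subring A) : Polynomial C →+* A :=
  Polynomial.eval₂RingHom C.subtype π

/-- The conditions on the map `C[X] → W(S)⟦π̃⟧` in mixed characteristic: it sends `X` to `π̃`, it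
reduces modulo `(p, π̃)` to the given map from the residue field of `A` to `S`, and it sends every
`t ∈ T` to `s_W(t̄) + ∑ s_W(u_{t,j}) π̃ ^ j`, where `s_W` is the Teichmüller map. -/
structure IsMixedMap {T : Set A} {C : Subring A} (hC : IsCohenSubring p T C) (S : Type u)
    [CommRing S] [Algebra (RTpf p T) S] (χ : Polynomial C →+* PowerSeries (WittVector p S)) :
    Prop where
  map_X : χ Polynomial.X = PowerSeries.X
  reduction : ∀ c : C,
    WittVector.constantCoeff (PowerSeries.constantCoeff (χ (Polynomial.C c))) =
      algebraMap (RTpf p T) S (resToRTpf p T (IsLocalRing.residue A c))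
  map_lift : ∀ t : T, χ (Polynomial.C ⟨t, hC.subset t.2⟩) =
    PowerSeries.mk fun j => WittVector.teichmuller p (algebraMap (RTpf p T) S (uCoeff p T t j))

variable {p}

/-- There is exactly one such map for every perfect `R_T^pf`-algebra. -/
def MixedMapsExistUnique {T : Set A} {C : Subring A} (hC : IsCohenSubring p T C) : Prop :=
  ∀ S : PAlg p (RTpf p T), ∃! χ : Polynomial C →+* PowerSeries (WittVector p S.obj),
    IsMixedMap p hC S.obj χ

theorem IsMixedMap.map {T : Set A} {C : Subring A} {hC : IsCohenSubring p T C} {S S' : Type u}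
    [CommRing S] [Algebra (RTpf p T) S] [CommRing S'] [Algebra (RTpf p T) S']
    {χ : Polynomial C →+* PowerSeries (WittVector p S)} (h : IsMixedMap p hC S χ)
    (f : S →ₐ[RTpf p T] S') :
    IsMixedMap p hC S' ((PowerSeries.map (WittVector.map f.toRingHom)).comp χ) where
  map_X := by simp [h.map_X]
  reduction c := by
    have := congrArg f (h.reduction c)
    rw [f.commutes] at this
    rw [← this, RingHom.comp_apply, ← PowerSeries.coeff_zero_eq_constantCoeff_apply,
      PowerSeries.coeff_map, PowerSeries.coeff_zero_eq_constantCoeff_apply]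
    exact WittVector.map_coeff _ _ _
  map_lift t := by
    ext1 j
    rw [RingHom.comp_apply, h.map_lift, PowerSeries.coeff_map, PowerSeries.coeff_mk,
      PowerSeries.coeff_mk, WittVector.map_teichmuller]
    exact congrArg _ (f.commutes _)

/-- The map `C[X] → W(S)⟦π̃⟧`. -/
def mixedMap {T : Set A} {C : Subring A} {hC : IsCohenSubring p T C}
    (h : MixedMapsExistUnique hC) (S : PAlg p (RTpf p T)) :
    Polynomial C →+* PowerSeries (WittVector p S.obj) := (h S).choose

theorem map_comp_mixedMap {T : Set A} {C : Subring A} {hC : IsCohenSubring p T C}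
    (h : MixedMapsExistUnique hC) {S S' : PAlg p (RTpf p T)} (f : S ⟶ S') :
    (PowerSeries.map (WittVector.map f.hom.hom.toRingHom)).comp (mixedMap h S) = mixedMap h S' :=
  (h S').unique ((h S).choose_spec.1.map f.hom.hom) (h S').choose_spec.1

/-- The functor `V` in mixed characteristic, with values in the category of `A`-algebras:
`V(S) = A ⊗_{C[X]} W(S)⟦π̃⟧`, where `A` is a `C[X]`-algebra via `X ↦ π`. -/
def VMixed (π : A) {T : Set A} {C : Subring A} {hC : IsCohenSubring p T C}
    (h : MixedMapsExistUnique hC) : PAlg p (RTpf p T) ⥤ CommAlgCat.{u} A where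
  obj S := CommAlgCat.of A (TensorRing (polyToA π C) (mixedMap h S))
  map f := CommAlgCat.ofHom (TensorRing.map (polyToA π C)
    (PowerSeries.map (WittVector.map f.hom.hom.toRingHom)) (map_comp_mixedMap h f))
  map_id S := CommAlgCat.hom_ext (TensorRing.algHom_ext fun x => by
    refine (TensorRing.map_inr _ _ (map_comp_mixedMap h (𝟙 S)) x).trans ?_
    refine congrArg (TensorRing.inr _ _) (PowerSeries.ext fun n => ?_)
    refine (PowerSeries.coeff_map _ n _).trans (WittVector.ext fun m => ?_)
    exact WittVector.map_coeff _ _ _)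
  map_comp f g := CommAlgCat.hom_ext (TensorRing.algHom_ext fun x => by
    refine (TensorRing.map_inr _ _ (map_comp_mixedMap h (f ≫ g)) x).trans (Eq.symm ?_)
    refine (congrArg (TensorRing.map _ _ (map_comp_mixedMap h g))
      (TensorRing.map_inr _ _ (map_comp_mixedMap h f) x)).trans ?_
    refine (TensorRing.map_inr _ _ (map_comp_mixedMap h g) _).trans ?_
    refine congrArg (TensorRing.inr _ _) (PowerSeries.ext fun n => ?_)
    simp only [PowerSeries.coeff_map]
    refine WittVector.ext fun m => ?_
    simp only [WittVector.map_coeff]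
    rfl)

/-- The map `W(S)⟦π̃⟧ → V(S) = A ⊗_{C[X]} W(S)⟦π̃⟧`, `f ↦ 1 ⊗ f`, in mixed characteristic. -/
def VMixed.ofSeries (π : A) {T : Set A} {C : Subring A} {hC : IsCohenSubring p T C}
    (h : MixedMapsExistUnique hC) (S : PAlg p (RTpf p T)) :
    PowerSeries (WittVector p S.obj) →+* (VMixed π h).obj S :=
  TensorRing.inr (polyToA π C) (mixedMap h S)

/-- `θ : W(B / 𝔭_B) → B` reduces to the identity of `B / 𝔭_B`. -/
def IsWittLift (B : CRP p A) (θ : WittVector p (Red A B.obj) →+* B.obj) : Prop :=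
  ∀ w, Ideal.Quotient.mk (pIdeal A B.obj) (θ w) = WittVector.constantCoeff w

/-! ### Universal and generic residual perfections -/

/-- Let `Au` be an initial object of the category of complete residual perfections of `A`. An
object `Ag` is a generic residual perfection if the reduction of `Au` is a domain and the reduction
of the unique morphism `Au → Ag` makes the reduction of `Ag` a fraction field of that of `Au`. -/
def IsGenericPerfection {Au : CRP p A} (hAu : Limits.IsInitial Au) (Ag : CRP p A) : Prop :=
  IsDomain (Red A Au.obj) ∧
    @IsFractionRing (Red A Au.obj) _ (Red A Ag.obj) _
      (redMap (CRP.toAlgHom (hAu.to Ag))).toAlgebra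

/-- A functor `V` from perfect `R_T^pf`-algebras to complete residual perfections of `A` describes
the universal and the generic residual perfection: an initial object `Au` (a universal residual
perfection) exists; for every such `Au`, the unique morphism `Au → V(R_T^pf)` is an isomorphism,
`V(Fr(R_T^pf))` is a generic residual perfection, and every generic residual perfection is
isomorphic to it by a unique isomorphism. -/
def DescribesUniversalAndGeneric (T : Set A) (V : PAlg p (RTpf p T) ⥤ CRP p A) : Prop :=
  (∃ Au : CRP p A, Nonempty (Limits.IsInitial Au)) ∧
  ∀ (Au : CRP p A) (hAu : Limits.IsInitial Au),
    IsIso (hAu.to (V.obj (RTpfObj p T))) ∧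
    IsGenericPerfection hAu (V.obj (FrRTpfObj p T)) ∧
    ∀ Ag : CRP p A, IsGenericPerfection hAu Ag →
      Nonempty (Unique (Ag ≅ V.obj (FrRTpfObj p T)))

end Explicit

end

end ResidualPerfection

open ResidualPerfection

/-!
If `x ≡ y` modulo `J n`, where `n ≥ 1` and `J` is a filtration with `p ∈ J 1`, then
`x ^ p ≡ y ^ p` modulo `J (n + 1)`. Start from a whole complete ring whose reduction modulo `J 1`
has a `p`-basis with lift `τ`, and in the `n`-th step replace the subring `G` by the one generated
by `τ`, the `p`-th powers of elements of `G`, `p G`, and `J (n + 1)`. In the `n`-th subring every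
element of `J 1` is a multiple of `p` modulo `J (n + 1)`, so the intersection of these subrings
still maps onto the reduction, but with kernel generated by `p`. In `A` this intersection is the
coefficient field, or the Cohen subring, containing `T`. In a fiber product `R ×_S D` it is the
graph of a ring map `R → D` with prescribed reduction and prescribed values on a lifted `p`-basis;
this gives the maps that define `V`.

A morphism of complete residual perfections is determined by its reduction, and it is an
isomorphism if its reduction is bijective. So the unit and counit are isomorphisms, and the
triangle identities and naturality hold, because they do after reduction, where everything is
expressed by the classes of `1 ⊗ s_W(x)` (or of constant series).

In mixed characteristic, Weierstrass preparation over `C` shows that `C[X] → A` is onto and kills a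
polynomial `P` whose constant coefficient is a unit times `p`. The image of `P` generates the kernel
of `W⟦X⟧ → V(S)`, and `X` is regular modulo it since `p` is regular in `W`; flatness and
completeness of `V(S)` follow.
-/

namespace ResidualPerfection

noncomputable section

/-! ### Frobenius bases -/

/-- The monomial `∏ (b i) ^ (α i)` in a family `b` of ring elements. -/
def monomialAt {R ι : Type*} [CommRing R] (b : ι → R) (α : ι →₀ ℕ) : R :=
  α.prod fun i e => b i ^ e

section MonomialAt

variable {R R' ι : Type*} [CommRing R] [CommRing R'] (b : ι → R)

@[simp]
theorem monomialAt_zero : monomialAt b 0 = 1 := Finsupp.prod_zero_index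

theorem monomialAt_add (α β : ι →₀ ℕ) :
    monomialAt b (α + β) = monomialAt b α * monomialAt b β :=
  Finsupp.prod_add_index' (fun _ => pow_zero _) (fun _ _ _ => pow_add _ _ _)

theorem monomialAt_single_one (i : ι) : monomialAt b (Finsupp.single i 1) = b i := by
  simp [monomialAt]

theorem map_monomialAt (f : R →+* R') (α : ι →₀ ℕ) :
    f (monomialAt b α) = monomialAt (f ∘ b) α := by
  simp [monomialAt, Finsupp.prod]

theorem monomialAt_nsmul (n : ℕ) (α : ι →₀ ℕ) : monomialAt b (n • α) = monomialAt b α ^ n := by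
  induction n with
  | zero => simp
  | succ n ih => rw [succ_nsmul, monomialAt_add, ih, pow_succ]

theorem monomialAt_mem {G : Subring R} (h : ∀ i, b i ∈ G) (α : ι →₀ ℕ) : monomialAt b α ∈ G :=
  G.prod_mem fun i _ => G.pow_mem (h i) _

end MonomialAt

/-- The exponents of the reduced monomials: multi-indices with all entries `< p`. -/
abbrev ReducedExponent (p : ℕ) (ι : Type*) := {α : ι →₀ ℕ // ∀ i, α i < p}

/-- The `p`-linear combination `∑ b ^ β * (c β) ^ p` of the reduced monomials in `b`. -/
def frobSum {p : ℕ} {R ι : Type*} [CommRing R] (b : ι → R) (c : ReducedExponent p ι →₀ R) : R :=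
  c.sum fun β y => monomialAt b β * y ^ p

/-- A version of `IsPBasis` for rings: every element is uniquely a `p`-linear combination of the
reduced monomials in `b`. Uniqueness is only required for `0`, which suffices in
characteristic `p`. -/
structure IsFrobeniusBasis (p : ℕ) {k ι : Type*} [CommRing k] (b : ι → k) : Prop where
  surjective : Function.Surjective (frobSum (p := p) b)
  eq_zero_of_frobSum_eq_zero : ∀ c : ReducedExponent p ι →₀ k, frobSum b c = 0 → c = 0

section FrobSum

variable {p : ℕ} {R R' ι : Type*} [CommRing R] [CommRing R'] (b : ι → R)

@[simp]
theorem frobSum_zero : frobSum b (0 : ReducedExponent p ι →₀ R) = 0 := Finsupp.sum_zero_index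

theorem frobSum_single (hp : p ≠ 0) (β : ReducedExponent p ι) (y : R) :
    frobSum b (Finsupp.single β y) = monomialAt b β * y ^ p :=
  Finsupp.sum_single_index (by rw [zero_pow hp, mul_zero])

theorem map_frobSum (hp : p ≠ 0) (f : R →+* R') (c : ReducedExponent p ι →₀ R) :
    f (frobSum b c) = frobSum (f ∘ b) (c.mapRange f (map_zero f)) := by
  rw [frobSum, frobSum, Finsupp.sum_mapRange_index (fun _ => by rw [zero_pow hp, mul_zero])]
  simp [Finsupp.sum, map_monomialAt]

theorem frobSum_mem {G G' : Subring R} (hb : ∀ i, b i ∈ G') (hG : ∀ y ∈ G, y ^ p ∈ G')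
    {c : ReducedExponent p ι →₀ R} (hc : ∀ β, c β ∈ G) : frobSum b c ∈ G' :=
  sum_mem fun β _ => mul_mem (monomialAt_mem b hb β) (hG _ (hc β))

theorem exists_add_pow_eq_of_mem [Fact p.Prime] (G : Subring R) {x y : R} (hx : x ∈ G)
    (hy : y ∈ G) : ∃ r ∈ G, (x + y) ^ p = x ^ p + y ^ p + p * r := by
  obtain ⟨r, hr⟩ := exists_add_pow_prime_eq (Fact.out : p.Prime) (⟨x, hx⟩ : G) ⟨y, hy⟩
  refine ⟨x * y * r, mul_mem (mul_mem hx hy) r.2, ?_⟩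
  have := congrArg Subtype.val hr
  push_cast at this
  rw [this]
  ring

theorem exists_frobSum_add_eq [Fact p.Prime] {b : ι → R} {G : Subring R} (hb : ∀ i, b i ∈ G)
    {c c' : ReducedExponent p ι →₀ R} (hc : ∀ β, c β ∈ G) (hc' : ∀ β, c' β ∈ G) :
    ∃ r ∈ G, frobSum b (c + c') = frobSum b c + frobSum b c' + p * r := by
  classical
  choose r hrG hr using fun β => exists_add_pow_eq_of_mem (p := p) G (hc β) (hc' β)
  have hzero : ∀ β ∈ c.support ∪ c'.support, monomialAt b β * (0 : R) ^ p = 0 := fun _ _ => by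
    rw [zero_pow (NeZero.ne p), mul_zero]
  refine ⟨∑ β ∈ c.support ∪ c'.support, monomialAt b β * r β,
    sum_mem fun β _ => mul_mem (monomialAt_mem b hb _) (hrG β), ?_⟩
  rw [frobSum, frobSum, frobSum, Finsupp.sum_of_support_subset _ Finsupp.support_add _ hzero,
    Finsupp.sum_of_support_subset c Finset.subset_union_left _ hzero,
    Finsupp.sum_of_support_subset c' Finset.subset_union_right _ hzero, Finset.mul_sum,
    ← Finset.sum_add_distrib, ← Finset.sum_add_distrib]
  refine Finset.sum_congr rfl fun β _ => ?_
  rw [Finsupp.add_apply, hr β]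
  ring

end FrobSum

theorem IsPBasis.isFrobeniusBasis {p : ℕ} {k ι : Type*} [Field k] [ExpChar k p] {b : ι → k}
    (hb : IsPBasis p b) : IsFrobeniusBasis p b := by
  let φ : k ≃+* (frobenius k p).fieldRange :=
    RingEquiv.ofBijective (frobenius k p).rangeRestrictField
      ⟨(frobenius k p).rangeRestrictField.injective, fun ⟨_, y, h⟩ => ⟨y, Subtype.ext h⟩⟩
  have frobSum_eq (c : ReducedExponent p ι →₀ k) :
      frobSum b c = Finsupp.linearCombination (frobenius k p).fieldRange
        (fun α : ReducedExponent p ι => α.1.prod fun i e => b i ^ e)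
        (c.mapRange φ (map_zero φ)) := by
    rw [Finsupp.linearCombination_apply, Finsupp.sum_mapRange_index (by simp)]
    exact Finsupp.sum_congr fun β _ => mul_comm _ _
  constructor
  · intro x
    obtain ⟨a, rfl⟩ := Finsupp.mem_span_range_iff_exists_finsupp.1
      (hb.span_eq_top ▸ Submodule.mem_top (x := x))
    obtain ⟨c, rfl⟩ := Finsupp.mapRange_surjective φ (map_zero φ) φ.surjective a
    exact ⟨c, frobSum_eq c⟩
  · intro c hc
    rw [frobSum_eq] at hc
    refine Finsupp.mapRange_injective φ (map_zero φ) φ.injective ?_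
    rw [linearIndependent_iff.1 hb.linearIndependent _ hc, Finsupp.mapRange_zero]

theorem IsPerfect.isFrobeniusBasis_elim {p : ℕ} [Fact p.Prime] {S : Type*} [CommRing S]
    (hS : IsPerfect p S) : IsFrobeniusBasis p (PEmpty.elim : PEmpty.{1} → S) := by
  let : Unique (ReducedExponent p PEmpty.{1}) :=
    ⟨⟨⟨0, fun i => i.elim⟩⟩, fun _ => Subtype.ext (Subsingleton.elim _ _)⟩
  have frobSum_eq (c : ReducedExponent p PEmpty.{1} →₀ S) :
      frobSum PEmpty.elim c = c default ^ p := by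
    rw [Finsupp.unique_single c, frobSum_single _ (NeZero.ne p), Finsupp.single_eq_same]
    exact (congrArg (· * _) (monomialAt_zero _)).trans (one_mul _)
  constructor
  · intro x
    obtain ⟨y, rfl⟩ := hS.2.2 x
    exact ⟨Finsupp.single default y, by rw [frobSum_eq, Finsupp.single_eq_same]⟩
  · intro c hc
    refine Finsupp.ext fun β => hS.2.1 ?_
    rw [Unique.eq_default β]
    simpa [zero_pow (NeZero.ne p), frobSum_eq] using hc

/-! ### Filtrations -/

/-- A decreasing multiplicative filtration by ideals, with `p` in filtration degree one. -/
structure IsFiltration (p : ℕ) {D : Type*} [CommRing D] (J : ℕ → Ideal D) : Prop where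
  zero_eq_top : J 0 = ⊤
  antitone : Antitone J
  mul_mem : ∀ {m n x y}, x ∈ J m → y ∈ J n → x * y ∈ J (m + n)
  p_mem : (p : D) ∈ J 1

/-- A filtration for which the ring is complete and separated. -/
structure IsCompleteFiltration (p : ℕ) {D : Type*} [CommRing D] (J : ℕ → Ideal D) : Prop
    extends IsFiltration p J where
  eq_zero : ∀ x, (∀ n, x ∈ J n) → x = 0
  exists_limit : ∀ x : ℕ → D, (∀ n, x (n + 1) - x n ∈ J n) → ∃ L, ∀ n, L - x n ∈ J n

section Filtration

variable {p : ℕ} {D : Type*} [CommRing D] {J : ℕ → Ideal D}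

theorem IsFiltration.p_pow_mem (hJ : IsFiltration p J) (n : ℕ) : (p : D) ^ n ∈ J n := by
  induction n with
  | zero => simp [hJ.zero_eq_top]
  | succ n ih => exact pow_succ (p : D) n ▸ hJ.mul_mem ih hJ.p_mem

theorem IsFiltration.p_mul_mem (hJ : IsFiltration p J) {n : ℕ} {x : D} (hx : x ∈ J n) :
    (p : D) * x ∈ J (n + 1) := by
  rw [add_comm]
  exact hJ.mul_mem hJ.p_mem hx

theorem IsFiltration.pow_p_mem [Fact p.Prime] (hJ : IsFiltration p J) {n : ℕ} {x : D}
    (hx : x ∈ J (n + 1)) : x ^ p ∈ J (n + 2) := by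
  rw [← pow_mul_pow_sub x (Fact.out : p.Prime).two_le, sq]
  exact Ideal.mul_mem_right _ _ (hJ.antitone (by lia) (hJ.mul_mem hx hx))

theorem IsFiltration.pow_sub_pow_mem [Fact p.Prime] (hJ : IsFiltration p J) {n : ℕ}
    {x y : D} (h : x - y ∈ J (n + 1)) : x ^ p - y ^ p ∈ J (n + 2) := by
  obtain ⟨r, hr⟩ := exists_add_pow_prime_eq (Fact.out : p.Prime) y (x - y)
  have hsub : x ^ p - y ^ p = (x - y) ^ p + p * (x - y) * (y * r) := by
    rw [add_sub_cancel] at hr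
    linear_combination hr
  rw [hsub]
  exact add_mem (hJ.pow_p_mem h) (Ideal.mul_mem_right _ _ (hJ.p_mul_mem h))

theorem IsFiltration.sub_mem_of_forall_succ_sub_mem (hJ : IsFiltration p J) {x : ℕ → D} {k : ℕ}
    (hx : ∀ n, x (n + 1) - x n ∈ J (k + n)) (n m : ℕ) : x (n + m) - x n ∈ J (k + n) := by
  induction m with
  | zero => simp
  | succ m ih =>
    have := add_mem (hJ.antitone (by lia) (hx (n + m))) ih
    rwa [sub_add_sub_cancel] at this

theorem IsCompleteFiltration.exists_limit_add (hJ : IsCompleteFiltration p J) {x : ℕ → D} {k : ℕ}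
    (hx : ∀ n, x (n + 1) - x n ∈ J (k + n)) : ∃ L, ∀ n, L - x n ∈ J (k + n) := by
  obtain ⟨L, hL⟩ := hJ.exists_limit x fun n => hJ.antitone (Nat.le_add_left n k) (hx n)
  refine ⟨L, fun n => ?_⟩
  have := add_mem (hJ.antitone (by lia) (hL (n + (k + n))))
    (hJ.sub_mem_of_forall_succ_sub_mem hx n (k + n))
  rwa [sub_add_sub_cancel] at this

theorem isCompleteFiltration_pow {I : Ideal D} (hI : IsAdicComplete I D) (hp : (p : D) ∈ I) :
    IsCompleteFiltration p (fun n => I ^ n) where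
  zero_eq_top := by rw [pow_zero, Ideal.one_eq_top]
  antitone := fun _ _ h => Ideal.pow_le_pow_right h
  mul_mem hx hy := by rw [pow_add]; exact Ideal.mul_mem_mul hx hy
  p_mem := by simpa using hp
  eq_zero x h := eq_of_forall_sub_mem I fun n => by simpa using h n
  exists_limit x hx := by
    obtain ⟨L, hL⟩ := IsPrecomplete.prec (I := I) (M := D) inferInstance (f := x) (by
      intro m n hmn
      induction n, hmn using Nat.le_induction with
      | base => rfl
      | succ n hmn ih =>
        refine ih.trans (SModEq.symm (SModEq.sub_mem.2 ?_))
        simpa using Ideal.pow_le_pow_right hmn (hx n))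
    exact ⟨L, fun n => by simpa using SModEq.sub_mem.1 (hL n).symm⟩

theorem isAdicComplete_of_exists_limit {I : Ideal D} (heq_zero : ∀ x, (∀ n, x ∈ I ^ n) → x = 0)
    (hlimit : ∀ x : ℕ → D, (∀ n, x (n + 1) - x n ∈ I ^ n) → ∃ L, ∀ n, L - x n ∈ I ^ n) :
    IsAdicComplete I D where
  haus' x hx := heq_zero x fun n => by simpa using SModEq.sub_mem.1 (hx n)
  prec' f hf := by
    obtain ⟨L, hL⟩ := hlimit f fun n => by
      simpa using SModEq.sub_mem.1 (hf (Nat.le_succ n)).symm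
    exact ⟨L, fun n => SModEq.symm (SModEq.sub_mem.2 (by simpa using hL n))⟩

theorem isCompleteFiltration_bot_pow (hp : (p : D) = 0) :
    IsCompleteFiltration p (fun n => (⊥ : Ideal D) ^ n) :=
  isCompleteFiltration_pow inferInstance (hp ▸ zero_mem _)

end Filtration

/-! ### The tower of subrings attached to a lift of a Frobenius basis -/

/-- The elements of the form `m * (g ^ p + p * h)` modulo `I`, where `m` is a monomial in `τ` and
`g` and `h` belong to `G`. -/
def frobMonoid (p : ℕ) {E ι : Type*} [CommRing E] (I : Ideal E) (τ : ι → E) (G : Subring E) :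
    Submonoid E where
  carrier := {x | ∃ α, ∃ g ∈ G, ∃ h ∈ G, x - monomialAt τ α * (g ^ p + p * h) ∈ I}
  one_mem' := ⟨0, 1, one_mem _, 0, zero_mem _, by simp⟩
  mul_mem' := by
    rintro x y ⟨α, g, hg, h, hh, hx⟩ ⟨β, g', hg', h', hh', hy⟩
    refine ⟨α + β, g * g', mul_mem hg hg', g ^ p * h' + h * g' ^ p + p * h * h',
      add_mem (add_mem (mul_mem (pow_mem hg _) hh') (mul_mem hh (pow_mem hg' _)))
        (mul_mem (mul_mem (natCast_mem _ _) hh) hh'), ?_⟩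
    convert add_mem (I.mul_mem_left y hx)
      (I.mul_mem_left (monomialAt τ α * (g ^ p + p * h)) hy) using 1
    rw [monomialAt_add]
    ring

/-- The subring generated by `I`, the monomials in `τ`, the `p`-th powers of the elements of `G`,
and `p G`. -/
def frobStep (p : ℕ) {E ι : Type*} [CommRing E] (I : Ideal E) (τ : ι → E) (G : Subring E) :
    Subring E :=
  Subring.closure (frobMonoid p I τ G)

section FrobStep

variable {p : ℕ} {E ι : Type*} [CommRing E] {I I' : Ideal E} {τ : ι → E} {G G' : Subring E}

theorem frobStep_mono (hI : I ≤ I') (hG : G ≤ G') : frobStep p I τ G ≤ frobStep p I' τ G' :=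
  Subring.closure_mono fun _ ⟨α, g, hg, h, hh, hx⟩ => ⟨α, g, hG hg, h, hG hh, hI hx⟩

theorem pow_mem_frobStep {g : E} (hg : g ∈ G) : g ^ p ∈ frobStep p I τ G :=
  Subring.subset_closure ⟨0, g, hg, 0, zero_mem _, by simp⟩

theorem lift_mem_frobStep (i : ι) : τ i ∈ frobStep p I τ G :=
  Subring.subset_closure ⟨Finsupp.single i 1, 1, one_mem _, 0, zero_mem _, by
    simp [monomialAt_single_one]⟩

variable [Fact p.Prime]

theorem mem_frobStep_of_mem_ideal {x : E} (hx : x ∈ I) : x ∈ frobStep p I τ G :=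
  Subring.subset_closure ⟨0, 0, zero_mem _, 0, zero_mem _, by simpa [NeZero.ne p] using hx⟩

theorem p_mul_mem_frobStep {h : E} (hh : h ∈ G) : (p : E) * h ∈ frobStep p I τ G :=
  Subring.subset_closure ⟨0, 0, zero_mem _, h, hh, by simp [NeZero.ne p]⟩

theorem exists_frobSum_eq_monomialAt_mul_pow (hτ : ∀ i, τ i ∈ G) (α : ι →₀ ℕ) {g : E}
    (hg : g ∈ G) : ∃ c : ReducedExponent p ι →₀ E,
      (∀ β, c β ∈ G) ∧ frobSum τ c = monomialAt τ α * g ^ p := by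
  classical
  let β : ReducedExponent p ι := ⟨α.mapRange (· % p) (Nat.zero_mod p), fun i => by
    rw [Finsupp.mapRange_apply]
    exact Nat.mod_lt _ (NeZero.pos p)⟩
  let γ : ι →₀ ℕ := α.mapRange (· / p) (Nat.zero_div p)
  have hα : α = β.1 + p • γ := by
    ext i
    simp [β, γ, Nat.mod_add_div]
  refine ⟨Finsupp.single β (monomialAt τ γ * g), fun δ => ?_, ?_⟩
  · rw [Finsupp.single_apply]
    split_ifs
    · exact mul_mem (monomialAt_mem τ hτ _) hg
    · exact zero_mem _
  · rw [frobSum_single _ (NeZero.ne p), hα, monomialAt_add, monomialAt_nsmul]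
    ring

theorem exists_frobSum_of_mem_frobStep (hτ : ∀ i, τ i ∈ G) {x : E} (hx : x ∈ frobStep p I τ G) :
    ∃ c : ReducedExponent p ι →₀ E, (∀ β, c β ∈ G) ∧ ∃ h ∈ G,
      x - (frobSum τ c + p * h) ∈ I := by
  rw [frobStep, Subring.mem_closure_iff, Submonoid.closure_eq] at hx
  induction hx using AddSubgroup.closure_induction with
  | mem x hx =>
    obtain ⟨α, g, hg, h, hh, hx⟩ := hx
    obtain ⟨c, hc, hcg⟩ := exists_frobSum_eq_monomialAt_mul_pow (p := p) hτ α hg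
    refine ⟨c, hc, monomialAt τ α * h, mul_mem (monomialAt_mem τ hτ _) hh, ?_⟩
    convert hx using 1
    rw [hcg]
    ring
  | zero => exact ⟨0, fun _ => zero_mem _, 0, zero_mem _, by simp⟩
  | add x y _ _ hx hy =>
    obtain ⟨c, hc, h, hh, hx⟩ := hx
    obtain ⟨c', hc', h', hh', hy⟩ := hy
    obtain ⟨r, hr, hcc'⟩ := exists_frobSum_add_eq hτ hc hc'
    refine ⟨c + c', fun β => add_mem (hc β) (hc' β), h + h' - r,
      sub_mem (add_mem hh hh') hr, ?_⟩
    convert add_mem hx hy using 1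
    rw [hcc']
    ring
  | neg x _ hx =>
    obtain ⟨c, hc, h, hh, hx⟩ := hx
    obtain ⟨r, hr, hcc'⟩ := exists_frobSum_add_eq (c' := -c) hτ hc fun β => neg_mem (hc β)
    refine ⟨-c, fun β => neg_mem (hc β), r - h, sub_mem hr hh, ?_⟩
    rw [add_neg_cancel, frobSum_zero] at hcc'
    convert neg_mem hx using 1
    linear_combination hcc'

theorem exists_mem_frobStep_sub_mem {J : ℕ → Ideal E} (hJ : IsFiltration p J) {n : ℕ}
    (hG : ∀ g ∈ G, ∃ g' ∈ G', g - g' ∈ J (n + 1)) {x : E}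
    (hx : x ∈ frobStep p (J (n + 2)) τ G) : ∃ y ∈ frobStep p I τ G', x - y ∈ J (n + 2) := by
  let π := Ideal.Quotient.mk (J (n + 2))
  suffices h : frobStep p (J (n + 2)) τ G ≤ ((frobStep p I τ G').map π).comap π by
    obtain ⟨y, hy, hxy⟩ := h hx
    exact ⟨y, hy, Ideal.Quotient.eq.1 hxy.symm⟩
  refine Subring.closure_le.2 fun z ⟨α, g, hg, h, hh, hz⟩ => ?_
  obtain ⟨g', hg', hgg'⟩ := hG g hg
  obtain ⟨h', hh', hhh'⟩ := hG h hh
  refine ⟨monomialAt τ α * (g' ^ p + p * h'),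
    Subring.subset_closure ⟨α, g', hg', h', hh', by simp⟩, (Ideal.Quotient.eq.2 ?_).symm⟩
  convert add_mem hz (Ideal.mul_mem_left _ (monomialAt τ α)
    (add_mem (hJ.pow_sub_pow_mem hgg') (hJ.p_mul_mem hhh'))) using 1
  ring

variable {k : Type*} [CommRing k] {ρ : E →+* k} {b : ι → k}

theorem IsFrobeniusBasis.exists_frobSum_sub_mem_ker (hb : IsFrobeniusBasis p b)
    (hρ : Function.Surjective ρ) (hτ : ∀ i, ρ (τ i) = b i) (x : E) :
    ∃ c : ReducedExponent p ι →₀ E, x - frobSum τ c ∈ RingHom.ker ρ := by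
  obtain ⟨a, ha⟩ := hb.surjective (ρ x)
  obtain ⟨c, rfl⟩ := Finsupp.mapRange_surjective ρ (map_zero ρ) hρ a
  refine ⟨c, ?_⟩
  rw [RingHom.mem_ker, map_sub, map_frobSum τ (NeZero.ne p), (funext hτ : ρ ∘ τ = b), ha, sub_self]

theorem IsFrobeniusBasis.exists_eq_p_mul_of_mem_frobStep (hb : IsFrobeniusBasis p b)
    (hτ : ∀ i, ρ (τ i) = b i) (hτG : ∀ i, τ i ∈ G) (hI : I ≤ RingHom.ker ρ)
    (hp : (p : E) ∈ RingHom.ker ρ)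
    (hpow : ∀ y ∈ G, y ∈ RingHom.ker ρ → ∃ g ∈ G, y ^ p - p * g ∈ I) {x : E}
    (hx : x ∈ frobStep p I τ G) (hρx : x ∈ RingHom.ker ρ) : ∃ h ∈ G, x - p * h ∈ I := by
  obtain ⟨c, hcG, h, hh, hxc⟩ := exists_frobSum_of_mem_frobStep hτG hx
  have hρsum : ρ (frobSum τ c) = 0 := by
    convert sub_mem (sub_mem hρx (hI hxc)) (Ideal.mul_mem_right h _ hp) using 1
    rw [RingHom.mem_ker]
    ring_nf
  rw [map_frobSum τ (NeZero.ne p), (funext hτ : ρ ∘ τ = b)] at hρsum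
  have hρc : ∀ β, c β ∈ RingHom.ker ρ :=
    DFunLike.congr_fun (hb.eq_zero_of_frobSum_eq_zero _ hρsum)
  choose g hg hcg using fun β => hpow (c β) (hcG β) (hρc β)
  refine ⟨∑ β ∈ c.support, monomialAt τ β * g β + h,
    add_mem (sum_mem fun β _ => mul_mem (monomialAt_mem τ hτG _) (hg β)) hh, ?_⟩
  convert add_mem hxc (sum_mem fun β (_ : β ∈ c.support) =>
    Ideal.mul_mem_left I (monomialAt τ β) (hcg β)) using 1
  simp only [mul_sub, Finset.sum_sub_distrib, mul_add, Finset.mul_sum, frobSum, Finsupp.sum,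
    mul_left_comm (p : E)]
  ring

end FrobStep

/-- The decreasing subrings obtained from the whole ring by iterating `frobStep` along the
filtration `J`. -/
def tower (p : ℕ) {E ι : Type*} [CommRing E] (J : ℕ → Ideal E) (τ : ι → E) : ℕ → Subring E
  | 0 => ⊤
  | n + 1 => frobStep p (J (n + 2)) τ (tower p J τ n)

section Tower

variable {p : ℕ} {E ι : Type*} [CommRing E] {J : ℕ → Ideal E} {τ : ι → E}

theorem lift_mem_tower (n : ℕ) (i : ι) : τ i ∈ tower p J τ n := by
  cases n with
  | zero => exact Subring.mem_top _
  | succ n => exact lift_mem_frobStep i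

theorem pow_pow_mem_tower (x : E) (n : ℕ) : x ^ p ^ n ∈ tower p J τ n := by
  induction n with
  | zero => exact Subring.mem_top _
  | succ n ih =>
    rw [pow_succ, pow_mul]
    exact pow_mem_frobStep ih

theorem tower_antitone (hJ : IsFiltration p J) : Antitone (tower p J τ) :=
  antitone_nat_of_succ_le fun n => by
    induction n with
    | zero => exact le_top
    | succ n ih => exact frobStep_mono (hJ.antitone (by lia)) ih

variable [Fact p.Prime]

theorem mem_tower_of_mem_ideal {n : ℕ} {x : E} (hx : x ∈ J (n + 1)) : x ∈ tower p J τ n := by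
  cases n with
  | zero => exact Subring.mem_top x
  | succ n => exact mem_frobStep_of_mem_ideal hx

theorem mem_tower_of_sub_mem_ideal {n : ℕ} {x y : E} (hxy : x - y ∈ J (n + 1))
    (hy : y ∈ tower p J τ n) : x ∈ tower p J τ n := by
  simpa using add_mem (mem_tower_of_mem_ideal hxy) hy

variable {k : Type*} [CommRing k] {ρ : E →+* k} {b : ι → k}

theorem exists_mem_tower_succ_sub_mem (hJ : IsFiltration p J) (hb : IsFrobeniusBasis p b)
    (hρ : Function.Surjective ρ) (hker : RingHom.ker ρ = J 1) (hτ : ∀ i, ρ (τ i) = b i) {n : ℕ}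
    {x : E} (hx : x ∈ tower p J τ n) : ∃ y ∈ tower p J τ (n + 1), x - y ∈ J (n + 1) := by
  induction n generalizing x with
  | zero =>
    obtain ⟨c, hc⟩ := hb.exists_frobSum_sub_mem_ker hρ hτ x
    exact ⟨frobSum τ c, frobSum_mem τ (G := ⊤) (lift_mem_tower 1) (fun _ => pow_mem_frobStep)
      fun _ => Subring.mem_top _, hker ▸ hc⟩
  | succ n ih => exact exists_mem_frobStep_sub_mem hJ (fun _ => ih) hx

theorem exists_eq_p_mul_of_mem_tower (hJ : IsFiltration p J) (hb : IsFrobeniusBasis p b)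
    (hker : RingHom.ker ρ = J 1) (hτ : ∀ i, ρ (τ i) = b i) {n : ℕ} {x : E}
    (hx : x ∈ tower p J τ (n + 1)) (hρx : x ∈ RingHom.ker ρ) :
    ∃ h ∈ tower p J τ n, x - p * h ∈ J (n + 2) := by
  induction n generalizing x with
  | zero =>
    refine hb.exists_eq_p_mul_of_mem_frobStep hτ (lift_mem_tower 0)
      (hker ▸ hJ.antitone (by lia)) (hker ▸ hJ.p_mem)
      (fun y _ hρy => ⟨0, zero_mem _, ?_⟩) hx hρx
    simpa using hJ.pow_p_mem (hker ▸ hρy)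
  | succ n ih =>
    refine hb.exists_eq_p_mul_of_mem_frobStep hτ (lift_mem_tower _)
      (hker ▸ hJ.antitone (by lia)) (hker ▸ hJ.p_mem) (fun y hy hρy => ?_) hx hρx
    obtain ⟨h, hh, hyh⟩ := ih hy hρy
    refine ⟨p * (p ^ (p - 2) * h ^ p), p_mul_mem_frobStep
      (mul_mem (pow_mem (natCast_mem _ _) _) (pow_mem hh _)), ?_⟩
    have hpow : (p : E) * (p * (p ^ (p - 2) * h ^ p)) = (p * h) ^ p := by
      rw [mul_pow, ← pow_mul_pow_sub (p : E) (Fact.out : p.Prime).two_le, sq]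
      ring
    rw [hpow]
    exact hJ.pow_sub_pow_mem hyh

end Tower

/-- The intersection of the tower. For a complete filtration whose first step is the kernel of a map
to a ring with a Frobenius basis, it is a Cohen ring in a generalized sense: modulo `p` it is the
target of that map. -/
def limitSubring (p : ℕ) {E ι : Type*} [CommRing E] (J : ℕ → Ideal E) (τ : ι → E) : Subring E :=
  ⨅ n, tower p J τ n

section LimitSubring

variable {p : ℕ} {E ι : Type*} [CommRing E] {J : ℕ → Ideal E} {τ : ι → E} {x : E}

theorem mem_limitSubring : x ∈ limitSubring p J τ ↔ ∀ n, x ∈ tower p J τ n := Subring.mem_iInf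

theorem lift_mem_limitSubring (i : ι) : τ i ∈ limitSubring p J τ :=
  mem_limitSubring.2 fun n => lift_mem_tower n i

theorem inv_mem_limitSubring (hp : p ≠ 0) {y : E} (hx : x ∈ limitSubring p J τ) (hxy : x * y = 1) :
    y ∈ limitSubring p J τ := by
  refine mem_limitSubring.2 fun n => ?_
  obtain ⟨m, hm⟩ := Nat.exists_eq_succ_of_ne_zero (pow_ne_zero n hp)
  have hy : y = x ^ m * y ^ p ^ n := by
    rw [hm, pow_succ, ← mul_assoc, ← mul_pow, hxy, one_pow, one_mul]
  rw [hy]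
  exact mul_mem (pow_mem (mem_limitSubring.1 hx n) m) (pow_pow_mem_tower y n)

variable [Fact p.Prime]

theorem mem_limitSubring_of_forall_exists (h : ∀ n, ∃ y ∈ limitSubring p J τ, x - y ∈ J n) :
    x ∈ limitSubring p J τ := by
  refine mem_limitSubring.2 fun n => ?_
  obtain ⟨y, hy, hxy⟩ := h (n + 1)
  exact mem_tower_of_sub_mem_ideal hxy (mem_limitSubring.1 hy n)

variable {k : Type*} [CommRing k] {ρ : E →+* k} {b : ι → k}

theorem exists_mem_limitSubring_sub_mem (hJ : IsCompleteFiltration p J)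
    (hb : IsFrobeniusBasis p b) (hρ : Function.Surjective ρ) (hker : RingHom.ker ρ = J 1)
    (hτ : ∀ i, ρ (τ i) = b i) {n : ℕ} (hx : x ∈ tower p J τ n) :
    ∃ y ∈ limitSubring p J τ, x - y ∈ J (n + 1) := by
  choose s hs hxs using fun (m : ℕ) (y : tower p J τ m) =>
    exists_mem_tower_succ_sub_mem hJ.toIsFiltration hb hρ hker hτ y.2
  let y : ∀ m, tower p J τ (n + m) := fun m =>
    Nat.rec (motive := fun m => tower p J τ (n + m)) ⟨x, hx⟩
      (fun m z => ⟨s (n + m) z, hs (n + m) z⟩) m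
  obtain ⟨L, hL⟩ := hJ.exists_limit_add (x := fun m => (y m : E)) (k := n + 1) fun m => by
    rw [← neg_sub, add_right_comm]
    exact neg_mem (hxs (n + m) (y m))
  refine ⟨L, mem_limitSubring.2 fun m => ?_, ?_⟩
  · exact mem_tower_of_sub_mem_ideal (hJ.antitone (by lia) (hL m))
      (tower_antitone hJ.toIsFiltration (Nat.le_add_left m n) (y m).2)
  · rw [← neg_sub]
    exact neg_mem (hL 0)

theorem exists_mem_limitSubring_map_eq (hJ : IsCompleteFiltration p J)
    (hb : IsFrobeniusBasis p b) (hρ : Function.Surjective ρ) (hker : RingHom.ker ρ = J 1)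
    (hτ : ∀ i, ρ (τ i) = b i) (a : k) : ∃ y ∈ limitSubring p J τ, ρ y = a := by
  obtain ⟨x, rfl⟩ := hρ a
  obtain ⟨y, hy, hxy⟩ := exists_mem_limitSubring_sub_mem hJ hb hρ hker hτ (n := 0)
    (Subring.mem_top x)
  rw [zero_add, ← hker, RingHom.sub_mem_ker_iff] at hxy
  exact ⟨y, hy, hxy.symm⟩

theorem exists_eq_p_mul_of_mem_limitSubring (hJ : IsCompleteFiltration p J)
    (hb : IsFrobeniusBasis p b) (hρ : Function.Surjective ρ) (hker : RingHom.ker ρ = J 1)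
    (hτ : ∀ i, ρ (τ i) = b i) (hx : x ∈ limitSubring p J τ) (hρx : x ∈ RingHom.ker ρ) (n : ℕ) :
    ∃ h ∈ limitSubring p J τ, x - p * h ∈ J n := by
  obtain ⟨h, hh, hxh⟩ := exists_eq_p_mul_of_mem_tower hJ.toIsFiltration hb hker hτ
    (mem_limitSubring.1 hx (n + 1)) hρx
  obtain ⟨h', hh', hhh'⟩ := exists_mem_limitSubring_sub_mem hJ hb hρ hker hτ hh
  refine ⟨h', hh', hJ.antitone (by lia : n ≤ n + 2) ?_⟩
  convert add_mem hxh (hJ.p_mul_mem hhh') using 1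
  ring

end LimitSubring

/-! ### Lifting ring maps -/

section FiberProduct

variable {p : ℕ} {R D S : Type*} [CommRing R] [CommRing D] [CommRing S] {f : R →+* S} {q : D →+* S}

/-- The fiber product `R ×_S D` as a subring of the product. -/
def fiberProduct (f : R →+* S) (q : D →+* S) : Subring (R × D) :=
  (f.comp (RingHom.fst R D)).eqLocus (q.comp (RingHom.snd R D))

/-- The projection of the fiber product to the first factor. -/
def fiberProduct.fst (f : R →+* S) (q : D →+* S) : fiberProduct f q →+* R :=
  (RingHom.fst R D).comp (fiberProduct f q).subtype

/-- The projection of the fiber product to the second factor. -/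
def fiberProduct.snd (f : R →+* S) (q : D →+* S) : fiberProduct f q →+* D :=
  (RingHom.snd R D).comp (fiberProduct f q).subtype

theorem fiberProduct.map_fst_eq_map_snd (e : fiberProduct f q) : f (fst f q e) = q (snd f q e) :=
  e.2

theorem fiberProduct.fst_surjective (hq : Function.Surjective q) :
    Function.Surjective (fst f q) := fun x => by
  obtain ⟨y, hy⟩ := hq (f x)
  exact ⟨⟨(x, y), hy.symm⟩, rfl⟩

/-- The filtration induced on the fiber product by filtrations of the factors. -/
def fiberFiltration (f : R →+* S) (q : D →+* S) (I : ℕ → Ideal R) (J : ℕ → Ideal D) (n : ℕ) :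
    Ideal (fiberProduct f q) :=
  ((I n).prod (J n)).comap (fiberProduct f q).subtype

variable {I : ℕ → Ideal R} {J : ℕ → Ideal D}

theorem mem_fiberFiltration {n : ℕ} {e : fiberProduct f q} :
    e ∈ fiberFiltration f q I J n ↔ fiberProduct.fst f q e ∈ I n ∧ fiberProduct.snd f q e ∈ J n :=
  Iff.rfl

theorem IsFiltration.fiberProduct (hI : IsFiltration p I) (hJ : IsFiltration p J) :
    IsFiltration p (fiberFiltration f q I J) where
  zero_eq_top := Ideal.eq_top_iff_one _ |>.2
    ⟨hI.zero_eq_top ▸ Submodule.mem_top, hJ.zero_eq_top ▸ Submodule.mem_top⟩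
  antitone _ _ h _ he := ⟨hI.antitone h he.1, hJ.antitone h he.2⟩
  mul_mem hx hy := ⟨hI.mul_mem hx.1 hy.1, hJ.mul_mem hx.2 hy.2⟩
  p_mem := ⟨hI.p_mem, hJ.p_mem⟩

theorem IsCompleteFiltration.fiberProduct (hI : IsCompleteFiltration p I)
    (hJ : IsCompleteFiltration p J) (hf : I 1 ≤ RingHom.ker f) (hq : J 1 ≤ RingHom.ker q) :
    IsCompleteFiltration p (fiberFiltration f q I J) where
  toIsFiltration := hI.toIsFiltration.fiberProduct hJ.toIsFiltration
  eq_zero e he := Subtype.ext (Prod.ext (hI.eq_zero _ fun n => (he n).1)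
    (hJ.eq_zero _ fun n => (he n).2))
  exists_limit e he := by
    obtain ⟨x, hx⟩ := hI.exists_limit (fun n => (e n).1.1) fun n => (he n).1
    obtain ⟨y, hy⟩ := hJ.exists_limit (fun n => (e n).1.2) fun n => (he n).2
    have hxy : f x = q y := by
      rw [RingHom.sub_mem_ker_iff f |>.1 (hf (hx 1)), RingHom.sub_mem_ker_iff q |>.1 (hq (hy 1))]
      exact (e 1).2
    exact ⟨⟨(x, y), hxy⟩, fun n => ⟨hx n, hy n⟩⟩

end FiberProduct

theorem ker_id_eq_span_natCast {p : ℕ} {k : Type*} [CommRing k] (hk : (p : k) = 0) :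
    RingHom.ker (RingHom.id k) = Ideal.span {(p : k)} := by
  rw [hk, Ideal.span_singleton_zero]
  exact (RingHom.ker_eq_bot_iff_eq_zero _).2 fun _ => id

section Lifting

variable {p : ℕ} [Fact p.Prime] {k ι C D S : Type*} [CommRing k] [CommRing C] [CommRing D]
  [CommRing S] {b : ι → k} {ρ : C →+* k} {t : ι → C} {J : ℕ → Ideal D}

theorem IsFrobeniusBasis.ringHom_ext (hb : IsFrobeniusBasis p b) (hρ : Function.Surjective ρ)
    (hker : RingHom.ker ρ = Ideal.span {(p : C)}) (ht : ∀ i, ρ (t i) = b i)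
    (hJ : IsFiltration p J) (heq_zero : ∀ x, (∀ n, x ∈ J n) → x = 0) {g g' : C →+* D}
    (hmod : ∀ c, g c - g' c ∈ J 1) (hgt : ∀ i, g (t i) = g' (t i)) : g = g' := by
  have sub_mem_of_sub_mem : ∀ n c, g c - g' c ∈ J (n + 1) := by
    intro n
    induction n with
    | zero => exact hmod
    | succ n ih =>
      intro c
      obtain ⟨a, ha⟩ := hb.exists_frobSum_sub_mem_ker hρ ht c
      obtain ⟨c', hc'⟩ := Ideal.mem_span_singleton.1 (hker ▸ ha)
      have hsum : g (frobSum t a) - g' (frobSum t a) =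
          ∑ β ∈ a.support, monomialAt (g' ∘ t) β * (g (a β) ^ p - g' (a β) ^ p) := by
        simp only [frobSum, Finsupp.sum, map_sum, map_mul, map_pow, map_monomialAt,
          (funext hgt : g ∘ t = g' ∘ t), mul_sub, Finset.sum_sub_distrib]
      have hc : g c - g' c = p * (g c' - g' c') + (g (frobSum t a) - g' (frobSum t a)) := by
        rw [sub_eq_iff_eq_add.1 hc']
        simp only [map_add, map_mul, map_natCast]
        ring
      rw [hc, hsum]
      exact add_mem (hJ.p_mul_mem (ih c')) (sum_mem fun β _ => Ideal.mul_mem_left _ _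
        (hJ.pow_sub_pow_mem (ih _)))
  ext c
  exact sub_eq_zero.1 (heq_zero _ fun n => hJ.antitone (Nat.le_succ n) (sub_mem_of_sub_mem n c))

theorem exists_mem_limitSubring_map_eq_of_isHausdorff {E : Type*} [CommRing E] {I : ℕ → Ideal E}
    {τ : ι → E} [IsHausdorff (Ideal.span {(p : C)}) C] (hb : IsFrobeniusBasis p b)
    (hker : RingHom.ker ρ = Ideal.span {(p : C)}) (hI : IsCompleteFiltration p I) (φ : E →+* C)
    (hφI : ∀ n, I n ≤ (Ideal.span {(p : C)} ^ n).comap φ)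
    (hρφ : Function.Surjective (ρ.comp φ)) (hkerφ : RingHom.ker (ρ.comp φ) = I 1)
    (hτ : ∀ i, ρ (φ (τ i)) = b i) (c : C) : ∃ y ∈ limitSubring p I τ, φ y = c := by
  have hdigit (c : C) : ∃ y ∈ limitSubring p I τ, ∃ c', c = φ y + p * c' := by
    obtain ⟨y, hy, hyc⟩ := exists_mem_limitSubring_map_eq hI hb hρφ hkerφ hτ (ρ c)
    obtain ⟨c', hc'⟩ := Ideal.mem_span_singleton.1
      (hker ▸ (RingHom.sub_mem_ker_iff ρ).2 hyc.symm)
    exact ⟨y, hy, c', by rw [← hc']; ring⟩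
  choose y hy r hr using hdigit
  let s : ℕ → E := fun n => ∑ i ∈ Finset.range n, (p : E) ^ i * y (r^[i] c)
  have hs (n : ℕ) : c = φ (s n) + p ^ n * r^[n] c := by
    induction n with
    | zero => simp [s]
    | succ n ih =>
      conv_lhs => rw [ih, hr (r^[n] c)]
      rw [Function.iterate_succ_apply']
      simp only [s, Finset.sum_range_succ, map_add, map_mul, map_pow, map_natCast]
      ring
  obtain ⟨L, hL⟩ := hI.exists_limit s fun n => by
    simpa [s, Finset.sum_range_succ] using Ideal.mul_mem_right _ _ (hI.p_pow_mem n)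
  refine ⟨L, mem_limitSubring_of_forall_exists fun n => ⟨s n, sum_mem fun i _ =>
    mul_mem (pow_mem (natCast_mem _ _) _) (hy _), hL n⟩,
    eq_of_forall_sub_mem (Ideal.span {(p : C)}) fun n => ?_⟩
  have hsub : φ L - c = φ (L - s n) - p ^ n * r^[n] c := by
    conv_lhs => rw [hs n]
    rw [map_sub]
    ring
  rw [hsub]
  exact sub_mem (hφI n (hL n)) (Ideal.mul_mem_right _ _
    (Ideal.pow_mem_pow (Ideal.mem_span_singleton_self _) n))

variable {q : D →+* S} {f : k →+* S} {I : ℕ → Ideal C}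

theorem ker_comp_fiberProduct_fst (hker : RingHom.ker ρ = I 1) (hqJ : RingHom.ker q = J 1) :
    RingHom.ker (ρ.comp (fiberProduct.fst (f.comp ρ) q)) =
      fiberFiltration (f.comp ρ) q I J 1 := by
  ext e
  rw [mem_fiberFiltration, ← hker, ← hqJ, RingHom.mem_ker, RingHom.mem_ker, RingHom.mem_ker,
    RingHom.comp_apply, ← fiberProduct.map_fst_eq_map_snd, RingHom.comp_apply]
  exact ⟨fun h => ⟨h, by rw [h, map_zero]⟩, And.left⟩

omit [Fact p.Prime] in
theorem snd_mem_of_fst_mem_pow {f : C →+* S} (hJ : IsFiltration p J)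
    (htorsion : (∀ c : C, p * c = 0 → c = 0) ∨ (p : D) = 0) {Γ : Subring (fiberProduct f q)}
    (hΓ : ∀ e ∈ Γ, (p : C) ∣ fiberProduct.fst f q e → ∀ n, ∃ h ∈ Γ,
      e - p * h ∈ fiberFiltration f q (fun n => Ideal.span {(p : C)} ^ n) J n)
    {n : ℕ} {e : fiberProduct f q} (heΓ : e ∈ Γ)
    (he : fiberProduct.fst f q e ∈ Ideal.span {(p : C)} ^ (n + 1)) :
    fiberProduct.snd f q e ∈ J (n + 1) := by
  induction n generalizing e with
  | zero =>
    rw [zero_add, pow_one, Ideal.mem_span_singleton] at he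
    obtain ⟨h, -, heh⟩ := hΓ e heΓ he 1
    rw [mem_fiberFiltration, map_sub, map_mul, map_natCast, map_sub, map_mul, map_natCast] at heh
    simpa using add_mem heh.2 (Ideal.mul_mem_right (fiberProduct.snd f q h) _ hJ.p_mem)
  | succ n ih =>
    rw [Ideal.span_singleton_pow, Ideal.mem_span_singleton] at he
    obtain ⟨h, hh, heh⟩ := hΓ e heΓ ((dvd_pow_self _ (by lia)).trans he) (n + 2)
    rw [mem_fiberFiltration, map_sub, map_mul, map_natCast, map_sub, map_mul, map_natCast,
      Ideal.span_singleton_pow, Ideal.mem_span_singleton] at heh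
    suffices hph : p * fiberProduct.snd f q h ∈ J (n + 2) by simpa using add_mem heh.2 hph
    rcases htorsion with hpC | hpD
    · refine hJ.p_mul_mem (ih hh ?_)
      obtain ⟨c, hc⟩ := (dvd_sub_right he).1 heh.1
      rw [Ideal.span_singleton_pow, Ideal.mem_span_singleton]
      refine ⟨c, sub_eq_zero.1 (hpC _ ?_)⟩
      rw [mul_sub, hc, pow_succ']
      ring
    · rw [hpD, zero_mul]
      exact zero_mem _

theorem exists_ringHom_lift [IsAdicComplete (Ideal.span {(p : C)}) C] (hb : IsFrobeniusBasis p b)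
    (hρ : Function.Surjective ρ) (hker : RingHom.ker ρ = Ideal.span {(p : C)})
    (ht : ∀ i, ρ (t i) = b i) (hJ : IsCompleteFiltration p J)
    (hq : Function.Surjective q) (hqJ : RingHom.ker q = J 1) (f : k →+* S) (d : ι → D)
    (hd : ∀ i, q (d i) = f (b i)) (htorsion : (∀ c : C, p * c = 0 → c = 0) ∨ (p : D) = 0) :
    ∃ g : C →+* D, (∀ c, q (g c) = f (ρ c)) ∧ ∀ i, g (t i) = d i := by
  let I : ℕ → Ideal C := fun n => Ideal.span {(p : C)} ^ n
  have hI : IsCompleteFiltration p I :=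
    isCompleteFiltration_pow inferInstance (Ideal.mem_span_singleton_self _)
  have hker' : RingHom.ker ρ = I 1 := hker.trans (pow_one _).symm
  let IJ := fiberFiltration (f.comp ρ) q I J
  have hIJ : IsCompleteFiltration p IJ :=
    hI.fiberProduct hJ (hker'.ge.trans fun x hx => by
      rw [RingHom.mem_ker, RingHom.comp_apply, hx, map_zero]) hqJ.ge
  let fst := fiberProduct.fst (f.comp ρ) q
  let snd := fiberProduct.snd (f.comp ρ) q
  have hρfst : Function.Surjective (ρ.comp fst) := hρ.comp (fiberProduct.fst_surjective hq)
  have hkerfst : RingHom.ker (ρ.comp fst) = IJ 1 := ker_comp_fiberProduct_fst hker' hqJ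
  let τ : ι → fiberProduct (f.comp ρ) q := fun i =>
    ⟨(t i, d i), (congrArg f (ht i)).trans (hd i).symm⟩
  let Γ := limitSubring p IJ τ
  have snd_eq_zero (e : fiberProduct (f.comp ρ) q) (he : e ∈ Γ) (hfst : fst e = 0) : snd e = 0 :=
    hJ.eq_zero _ fun n => hJ.antitone (Nat.le_succ n) <|
      snd_mem_of_fst_mem_pow hJ.toIsFiltration htorsion
        (fun e he hpe => exists_eq_p_mul_of_mem_limitSubring hIJ hb hρfst hkerfst ht he
          (hker.ge (Ideal.mem_span_singleton.2 hpe)))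
        he (hfst.symm ▸ zero_mem _ : fst e ∈ I (n + 1))
  have hbij : Function.Bijective (fst.comp Γ.subtype) := by
    refine ⟨(injective_iff_map_eq_zero _).2 fun e he =>
      Subtype.ext (Subtype.ext (Prod.ext he (snd_eq_zero e.1 e.2 he))), fun c => ?_⟩
    obtain ⟨e, he, rfl⟩ := exists_mem_limitSubring_map_eq_of_isHausdorff hb hker hIJ fst
      (fun _ _ he => he.1) hρfst hkerfst (τ := τ) ht c
    exact ⟨⟨e, he⟩, rfl⟩
  let φ := RingEquiv.ofBijective _ hbij
  refine ⟨(snd.comp Γ.subtype).comp φ.symm.toRingHom, fun c => ?_, fun i => ?_⟩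
  · obtain ⟨e, rfl⟩ := φ.surjective c
    refine Eq.trans ?_ (fiberProduct.map_fst_eq_map_snd e.1).symm
    simp [snd]
  · have hφ : φ ⟨τ i, lift_mem_limitSubring i⟩ = t i := rfl
    rw [← hφ]
    exact congrArg (snd.comp Γ.subtype) (φ.symm_apply_apply _)

theorem IsFrobeniusBasis.ringHom_ext_of_natCast_eq_zero (hb : IsFrobeniusBasis p b)
    (hk : (p : k) = 0) (hJ : IsFiltration p J) (heq_zero : ∀ x, (∀ n, x ∈ J n) → x = 0)
    {g g' : k →+* D} (hmod : ∀ x, g x - g' x ∈ J 1) (hgb : ∀ i, g (b i) = g' (b i)) : g = g' :=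
  hb.ringHom_ext (ρ := RingHom.id k) Function.surjective_id (ker_id_eq_span_natCast hk)
    (fun _ => rfl) hJ heq_zero hmod hgb

theorem exists_ringHom_lift_of_natCast_eq_zero (hb : IsFrobeniusBasis p b) (hk : (p : k) = 0)
    (hD : (p : D) = 0) (hJ : IsCompleteFiltration p J) (hq : Function.Surjective q)
    (hqJ : RingHom.ker q = J 1) (f : k →+* S) (d : ι → D) (hd : ∀ i, q (d i) = f (b i)) :
    ∃ g : k →+* D, (∀ x, q (g x) = f x) ∧ ∀ i, g (b i) = d i := by
  have : IsAdicComplete (Ideal.span {(p : k)}) k := by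
    rw [hk, Ideal.span_singleton_zero]
    infer_instance
  exact exists_ringHom_lift (ρ := RingHom.id k) hb Function.surjective_id
    (ker_id_eq_span_natCast hk) (fun _ => rfl) hJ hq hqJ f d hd (Or.inr hD)

end Lifting

/-! ### Witt vectors of perfect rings -/

section Witt

theorem subsingleton_wittVector {p : ℕ} {S : Type*} [Subsingleton S] :
    Subsingleton (WittVector p S) :=
  ⟨fun _ _ => WittVector.ext fun _ => Subsingleton.elim _ _⟩

variable {p : ℕ} [Fact p.Prime] {S : Type*} [CommRing S]

theorem IsPerfect.charP [Nontrivial S] (hS : IsPerfect p S) : CharP S p := by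
  obtain ⟨q, hq⟩ := CharP.exists S
  rcases (Nat.dvd_prime Fact.out).1 ((CharP.cast_eq_zero_iff S q p).1 hS.1) with rfl | rfl
  · exact absurd rfl (CharP.char_ne_one S 1)
  · exact hq

theorem IsPerfect.eq_zero_of_p_mul_eq_zero (hS : IsPerfect p S) {x : WittVector p S}
    (hx : (p : WittVector p S) * x = 0) : x = 0 := by
  rcases subsingleton_or_nontrivial S with _ | _
  · have := subsingleton_wittVector (p := p) (S := S)
    exact Subsingleton.elim _ _
  · have := hS.charP
    have : PerfectRing S p := ⟨hS.2⟩
    exact WittVector.eq_zero_of_p_mul_eq_zero x (by rwa [mul_comm])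

theorem IsPerfect.ker_constantCoeff (hS : IsPerfect p S) :
    RingHom.ker (WittVector.constantCoeff : WittVector p S →+* S) =
      Ideal.span {(p : WittVector p S)} := by
  rcases subsingleton_or_nontrivial S with _ | _
  · have := subsingleton_wittVector (p := p) (S := S)
    exact Subsingleton.elim _ _
  · have := hS.charP
    have : PerfectRing S p := ⟨hS.2⟩
    exact WittVector.ker_constantCoeff

theorem IsPerfect.isAdicComplete_wittVector (hS : IsPerfect p S) :
    IsAdicComplete (Ideal.span {(p : WittVector p S)}) (WittVector p S) := by
  rcases subsingleton_or_nontrivial S with _ | _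
  · have := subsingleton_wittVector (p := p) (S := S)
    infer_instance
  · have := hS.charP
    have : PerfectRing S p := ⟨hS.2⟩
    infer_instance

end Witt

/-! ### Power series -/

section Series

variable {p : ℕ} {W : Type*} [CommRing W]

/-- The filtration of `W⟦X⟧` in which `X` has degree one and `W` carries the filtration `F`. -/
def seriesFiltration {F : ℕ → Ideal W} (hF : IsFiltration p F) (n : ℕ) :
    Ideal (PowerSeries W) where
  carrier := {f | ∀ i, PowerSeries.coeff i f ∈ F (n - i)}
  add_mem' hf hg i := by
    rw [map_add]
    exact add_mem (hf i) (hg i)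
  zero_mem' i := by
    rw [map_zero]
    exact zero_mem _
  smul_mem' g f hf i := by
    rw [smul_eq_mul, PowerSeries.coeff_mul]
    refine sum_mem fun x hx => Ideal.mul_mem_left _ _ (hF.antitone ?_ (hf x.2))
    rw [← Finset.HasAntidiagonal.mem_antidiagonal.1 hx]
    lia

theorem mem_seriesFiltration {F : ℕ → Ideal W} {hF : IsFiltration p F} {n : ℕ}
    {f : PowerSeries W} :
    f ∈ seriesFiltration hF n ↔ ∀ i, PowerSeries.coeff i f ∈ F (n - i) :=
  Iff.rfl

theorem mem_seriesFiltration_one {F : ℕ → Ideal W} {hF : IsFiltration p F} {f : PowerSeries W} :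
    f ∈ seriesFiltration hF 1 ↔ PowerSeries.constantCoeff f ∈ F 1 := by
  rw [mem_seriesFiltration, ← PowerSeries.coeff_zero_eq_constantCoeff_apply]
  refine ⟨fun h => h 0, fun h i => ?_⟩
  cases i with
  | zero => exact h
  | succ i => simp [hF.zero_eq_top]

theorem IsFiltration.seriesFiltration {F : ℕ → Ideal W} (hF : IsFiltration p F) :
    IsFiltration p (seriesFiltration hF) where
  zero_eq_top := Ideal.eq_top_iff_one _ |>.2 fun i => by simp [hF.zero_eq_top]
  antitone m n hmn f hf i := hF.antitone (by lia) (hf i)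
  mul_mem {m n f g} hf hg i := by
    rw [PowerSeries.coeff_mul]
    refine sum_mem fun x hx => hF.antitone ?_ (hF.mul_mem (hf x.1) (hg x.2))
    rw [← Finset.HasAntidiagonal.mem_antidiagonal.1 hx]
    lia
  p_mem := by
    rw [mem_seriesFiltration_one, map_natCast]
    exact hF.p_mem

theorem IsCompleteFiltration.seriesFiltration {F : ℕ → Ideal W} (hF : IsCompleteFiltration p F) :
    IsCompleteFiltration p (seriesFiltration hF.toIsFiltration) where
  toIsFiltration := hF.toIsFiltration.seriesFiltration
  eq_zero f hf := by
    ext i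
    refine hF.eq_zero _ fun n => ?_
    simpa using hf (n + i) i
  exists_limit f hf := by
    have exists_coeff (i : ℕ) : ∃ L, ∀ n, L - PowerSeries.coeff i (f (n + i)) ∈ F n :=
      hF.exists_limit _ fun n => by
        simpa [add_right_comm n 1 i] using hf (n + i) i
    choose L hL using exists_coeff
    refine ⟨PowerSeries.mk L, fun n i => ?_⟩
    rcases le_total i n with hin | hni
    · simpa [hin] using hL i (n - i)
    · simp [Nat.sub_eq_zero_of_le hni, hF.zero_eq_top]

theorem ker_constantCoeff_eq_seriesFiltration_one (hW : (p : W) = 0) :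
    RingHom.ker (PowerSeries.constantCoeff (R := W)) =
      seriesFiltration (isCompleteFiltration_bot_pow hW).toIsFiltration 1 := by
  ext f
  rw [mem_seriesFiltration_one, pow_one, Ideal.mem_bot, RingHom.mem_ker]

theorem mem_span_X_pow {n : ℕ} {f : PowerSeries W} :
    f ∈ Ideal.span {(PowerSeries.X : PowerSeries W)} ^ n ↔
      ∀ i < n, PowerSeries.coeff i f = 0 := by
  rw [Ideal.span_singleton_pow, Ideal.mem_span_singleton, PowerSeries.X_pow_dvd_iff]

end Series

section AdicSum

variable {B : Type*} [CommRing B] {I : Ideal B} {ϖ : B}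

theorem IsAdicSum.unique [IsHausdorff I B] {c : ℕ → B} {x y : B} (hx : IsAdicSum I ϖ c x)
    (hy : IsAdicSum I ϖ c y) : x = y :=
  eq_of_forall_sub_mem I fun n => by simpa using sub_mem (hx n) (hy n)

theorem IsAdicSum.sub_zero_mem {c : ℕ → B} {x : B} (h : IsAdicSum I ϖ c x) : x - c 0 ∈ I := by
  simpa using h 1

theorem exists_isAdicSum [IsPrecomplete I B] (hϖ : ϖ ∈ I) (c : ℕ → B) :
    ∃ x, IsAdicSum I ϖ c x := by
  obtain ⟨x, hx⟩ := IsPrecomplete.prec (I := I) (M := B) inferInstance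
    (f := fun n => ∑ i ∈ Finset.range n, c i * ϖ ^ i) fun {m n} hmn => by
      rw [SModEq.comm, SModEq.sub_mem, ← Finset.sum_range_add_sum_Ico _ hmn, add_sub_cancel_left,
        smul_eq_mul, Ideal.mul_top]
      exact sum_mem fun i hi => Ideal.mul_mem_left _ _
        (Ideal.pow_le_pow_right (Finset.mem_Ico.1 hi).1 (Ideal.pow_mem_pow hϖ i))
  exact ⟨x, fun n => by simpa using SModEq.sub_mem.1 (hx n).symm⟩

open scoped Topology in
theorem isAdicSum_of_hasSum [TopologicalSpace B] (hI : IsAdic I) (hϖ : ϖ ∈ I) {c : ℕ → B} {x : B}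
    (h : HasSum (fun i => c i * ϖ ^ i) x) : IsAdicSum I ϖ c x := by
  intro n
  obtain ⟨N, hnN, hN⟩ := (Filter.eventually_ge_atTop n |>.and
    ((hI.hasBasis_nhds x).tendsto_right_iff.1 h.tendsto_sum_nat n trivial)).exists
  obtain ⟨y, hy, hxy : x + y = _⟩ := hN
  rw [← Finset.sum_range_add_sum_Ico _ hnN] at hxy
  have htail : ∑ i ∈ Finset.Ico n N, c i * ϖ ^ i ∈ I ^ n :=
    sum_mem fun i hi => Ideal.mul_mem_left _ _
      (Ideal.pow_le_pow_right (Finset.mem_Ico.1 hi).1 (Ideal.pow_mem_pow hϖ i))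
  rw [show x - _ = ∑ i ∈ Finset.Ico n N, c i * ϖ ^ i - y by linear_combination hxy]
  exact sub_mem htail hy

theorem exists_evalSeries [IsAdicComplete I B] (hϖ : ϖ ∈ I) {W : Type*} [CommRing W]
    (θ : W →+* B) :
    ∃ ev : PowerSeries W →+* B, ev PowerSeries.X = ϖ ∧ (∀ w, ev (PowerSeries.C w) = θ w) ∧
      ∀ f, IsAdicSum I ϖ (fun i => θ (PowerSeries.coeff i f)) (ev f) := by
  let : WithIdeal B := ⟨I⟩
  have hI : IsAdic I := rfl
  obtain ⟨_, _⟩ := hI.isAdicComplete_iff.1 ‹_›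
  let : UniformSpace W := ⊥
  have : DiscreteUniformity W := ⟨rfl⟩
  have hθ : Continuous θ := continuous_of_discreteTopology
  have hnil : PowerSeries.HasEval ϖ := WithIdeal.isTopologicallyNilpotent_of_mem hϖ
  refine ⟨PowerSeries.eval₂Hom hθ hnil, ?_, fun w => ?_, fun f => ?_⟩ <;>
    rw [PowerSeries.coe_eval₂Hom]
  · exact PowerSeries.eval₂_X ..
  · exact PowerSeries.eval₂_C ..
  · exact isAdicSum_of_hasSum hI hϖ (PowerSeries.hasSum_eval₂ hθ hnil f)

end AdicSum

/-! ### Lifts of perfect reductions -/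

section PerfectLift

variable {p : ℕ} [Fact p.Prime] {B : Type*} [CommRing B] {I : Ideal B} [IsAdicComplete I B]

theorem existsUnique_wittLift (hB : IsPerfect p (B ⧸ I)) :
    ∃! θ : WittVector p (B ⧸ I) →+* B,
      ∀ w, Ideal.Quotient.mk I (θ w) = WittVector.constantCoeff w := by
  have hp : (p : B) ∈ I := by
    rw [← Ideal.Quotient.eq_zero_iff_mem, map_natCast]
    exact hB.1
  have hI := isCompleteFiltration_pow (I := I) inferInstance hp
  have := hB.isAdicComplete_wittVector
  have hb := hB.isFrobeniusBasis_elim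
  have hsurj := WittVector.constantCoeff_surjective (R := B ⧸ I) p
  refine existsUnique_of_exists_of_unique ?_ fun θ θ' hθ hθ' => ?_
  · obtain ⟨θ, hθ, -⟩ := exists_ringHom_lift hb hsurj hB.ker_constantCoeff (t := PEmpty.elim)
      nofun hI Ideal.Quotient.mk_surjective (by rw [Ideal.mk_ker, pow_one]) (RingHom.id _)
      PEmpty.elim nofun (Or.inl fun _ => hB.eq_zero_of_p_mul_eq_zero)
    exact ⟨θ, hθ⟩
  · refine hb.ringHom_ext hsurj hB.ker_constantCoeff (t := PEmpty.elim) nofun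
      hI.toIsFiltration hI.eq_zero (fun w => ?_) nofun
    rw [pow_one, ← Ideal.Quotient.mk_eq_mk_iff_sub_mem, hθ, hθ']

theorem exists_ringSection (hB : IsPerfect p (B ⧸ I)) (hp : (p : B) = 0) :
    ∃ σ : (B ⧸ I) →+* B, ∀ x, Ideal.Quotient.mk I (σ x) = x := by
  have hI := isCompleteFiltration_pow (p := p) (I := I) inferInstance (hp ▸ zero_mem I)
  obtain ⟨σ, hσ, -⟩ := exists_ringHom_lift_of_natCast_eq_zero hB.isFrobeniusBasis_elim hB.1 hp hI
    Ideal.Quotient.mk_surjective (by rw [Ideal.mk_ker, pow_one]) (RingHom.id _) PEmpty.elim nofun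
  exact ⟨σ, hσ⟩

end PerfectLift

theorem flat_of_isSMulRegular_uniformizer {A : Type*} [CommRing A] [IsDomain A]
    [IsDiscreteValuationRing A] {π : A} (hπ : Irreducible π) {M : Type*} [AddCommGroup M]
    [Module A M] (h : IsSMulRegular M π) : Module.Flat A M := by
  have : Module.IsTorsionFree A M := ⟨fun r hr => by
    obtain ⟨n, u, rfl⟩ := IsDiscreteValuationRing.eq_unit_mul_pow_irreducible hr.ne_zero hπ
    exact (u.isUnit.isSMulRegular M).mul (h.pow n)⟩
  infer_instance

/-! ### Morphisms of complete residual perfections and their reductions -/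

theorem isIso_of_bijective {R : Type u} [CommRing R] {P : ObjectProperty (CommAlgCat.{u} R)}
    {S S' : P.FullSubcategory} (f : S ⟶ S') (hf : Function.Bijective f.hom.hom) : IsIso f := by
  have : IsIso ((forget (CommAlgCat R)).map f.hom) := (isIso_iff_bijective _).2 hf
  have : IsIso (P.ι.map f) := isIso_of_reflects_iso f.hom (forget (CommAlgCat R))
  exact isIso_of_reflects_iso f P.ι

theorem CRP.isCompleteFiltration {p : ℕ} {A : Type u} [CommRing A] [IsLocalRing A] (B : CRP p A) :
    IsCompleteFiltration p (fun n => pIdeal A B.obj ^ n) :=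
  isCompleteFiltration_pow B.property.complete B.p_mem

section Reduction

variable {p : ℕ} [Fact p.Prime] {A : Type u} [CommRing A] [IsDomain A]
  [IsDiscreteValuationRing A] {π : A}

theorem algebraMap_uniformizer_mem (hπ : Irreducible π) (B : Type*) [CommRing B] [Algebra A B] :
    algebraMap A B π ∈ pIdeal A B :=
  Ideal.mem_map_of_mem _ (hπ.maximalIdeal_eq ▸ Ideal.mem_span_singleton_self π)

theorem CRP.coeff_zero (hπ : Irreducible π) (B : CRP p A) (x : B.obj) :
    B.coeff hπ x 0 = Ideal.Quotient.mk (pIdeal A B.obj) x := by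
  have h := (B.isAdicSum_coeff hπ x).sub_zero_mem
  rw [← Ideal.Quotient.eq, B.mk_sec] at h
  exact h.symm

theorem CRP.eq_of_coeff_eq (hπ : Irreducible π) {B : CRP p A} {x y : B.obj}
    (h : B.coeff hπ x = B.coeff hπ y) : x = y := by
  have := B.property.complete
  exact (B.isAdicSum_coeff hπ x).unique (h ▸ B.isAdicSum_coeff hπ y)

theorem CRP.hom_ext {B C : CRP p A} {f g : B ⟶ C}
    (h : redMap (toAlgHom f) = redMap (toAlgHom g)) : f = g := by
  obtain ⟨π, hπ⟩ := IsDiscreteValuationRing.exists_irreducible A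
  refine ObjectProperty.hom_ext _ (CommAlgCat.hom_ext (AlgHom.ext fun x => ?_))
  refine eq_of_coeff_eq hπ (funext fun i => ?_)
  exact (redMap_coeff f hπ x i).symm.trans
    ((RingHom.congr_fun h _).trans (redMap_coeff g hπ x i))

theorem CRP.exists_coeff_eq (hπ : Irreducible π) (B : CRP p A) (c : ℕ → Red A B.obj) :
    ∃ x, B.coeff hπ x = c := by
  have := B.property.complete
  obtain ⟨x, hx⟩ := exists_isAdicSum (algebraMap_uniformizer_mem hπ B.obj) fun i => B.sec (c i)
  exact ⟨x, (B.existsUnique_coeff hπ x).unique (B.isAdicSum_coeff hπ x) hx⟩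

theorem CRP.isIso_of_bijective_redMap {B C : CRP p A} (f : B ⟶ C)
    (h : Function.Bijective (redMap (toAlgHom f))) : IsIso f := by
  obtain ⟨π, hπ⟩ := IsDiscreteValuationRing.exists_irreducible A
  refine isIso_of_bijective f ⟨fun x y hxy => ?_, fun y => ?_⟩
  · refine eq_of_coeff_eq hπ (funext fun i => h.1 ?_)
    rw [redMap_coeff, redMap_coeff]
    exact congrArg (C.coeff hπ · i) hxy
  · choose r hr using h.2
    obtain ⟨x, hx⟩ := B.exists_coeff_eq hπ fun i => r (C.coeff hπ y i)
    refine ⟨x, eq_of_coeff_eq hπ (funext fun i => ?_)⟩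
    exact (redMap_coeff f hπ x i).symm.trans (by rw [hx, hr])

end Reduction

/-! ### Universal and generic residual perfections from an adjoint equivalence -/

theorem isFractionRing_comp_iff {R R' K : Type*} [CommRing R] [CommRing R'] [CommRing K]
    {e : R →+* R'} (he : Function.Bijective e) (g : R' →+* K) :
    @IsFractionRing R _ K _ (g.comp e).toAlgebra ↔ @IsFractionRing R' _ K _ g.toAlgebra := by
  let e' := RingEquiv.ofBijective e he
  let := (g.comp e).toAlgebra
  have hg : (algebraMap R K).comp e'.symm.toRingHom = g :=
    RingHom.ext fun x => congrArg g (e'.apply_symm_apply x)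
  rw [IsFractionRing.isFractionRing_iff_of_base_ringEquiv (S := K) e', hg]

section Explicit

variable {p : ℕ} [Fact p.Prime] {A : Type u} [CommRing A] [IsDomain A]
  [IsDiscreteValuationRing A] [CharP (IsLocalRing.ResidueField A) p] {π : A}

/-- `R_T^pf` is the initial perfect algebra over itself. -/
def isInitialRTpfObj (T : Set A) : Limits.IsInitial (RTpfObj p T) :=
  Limits.IsInitial.ofUniqueHom
    (fun S => ObjectProperty.homMk (CommAlgCat.ofHom (Algebra.ofId (RTpf p T) S.obj)))
    (fun S _ => ObjectProperty.hom_ext _ (CommAlgCat.hom_ext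
      (Subsingleton.elim (α := RTpf p T →ₐ[RTpf p T] S.obj) _ _)))

variable {hπ : Irreducible π} {T : Set A} {V : PAlg p (RTpf p T) ⥤ CRP p A}

/-- A left adjoint of `U` sends `R_T^pf` to a universal residual perfection. -/
def isInitialOfAdjunction (adj : V ⊣ U hπ T) : Limits.IsInitial (V.obj (RTpfObj p T)) :=
  have := adj.leftAdjoint_preservesColimits
  (isInitialRTpfObj T).isInitialObj V

/-- A fully faithful left adjoint of `U` makes every perfect `R_T^pf`-algebra `S` isomorphic to the
reduction of `V(S)`, whose algebra structure is given by `CRP.structureMap`. -/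
def unitAlgEquiv (adj : V ⊣ U hπ T) [IsIso adj.unit] (S : PAlg p (RTpf p T)) :
    letI := ((V.obj S).structureMap hπ T).toAlgebra
    S.obj ≃ₐ[RTpf p T] Red A (V.obj S).obj :=
  CommAlgCat.algEquivOfIso
    ((isPerfectAlg p (RTpf p T)).ι.mapIso (asIso (adj.unit.app S)))

theorem structureMap_bijective_of_isInitial (adj : V ⊣ U hπ T) [IsIso adj.unit] {Au : CRP p A}
    (hAu : Limits.IsInitial Au) : Function.Bijective (Au.structureMap hπ T) := by
  let i : RTpfObj p T ≅ (U hπ T).obj Au :=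
    asIso (adj.unit.app (RTpfObj p T)) ≪≫
      (U hπ T).mapIso ((isInitialOfAdjunction adj).uniqueUpToIso hAu)
  let e := CommAlgCat.algEquivOfIso ((isPerfectAlg p (RTpf p T)).ι.mapIso i)
  have he : ⇑(Au.structureMap hπ T) = e := funext fun x => (e.commutes x).symm
  rw [he]
  exact e.bijective

theorem isGenericPerfection_iff (adj : V ⊣ U hπ T) [IsIso adj.unit] {Au : CRP p A}
    (hAu : Limits.IsInitial Au) (B : CRP p A) :
    IsGenericPerfection hAu B ↔
      @IsFractionRing (RTpf p T) _ (Red A B.obj) _ (B.structureMap hπ T).toAlgebra := by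
  have hbij := structureMap_bijective_of_isInitial adj hAu
  have hdom : IsDomain (Red A Au.obj) :=
    (RingEquiv.ofBijective _ hbij).symm.toMulEquiv.isDomain (RTpf p T)
  rw [IsGenericPerfection, ← isFractionRing_comp_iff hbij,
    CRP.redMap_comp_structureMap hπ T (hAu.to B)]
  exact and_iff_right hdom

theorem isGenericPerfection_obj_FrRTpfObj (adj : V ⊣ U hπ T) [IsIso adj.unit] {Au : CRP p A}
    (hAu : Limits.IsInitial Au) : IsGenericPerfection hAu (V.obj (FrRTpfObj p T)) := by
  rw [isGenericPerfection_iff adj]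
  let := ((V.obj (FrRTpfObj p T)).structureMap hπ T).toAlgebra
  let e : FractionRing (RTpf p T) ≃ₐ[RTpf p T] Red A (V.obj (FrRTpfObj p T)).obj :=
    unitAlgEquiv adj (FrRTpfObj p T)
  exact IsLocalization.isLocalization_of_algEquiv (nonZeroDivisors (RTpf p T)) e

theorem IsGenericPerfection.nonempty_unique_iso (adj : V ⊣ U hπ T) [IsIso adj.unit]
    [IsIso adj.counit] {Au Ag : CRP p A} {hAu : Limits.IsInitial Au}
    (hAg : IsGenericPerfection hAu Ag) : Nonempty (Unique (Ag ≅ V.obj (FrRTpfObj p T))) := by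
  let : Algebra (RTpf p T) (Red A Ag.obj) := (Ag.structureMap hπ T).toAlgebra
  have : IsFractionRing (RTpf p T) (Red A Ag.obj) := (isGenericPerfection_iff adj hAu Ag).1 hAg
  let e : Red A Ag.obj ≃ₐ[RTpf p T] FractionRing (RTpf p T) :=
    IsLocalization.algEquiv (nonZeroDivisors (RTpf p T)) _ _
  let i : (U hπ T).obj Ag ≅ FrRTpfObj p T :=
    (isPerfectAlg p (RTpf p T)).isoMk (CommAlgCat.isoMk e)
  refine ⟨⟨⟨(asIso (adj.counit.app Ag)).symm ≪≫ V.mapIso i⟩, fun j => Iso.ext (CRP.hom_ext ?_)⟩⟩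
  refine IsLocalization.ringHom_ext (nonZeroDivisors (RTpf p T)) ?_
  exact (CRP.redMap_comp_structureMap hπ T _).trans (CRP.redMap_comp_structureMap hπ T _).symm

theorem describesUniversalAndGeneric (adj : V ⊣ U hπ T) [IsIso adj.unit] [IsIso adj.counit] :
    DescribesUniversalAndGeneric T V :=
  ⟨⟨_, ⟨isInitialOfAdjunction adj⟩⟩, fun _ hAu =>
    ⟨(hAu.uniqueUpToIso (isInitialOfAdjunction adj)).isIso_hom,
      isGenericPerfection_obj_FrRTpfObj adj hAu, fun _ hAg => hAg.nonempty_unique_iso adj⟩⟩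

/-! ### The adjoint equivalence from multiplicative coefficient maps -/

/-- Multiplicative maps `κ S : S → V(S)` that reduce to ring isomorphisms and describe the
expansions of the elements of `T`: the Teichmüller maps of the explicit functors `V`. -/
structure IsCoefficientSystem (hπ : Irreducible π) {T : Set A}
    (V : PAlg p (RTpf p T) ⥤ CRP p A) (κ : ∀ S, S.obj →* (V.obj S).obj) : Prop where
  natural : ∀ {S S' : PAlg p (RTpf p T)} (f : S ⟶ S') (x : S.obj),
    CRP.toAlgHom (V.map f) (κ S x) = κ S' (f.hom.hom x)
  bijective : ∀ S, Function.Bijective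
    (fun x => Ideal.Quotient.mk (pIdeal A (V.obj S).obj) (κ S x))
  map_add : ∀ S x y, κ S (x + y) - (κ S x + κ S y) ∈ pIdeal A (V.obj S).obj
  residue : ∀ S (a : A), algebraMap A (V.obj S).obj a -
    κ S (algebraMap (RTpf p T) S.obj (resToRTpf p T (IsLocalRing.residue A a))) ∈
      pIdeal A (V.obj S).obj
  expansion : ∀ S (t : T), IsAdicSum (pIdeal A (V.obj S).obj) (algebraMap A (V.obj S).obj π)
    (fun j => κ S (algebraMap (RTpf p T) S.obj (uCoeff p T t j))) (algebraMap A (V.obj S).obj t)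

/-- A ring map compatible with the structure maps, as a morphism of algebras. -/
def homToAlgOfRingHom {R S' : Type u} [CommRing R] [CommRing S'] {S : CommAlgCat.{u} R}
    {f : R →+* S'} (h : S →+* S') (hh : h.comp (algebraMap R S) = f) : S ⟶ algOfRingHom f :=
  letI := f.toAlgebra
  CommAlgCat.ofHom (R := R) (X := S) (Y := S')
    { toRingHom := h, commutes' := fun r => RingHom.congr_fun hh r }

namespace IsCoefficientSystem

variable {κ : ∀ S, S.obj →* (V.obj S).obj}

/-- The reduction of a coefficient map, as a ring map. -/
def red (h : IsCoefficientSystem hπ V κ) (S : PAlg p (RTpf p T)) :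
    S.obj →+* Red A (V.obj S).obj :=
  RingHom.mk' ((Ideal.Quotient.mk (pIdeal A (V.obj S).obj) : _ →* _).comp (κ S)) fun x y =>
    Ideal.Quotient.eq.2 (h.map_add S x y)

theorem sec_red (h : IsCoefficientSystem hπ V κ) (S : PAlg p (RTpf p T)) (x : S.obj) :
    (V.obj S).sec (h.red S x) = κ S x := by
  have := (V.obj S).property.complete
  refine DFunLike.congr_fun (multiplicative_ext (V.obj S).p_mem S.property
    (s := (V.obj S).sec.comp (h.red S : S.obj →* Red A (V.obj S).obj)) (s' := κ S) fun y => ?_) x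
  rw [← Ideal.Quotient.mk_eq_mk_iff_sub_mem]
  exact (V.obj S).mk_sec _

theorem coeff_algebraMap (h : IsCoefficientSystem hπ V κ) (S : PAlg p (RTpf p T)) (t : T) (j : ℕ) :
    (V.obj S).coeff hπ (algebraMap A (V.obj S).obj t) j =
      h.red S (algebraMap (RTpf p T) S.obj (uCoeff p T t j)) := by
  refine congrFun (((V.obj S).existsUnique_coeff hπ _).unique ((V.obj S).isAdicSum_coeff hπ _)
    (y₂ := fun j => h.red S (algebraMap (RTpf p T) S.obj (uCoeff p T t j))) ?_) j
  simp only [sec_red]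
  exact h.expansion S t

theorem red_comp_algebraMap (h : IsCoefficientSystem hπ V κ) (S : PAlg p (RTpf p T)) :
    (h.red S).comp (algebraMap (RTpf p T) S.obj) = (V.obj S).structureMap hπ T := by
  refine perfectClosure_hom_ext p (V.obj S).property.perfect ?_
  rw [CRP.structureMap, perfectLift_comp_of]
  refine MvPolynomial.ringHom_ext (fun r => ?_) (fun ⟨t, j⟩ => ?_)
  · obtain ⟨a, rfl⟩ := IsLocalRing.residue_surjective r
    simp only [RingHom.comp_apply, MvPolynomial.coe_eval₂Hom, MvPolynomial.eval₂_C]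
    exact (Ideal.Quotient.eq.2 (h.residue S a)).symm
  · have huCoeff : uCoeff p T t j = PerfectClosure.of (RT T) p (MvPolynomial.X (t, j)) :=
      dif_pos j.2
    simp only [RingHom.comp_apply, MvPolynomial.coe_eval₂Hom, MvPolynomial.eval₂_X,
      h.coeff_algebraMap, huCoeff]

/-- The component `S → U(V(S))` of the unit. -/
def unitApp (h : IsCoefficientSystem hπ V κ) (S : PAlg p (RTpf p T)) :
    S ⟶ (U hπ T).obj (V.obj S) :=
  ObjectProperty.homMk (homToAlgOfRingHom (h.red S) (h.red_comp_algebraMap S))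

theorem toRed_unitApp (h : IsCoefficientSystem hπ V κ) (S : PAlg p (RTpf p T)) (x : S.obj) :
    U.toRed hπ T _ ((h.unitApp S).hom.hom x) =
      Ideal.Quotient.mk (pIdeal A (V.obj S).obj) (κ S x) :=
  rfl

theorem hom_ext (h : IsCoefficientSystem hπ V κ) {S : PAlg p (RTpf p T)} {B : CRP p A}
    {f g : V.obj S ⟶ B}
    (hfg : ∀ x, Ideal.Quotient.mk (pIdeal A B.obj) (CRP.toAlgHom f (κ S x)) =
      Ideal.Quotient.mk (pIdeal A B.obj) (CRP.toAlgHom g (κ S x))) : f = g := by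
  refine CRP.hom_ext (RingHom.ext fun y => ?_)
  obtain ⟨x, rfl⟩ := (h.bijective S).2 y
  exact hfg x

variable {ε : ∀ B : CRP p A, V.obj ((U hπ T).obj B) ⟶ B}

/-- The adjunction whose unit is given by the coefficient maps `κ` and whose counit is `ε`. -/
def adjunction (h : IsCoefficientSystem hπ V κ)
    (hε : ∀ B x, Ideal.Quotient.mk (pIdeal A B.obj) (CRP.toAlgHom (ε B) (κ _ x)) =
      U.toRed hπ T B x) : V ⊣ U hπ T where
  unit :=
    { app := h.unitApp
      naturality := fun S S' f => ObjectProperty.hom_ext _ (CommAlgCat.hom_ext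
        (AlgHom.ext fun x => by
          change Ideal.Quotient.mk (pIdeal A (V.obj S').obj) (κ S' (f.hom.hom x)) =
            redMap (CRP.toAlgHom (V.map f)) (Ideal.Quotient.mk _ (κ S x))
          rw [redMap_mk, h.natural])) }
  counit :=
    { app := ε
      naturality := fun B B' f => h.hom_ext fun x => by
        change Ideal.Quotient.mk (pIdeal A B'.obj) (CRP.toAlgHom (ε B')
          (CRP.toAlgHom (V.map ((U hπ T).map f)) (κ _ x))) =
          Ideal.Quotient.mk (pIdeal A B'.obj) (CRP.toAlgHom f (CRP.toAlgHom (ε B) (κ _ x)))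
        rw [h.natural, hε, ← redMap_mk, hε]
        rfl }
  left_triangle_components S := h.hom_ext fun x => by
    change Ideal.Quotient.mk _ (CRP.toAlgHom (ε (V.obj S))
      (CRP.toAlgHom (V.map (h.unitApp S)) (κ _ x))) = Ideal.Quotient.mk _ (κ S x)
    rw [h.natural, hε, toRed_unitApp]
  right_triangle_components B := ObjectProperty.hom_ext _ (CommAlgCat.hom_ext
    (AlgHom.ext fun x => by
      change redMap (CRP.toAlgHom (ε B)) (Ideal.Quotient.mk _ (κ _ x)) = U.toRed hπ T B x
      rw [redMap_mk, hε]))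

theorem exists_adjunction (h : IsCoefficientSystem hπ V κ)
    (hε : ∀ B x, Ideal.Quotient.mk (pIdeal A B.obj) (CRP.toAlgHom (ε B) (κ _ x)) =
      U.toRed hπ T B x) :
    ∃ adj : V ⊣ U hπ T, IsIso adj.unit ∧ IsIso adj.counit ∧
      (∀ S x, U.toRed hπ T _ ((adj.unit.app S).hom.hom x) =
        Ideal.Quotient.mk (pIdeal A (V.obj S).obj) (κ S x)) ∧
      (∀ B, adj.counit.app B = ε B) ∧ DescribesUniversalAndGeneric T V := by
  have isIso_unit : IsIso (h.adjunction hε).unit := by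
    rw [NatTrans.isIso_iff_isIso_app]
    exact fun S => isIso_of_bijective _ (h.bijective S)
  have isIso_counit : IsIso (h.adjunction hε).counit := by
    rw [NatTrans.isIso_iff_isIso_app]
    refine fun B => CRP.isIso_of_bijective_redMap _ ?_
    refine (Function.Bijective.of_comp_iff _ (h.bijective _)).1 ?_
    have hcomp : redMap (CRP.toAlgHom (ε B)) ∘
        (fun x => Ideal.Quotient.mk _ (κ ((U hπ T).obj B) x)) = U.toRed hπ T B :=
      funext (hε B)
    exact (congrArg Function.Bijective hcomp).mpr (U.toRed hπ T B).bijective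
  exact ⟨h.adjunction hε, isIso_unit, isIso_counit, fun _ _ => rfl, fun _ => rfl,
    describesUniversalAndGeneric (h.adjunction hε)⟩

end IsCoefficientSystem

end Explicit

theorem IsPerfect.of_bijective {p : ℕ} {S S' : Type*} [CommRing S] [CommRing S']
    (hS : IsPerfect p S) (f : S →+* S') (hf : Function.Bijective f) : IsPerfect p S' := by
  refine ⟨by rw [← map_natCast f, hS.1, map_zero], ?_⟩
  have hcomm : (fun x : S' => x ^ p) ∘ f = f ∘ fun x : S => x ^ p :=
    funext fun x => (map_pow f x p).symm
  rw [← Function.Bijective.of_comp_iff _ hf, hcomm]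
  exact hf.comp hS.2

section Explicit

variable {p : ℕ} [Fact p.Prime] {A : Type u} [CommRing A] [IsDomain A]
  [IsDiscreteValuationRing A] [CharP (IsLocalRing.ResidueField A) p] {π : A} {T : Set A}

/-! ### Values of the structure map `R_T^pf → B̄` -/

theorem uCoeff_zero (t : T) : uCoeff p T t 0 = resToRTpf p T (IsLocalRing.residue A t) :=
  dif_neg (lt_irrefl 0)

theorem structureMap_resToRTpf (hπ : Irreducible π) (B : CRP p A)
    (r : IsLocalRing.ResidueField A) :
    B.structureMap hπ T (resToRTpf p T r) = resToRed A B.obj r :=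
  (RingHom.congr_fun (perfectLift_comp_of p B.property.perfect _) (MvPolynomial.C r)).trans
    (MvPolynomial.eval₂_C ..)

theorem structureMap_uCoeff (hπ : Irreducible π) (B : CRP p A) (t : T) (j : ℕ) :
    B.structureMap hπ T (uCoeff p T t j) = B.coeff hπ (algebraMap A B.obj t) j := by
  rcases j.eq_zero_or_pos with rfl | hj
  · rw [uCoeff_zero, structureMap_resToRTpf, CRP.coeff_zero]
    rfl
  · have huCoeff : uCoeff p T t j = PerfectClosure.of (RT T) p (MvPolynomial.X (t, ⟨j, hj⟩)) :=
      dif_pos hj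
    rw [huCoeff]
    exact (RingHom.congr_fun (perfectLift_comp_of p B.property.perfect _) _).trans
      (MvPolynomial.eval₂_X ..)

/-! ### Equal characteristic -/

section Equal

theorem exists_coefficientField [IsAdicComplete (IsLocalRing.maximalIdeal A) A] [CharP A p]
    (hT : IsPBasis p (fun t : T => IsLocalRing.residue A t)) :
    ∃ σ : IsLocalRing.ResidueField A →+* A, (∀ x, IsLocalRing.residue A (σ x) = x) ∧
      ∀ t : T, σ (IsLocalRing.residue A t) = t := by
  have hp : (p : A) = 0 := CharP.cast_eq_zero A p
  exact exists_ringHom_lift_of_natCast_eq_zero hT.isFrobeniusBasis (CharP.cast_eq_zero _ p) hp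
    (isCompleteFiltration_pow (I := IsLocalRing.maximalIdeal A) inferInstance (hp ▸ zero_mem _))
    IsLocalRing.residue_surjective (by rw [IsLocalRing.ker_residue, pow_one]) (RingHom.id _)
    (fun t : T => (t : A)) fun _ => rfl

theorem exists_eq_add_uniformizer_mul (hπ : Irreducible π) {x y : A}
    (h : IsLocalRing.residue A x = IsLocalRing.residue A y) : ∃ z, x = y + π * z := by
  rw [← sub_eq_zero, ← map_sub, IsLocalRing.residue_eq_zero_iff, hπ.maximalIdeal_eq,
    Ideal.mem_span_singleton] at h
  obtain ⟨z, hz⟩ := h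
  exact ⟨z, sub_eq_iff_eq_add'.1 hz⟩

theorem ringHom_ext_of_charP [IsAdicComplete (IsLocalRing.maximalIdeal A) A] [CharP A p]
    (hπ : Irreducible π) (hT : IsPBasis p (fun t : T => IsLocalRing.residue A t)) {D : Type*}
    [CommRing D] {J : ℕ → Ideal D} (hJ : IsFiltration p J)
    (heq_zero : ∀ x, (∀ n, x ∈ J n) → x = 0) {φ φ' : A →+* D}
    (hmod : ∀ a, φ a - φ' a ∈ J 1) (hφT : ∀ t : T, φ t = φ' t) (hφπ : φ π = φ' π)
    (hπJ : φ' π ∈ J 1) : φ = φ' := by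
  obtain ⟨σ, hσ, hσt⟩ := exists_coefficientField hT
  have eq_on_σ : φ.comp σ = φ'.comp σ :=
    hT.isFrobeniusBasis.ringHom_ext_of_natCast_eq_zero (CharP.cast_eq_zero _ p) hJ heq_zero
      (fun _ => hmod _) fun t => by rw [RingHom.comp_apply, RingHom.comp_apply, hσt, hφT]
  have sub_mem : ∀ n a, φ a - φ' a ∈ J n := by
    intro n
    induction n with
    | zero => simp [hJ.zero_eq_top]
    | succ n ih =>
      intro a
      obtain ⟨z, hz⟩ := exists_eq_add_uniformizer_mul hπ (hσ (IsLocalRing.residue A a)).symm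
      have hsub : φ a - φ' a = φ' π * (φ z - φ' z) := by
        rw [hz, map_add, map_add, map_mul, map_mul, hφπ]
        linear_combination RingHom.congr_fun eq_on_σ (IsLocalRing.residue A a)
      rw [hsub, add_comm]
      exact hJ.mul_mem hπJ (ih z)
  exact RingHom.ext fun a => sub_eq_zero.1 (heq_zero _ fun n => sub_mem n a)

theorem exists_powerSeries_ringEquiv [IsAdicComplete (IsLocalRing.maximalIdeal A) A]
    (hπ : Irreducible π) {σ : IsLocalRing.ResidueField A →+* A}
    (hσ : ∀ x, IsLocalRing.residue A (σ x) = x) :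
    ∃ e : PowerSeries (IsLocalRing.ResidueField A) ≃+* A,
      e PowerSeries.X = π ∧ (∀ x, e (PowerSeries.C x) = σ x) ∧
      ∀ f, IsLocalRing.residue A (e f) = PowerSeries.constantCoeff f := by
  have hπm : π ∈ IsLocalRing.maximalIdeal A :=
    hπ.maximalIdeal_eq ▸ Ideal.mem_span_singleton_self π
  obtain ⟨ev, hevX, hevC, hev⟩ := exists_evalSeries hπm σ
  have existsUnique_expansion : ∀ a, ∃! c : ℕ → IsLocalRing.ResidueField A,
      IsAdicSum (IsLocalRing.maximalIdeal A) π (fun i => σ (c i)) a :=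
    existsUnique_coeffs hπ.maximalIdeal_eq (fun _ _ h => mul_left_cancel₀ hπ.ne_zero h) hσ
  have hbij : Function.Bijective ev := by
    refine ⟨fun f g hfg => PowerSeries.ext fun i => ?_, fun a => ?_⟩
    · exact congrFun ((existsUnique_expansion (ev f)).unique
        (y₁ := fun i => PowerSeries.coeff i f) (y₂ := fun i => PowerSeries.coeff i g)
        (hev f) (hfg ▸ hev g)) i
    · obtain ⟨c, hc⟩ := (existsUnique_expansion a).exists
      exact ⟨PowerSeries.mk c,
        (hev _).unique (by simpa only [PowerSeries.coeff_mk] using hc)⟩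
  refine ⟨RingEquiv.ofBijective ev hbij, hevX, hevC, fun f => ?_⟩
  have h := (hev f).sub_zero_mem
  rwa [← IsLocalRing.residue_eq_zero_iff, map_sub, hσ, sub_eq_zero,
    PowerSeries.coeff_zero_eq_constantCoeff_apply] at h

section EqualMap

variable {S : Type u} [CommRing S] [Algebra (RTpf p T) S]

theorem natCast_eq_zero_of_algebra_RTpf (T : Set A) (S : Type*) [CommRing S]
    [Algebra (RTpf p T) S] : (p : S) = 0 := by
  rw [← map_natCast (algebraMap (RTpf p T) S), (isPerfect_perfectClosure p (RT T)).1, map_zero]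

theorem exists_isEqualMap [IsAdicComplete (IsLocalRing.maximalIdeal A) A] [CharP A p]
    (hπ : Irreducible π) (hT : IsPBasis p (fun t : T => IsLocalRing.residue A t)) :
    ∃ φ, IsEqualMap p π T S φ := by
  obtain ⟨σ, hσ, hσt⟩ := exists_coefficientField hT
  obtain ⟨e, heX, heC, her⟩ := exists_powerSeries_ringEquiv hπ hσ
  have hS := natCast_eq_zero_of_algebra_RTpf (p := p) T S
  obtain ⟨g, hg, hgt⟩ := exists_ringHom_lift_of_natCast_eq_zero hT.isFrobeniusBasis
    (CharP.cast_eq_zero _ p) (by rw [← map_natCast (PowerSeries.C (R := S)), hS, map_zero])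
    (isCompleteFiltration_bot_pow hS).seriesFiltration PowerSeries.constantCoeff_surj
    (ker_constantCoeff_eq_seriesFiltration_one hS)
    ((algebraMap (RTpf p T) S).comp (resToRTpf p T))
    (fun t => PowerSeries.mk fun j => algebraMap (RTpf p T) S (uCoeff p T t j))
    fun t => by
      rw [← PowerSeries.coeff_zero_eq_constantCoeff_apply, PowerSeries.coeff_mk, uCoeff_zero]
      rfl
  obtain ⟨ev, hevX, hevC, hev⟩ := exists_evalSeries
    (Ideal.mem_span_singleton_self (PowerSeries.X : PowerSeries S)) g
  refine ⟨ev.comp e.symm.toRingHom, ?_, fun a => ?_, fun t => ?_⟩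
  · simpa [← heX] using hevX
  · obtain ⟨f, rfl⟩ := e.surjective a
    have h := (hev f).sub_zero_mem
    rw [Ideal.mem_span_singleton, PowerSeries.X_dvd_iff, map_sub, sub_eq_zero, hg] at h
    simpa [her] using h
  · rw [← hσt t, ← heC, ← hgt, ← hevC]
    simp

theorem IsEqualMap.unique [IsAdicComplete (IsLocalRing.maximalIdeal A) A] [CharP A p]
    (hπ : Irreducible π) (hT : IsPBasis p (fun t : T => IsLocalRing.residue A t))
    {φ φ' : A →+* PowerSeries S} (h : IsEqualMap p π T S φ) (h' : IsEqualMap p π T S φ') :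
    φ = φ' := by
  have hS := natCast_eq_zero_of_algebra_RTpf (p := p) T S
  have hF := (isCompleteFiltration_bot_pow hS).seriesFiltration
  refine ringHom_ext_of_charP hπ hT hF.toIsFiltration hF.eq_zero (fun a => ?_)
    (fun t => by rw [h.map_lift, h'.map_lift]) (by rw [h.map_uniformizer, h'.map_uniformizer]) ?_
  · rw [← ker_constantCoeff_eq_seriesFiltration_one hS, RingHom.mem_ker, map_sub, h.reduction,
      h'.reduction, sub_self]
  · rw [← ker_constantCoeff_eq_seriesFiltration_one hS, RingHom.mem_ker, h'.map_uniformizer,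
      PowerSeries.constantCoeff_X]

end EqualMap

theorem equalMapsExistUnique [IsAdicComplete (IsLocalRing.maximalIdeal A) A] [CharP A p]
    (hπ : Irreducible π) (hT : IsPBasis p (fun t : T => IsLocalRing.residue A t)) :
    EqualMapsExistUnique p π T := fun _ =>
  existsUnique_of_exists_of_unique (exists_isEqualMap hπ hT) fun _ _ h h' => h.unique hπ hT h'

variable (hφ : EqualMapsExistUnique p π T) (S : PAlg p (RTpf p T))

theorem isEqualMap_equalMap : IsEqualMap p π T S.obj (equalMap hφ S) := (hφ S).choose_spec.1

theorem VEqual.algebraMap_apply (a : A) :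
    algebraMap A ((VEqual hφ).obj S) a = VEqual.ofSeries hφ S (equalMap hφ S a) := rfl

theorem VEqual.pIdeal_eq (hπ : Irreducible π) : pIdeal A ((VEqual hφ).obj S) =
    (Ideal.span {(PowerSeries.X : PowerSeries S.obj)} : Ideal (PowerSeries S.obj)) := by
  rw [pIdeal_eq_span hπ, VEqual.algebraMap_apply, (isEqualMap_equalMap hφ S).map_uniformizer]
  rfl

theorem VEqual.ofSeries_mem_pIdeal (hπ : Irreducible π) (f : PowerSeries S.obj) :
    VEqual.ofSeries hφ S f ∈ pIdeal A ((VEqual hφ).obj S) ↔ PowerSeries.constantCoeff f = 0 := by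
  rw [VEqual.pIdeal_eq hφ S hπ, ← PowerSeries.X_dvd_iff]
  exact Ideal.mem_span_singleton (α := PowerSeries S.obj)

theorem VEqual.bijective_mk_C (hπ : Irreducible π) : Function.Bijective
    ((Ideal.Quotient.mk (pIdeal A ((VEqual hφ).obj S))).comp
      ((VEqual.ofSeries hφ S).toRingHom.comp PowerSeries.C)) := by
  refine ⟨(injective_iff_map_eq_zero _).2 fun x hx => ?_, fun y => ?_⟩
  · have hmem : VEqual.ofSeries hφ S (PowerSeries.C x) ∈ pIdeal A ((VEqual hφ).obj S) :=
      Ideal.Quotient.eq_zero_iff_mem.1 hx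
    simpa using (VEqual.ofSeries_mem_pIdeal hφ S hπ _).1 hmem
  · obtain ⟨y, rfl⟩ := Ideal.Quotient.mk_surjective y
    obtain ⟨f, rfl⟩ := (VEqual.ofSeries hφ S).surjective y
    refine ⟨PowerSeries.constantCoeff f, Ideal.Quotient.eq.2 ?_⟩
    change VEqual.ofSeries hφ S (PowerSeries.C (PowerSeries.constantCoeff f)) -
      VEqual.ofSeries hφ S f ∈ _
    rw [← map_sub, VEqual.ofSeries_mem_pIdeal hφ S hπ]
    simp

theorem VEqual.isCRP (hπ : Irreducible π) : isCRP p A ((VEqual hφ).obj S) where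
  flat := by
    refine flat_of_isSMulRegular_uniformizer hπ fun x y hxy => ?_
    simp only [Algebra.smul_def, VEqual.algebraMap_apply,
      (isEqualMap_equalMap hφ S).map_uniformizer] at hxy
    exact PowerSeries.X_mul_cancel (R := S.obj) hxy
  complete := by
    rw [VEqual.pIdeal_eq hφ S hπ]
    exact inferInstanceAs (IsAdicComplete (Ideal.span {(PowerSeries.X : PowerSeries S.obj)})
      (PowerSeries S.obj))
  perfect := IsPerfect.of_bijective S.property _ (VEqual.bijective_mk_C hφ S hπ)

/-- The constant series, as a multiplicative map `S → V(S)` in equal characteristic. -/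
def VEqual.const : S.obj →* (VEqual hφ).obj S :=
  ((VEqual.ofSeries hφ S).toRingHom.comp PowerSeries.C : S.obj →+* (VEqual hφ).obj S)

theorem VEqual.isCoefficientSystem (hπ : Irreducible π) :
    IsCoefficientSystem hπ ((ResidualPerfection.isCRP p A).lift (VEqual hφ)
      (fun S => VEqual.isCRP hφ S hπ)) (VEqual.const hφ) where
  natural {S S'} f x := PowerSeries.map_C (R := S.obj) (S := S'.obj) f.hom.hom.toRingHom x
  bijective S := VEqual.bijective_mk_C hφ S hπ
  map_add S x y := by
    have hadd : VEqual.const hφ S (x + y) = VEqual.const hφ S x + VEqual.const hφ S y :=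
      map_add (PowerSeries.C (R := S.obj)) x y
    change VEqual.const hφ S (x + y) - (VEqual.const hφ S x + VEqual.const hφ S y) ∈
      pIdeal A ((VEqual hφ).obj S)
    rw [hadd, sub_self]
    exact zero_mem _
  residue S a := by
    change VEqual.ofSeries hφ S (equalMap hφ S a - PowerSeries.C (algebraMap (RTpf p T) S.obj
      (resToRTpf p T (IsLocalRing.residue A a)))) ∈ pIdeal A ((VEqual hφ).obj S)
    rw [VEqual.ofSeries_mem_pIdeal hφ S hπ, map_sub, PowerSeries.constantCoeff_C,
      (isEqualMap_equalMap hφ S).reduction, sub_self]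
  expansion S t n := by
    change (equalMap hφ S t - ∑ i ∈ Finset.range n, PowerSeries.C (algebraMap (RTpf p T) S.obj
      (uCoeff p T t i)) * equalMap hφ S π ^ i : PowerSeries S.obj) ∈
      pIdeal A ((VEqual hφ).obj S) ^ n
    rw [VEqual.pIdeal_eq hφ S hπ, (isEqualMap_equalMap hφ S).map_lift,
      (isEqualMap_equalMap hφ S).map_uniformizer]
    refine mem_span_X_pow.2 fun i hi => ?_
    simp [PowerSeries.coeff_C_mul, PowerSeries.coeff_X_pow, hi]

theorem CRP.comp_equalMap_eq_algebraMap [IsAdicComplete (IsLocalRing.maximalIdeal A) A]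
    [CharP A p] (hπ : Irreducible π) (hT : IsPBasis p (fun t : T => IsLocalRing.residue A t))
    (B : CRP p A) {ev : PowerSeries ((U hπ T).obj B).obj →+* B.obj}
    (hevX : ev PowerSeries.X = algebraMap A B.obj π)
    (hev : ∀ f, IsAdicSum (pIdeal A B.obj) (algebraMap A B.obj π)
      (fun i => B.sec (U.toRed hπ T B (PowerSeries.coeff i f))) (ev f)) :
    ev.comp (equalMap hφ ((U hπ T).obj B)) = algebraMap A B.obj := by
  have := B.property.complete
  have hB := B.isCompleteFiltration
  have hmap := isEqualMap_equalMap hφ ((U hπ T).obj B)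
  refine ringHom_ext_of_charP hπ hT hB.toIsFiltration hB.eq_zero (fun a => ?_) (fun t => ?_) ?_ ?_
  · have h := Ideal.Quotient.eq.2 (hev (equalMap hφ _ a)).sub_zero_mem
    rw [B.mk_sec, PowerSeries.coeff_zero_eq_constantCoeff_apply, hmap.reduction] at h
    rw [pow_one, ← Ideal.Quotient.eq]
    exact h.trans (structureMap_resToRTpf hπ B _)
  · have h := hev (equalMap hφ _ t)
    simp only [hmap.map_lift, PowerSeries.coeff_mk] at h
    refine IsAdicSum.unique (I := pIdeal A B.obj) (ϖ := algebraMap A B.obj π)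
      (c := fun i => B.sec (B.coeff hπ (algebraMap A B.obj t) i)) ?_ (B.isAdicSum_coeff hπ _)
    simp only [← structureMap_uCoeff]
    rw [RingHom.comp_apply, hmap.map_lift]
    exact h
  · rw [RingHom.comp_apply, hmap.map_uniformizer, hevX]
  · rw [pow_one]
    exact algebraMap_uniformizer_mem hπ B.obj

theorem CRP.exists_equal_counit [IsAdicComplete (IsLocalRing.maximalIdeal A) A] [CharP A p]
    (hπ : Irreducible π) (hT : IsPBasis p (fun t : T => IsLocalRing.residue A t)) (B : CRP p A) :
    ∃ ε : (VEqual hφ).obj ((U hπ T).obj B) ⟶ B.obj, ∀ f : PowerSeries ((U hπ T).obj B).obj,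
      IsAdicSum (pIdeal A B.obj) (algebraMap A B.obj π)
        (fun i => B.sec (U.toRed hπ T B (PowerSeries.coeff i f)))
        (ε.hom (VEqual.ofSeries hφ _ f)) := by
  have := B.property.complete
  have hp : (p : B.obj) = 0 := by
    rw [← map_natCast (algebraMap A B.obj), CharP.cast_eq_zero A p, map_zero]
  obtain ⟨σ, hσ⟩ := exists_ringSection B.property.perfect hp
  have hsec : (σ : Red A B.obj →* B.obj) = B.sec := B.existsUnique_section.unique hσ B.mk_sec
  obtain ⟨ev, hevX, -, hev⟩ := exists_evalSeries (algebraMap_uniformizer_mem hπ B.obj)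
    (σ.comp (U.toRed hπ T B).toRingHom)
  have hev : ∀ f, IsAdicSum (pIdeal A B.obj) (algebraMap A B.obj π)
      (fun i => B.sec (U.toRed hπ T B (PowerSeries.coeff i f))) (ev f) := by
    rw [← hsec]
    exact hev
  let S := (U hπ T).obj B
  let ε : (VEqual hφ).obj S ⟶ B.obj :=
    letI := (equalMap hφ S).toAlgebra
    CommAlgCat.ofHom (X := PowerSeries S.obj)
      { toRingHom := ev
        commutes' := RingHom.congr_fun (B.comp_equalMap_eq_algebraMap hφ hπ hT hevX hev) }
  exact ⟨ε, hev⟩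

theorem exists_equal_adjunction [IsAdicComplete (IsLocalRing.maximalIdeal A) A] [CharP A p]
    (hπ : Irreducible π) (hT : IsPBasis p (fun t : T => IsLocalRing.residue A t)) :
    ∃ (hφ : EqualMapsExistUnique p π T)
      (hV : ∀ S, isCRP p A ((VEqual hφ).obj S))
      (adj : (isCRP p A).lift (VEqual hφ) hV ⊣ U hπ T),
      IsIso adj.unit ∧ IsIso adj.counit ∧
      (∀ (S : PAlg p (RTpf p T)) (x : S.obj),
        U.toRed hπ T _ ((adj.unit.app S).hom.hom x) =
          Ideal.Quotient.mk (pIdeal A ((VEqual hφ).obj S))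
            (VEqual.ofSeries hφ S (PowerSeries.C x))) ∧
      (∀ (B : CRP p A) (f : PowerSeries ((U hπ T).obj B).obj),
        IsAdicSum (pIdeal A B.obj) (algebraMap A B.obj π)
          (fun i => B.sec (U.toRed hπ T B (PowerSeries.coeff i f)))
          ((adj.counit.app B).hom.hom (VEqual.ofSeries hφ _ f))) ∧
      DescribesUniversalAndGeneric T ((isCRP p A).lift (VEqual hφ) hV) := by
  have hφ := equalMapsExistUnique (p := p) hπ hT
  have hκ := VEqual.isCoefficientSystem hφ hπ
  choose ε hε using CRP.exists_equal_counit hφ hπ hT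
  have ε_const (B : CRP p A) (x : ((U hπ T).obj B).obj) :
      Ideal.Quotient.mk (pIdeal A B.obj) ((ε B).hom (VEqual.const hφ _ x)) = U.toRed hπ T B x := by
    have h := Ideal.Quotient.eq.2 (hε B (PowerSeries.C x)).sub_zero_mem
    rwa [B.mk_sec, PowerSeries.coeff_zero_C] at h
  obtain ⟨adj, hunit, hcounit, hunit_app, hcounit_app, hdesc⟩ :=
    hκ.exists_adjunction (ε := fun B => ObjectProperty.homMk (ε B)) (by exact ε_const)
  exact ⟨hφ, _, adj, hunit, hcounit, hunit_app,
    fun B f => (hcounit_app B).symm ▸ hε B f, hdesc⟩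

end Equal

end Explicit

/-! ### The Cohen subring -/

theorem natCast_mem_maximalIdeal {p : ℕ} {A : Type*} [CommRing A] [IsLocalRing A]
    [CharP (IsLocalRing.ResidueField A) p] : (p : A) ∈ IsLocalRing.maximalIdeal A := by
  rw [← IsLocalRing.residue_eq_zero_iff, map_natCast, CharP.cast_eq_zero]

theorem exists_span_singleton_eq_maximalIdeal_pow {A : Type*} [CommRing A] [IsDomain A]
    [IsDiscreteValuationRing A] {a : A} (ha : a ≠ 0) :
    ∃ e, Ideal.span {a} = IsLocalRing.maximalIdeal A ^ e := by
  obtain ⟨π, hπ⟩ := IsDiscreteValuationRing.exists_irreducible A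
  obtain ⟨e, he⟩ := IsDiscreteValuationRing.associated_pow_irreducible ha hπ
  exact ⟨e, by rw [hπ.maximalIdeal_eq, Ideal.span_singleton_pow,
    Ideal.span_singleton_eq_span_singleton.2 he]⟩

section Cohen

variable {p : ℕ} {A : Type*} [CommRing A] [IsDomain A] [IsDiscreteValuationRing A] {T : Set A}
  {C : Subring A}

/-- The residue map of a subring `C` of `A`, with values in the residue field of `A`, not of `C`:
the two agree when `C` is a Cohen subring. -/
def cohenResidue (C : Subring A) : C →+* IsLocalRing.ResidueField A :=
  (IsLocalRing.residue A).comp C.subtype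

theorem IsCohenSubring.isAdicComplete (hC : IsCohenSubring p T C) :
    IsAdicComplete (Ideal.span {(p : C)}) C := by
  have := hC.isDVR
  rw [← hC.maximalIdeal_eq]
  exact hC.complete

theorem IsCohenSubring.ker_cohenResidue [CharP (IsLocalRing.ResidueField A) p]
    (hC : IsCohenSubring p T C) : RingHom.ker (cohenResidue C) = Ideal.span {(p : C)} := by
  have := hC.isDVR
  refine le_antisymm (fun c hc => ?_) ((Ideal.span_singleton_le_iff_mem _).2 ?_)
  · rw [← hC.maximalIdeal_eq, IsLocalRing.mem_maximalIdeal]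
    exact fun hunit => (hunit.map (cohenResidue C)).ne_zero hc
  · rw [RingHom.mem_ker, map_natCast, CharP.cast_eq_zero]

variable [Fact p.Prime] [CharP (IsLocalRing.ResidueField A) p]

section Subring

variable [CharZero A]

theorem natCast_prime_ne_zero (p : ℕ) [Fact p.Prime] (A : Type*) [CommRing A] [CharZero A] :
    (p : A) ≠ 0 :=
  Nat.cast_ne_zero.2 (Fact.out : p.Prime).ne_zero

theorem mem_of_p_pow_mul_mem
    (hdiv : ∀ x ∈ C, IsLocalRing.residue A x = 0 → ∃ y ∈ C, x = p * y) {n : ℕ} {x : A}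
    (h : (p : A) ^ n * x ∈ C) : x ∈ C := by
  induction n with
  | zero => simpa using h
  | succ n ih =>
    obtain ⟨y, hy, hxy⟩ := hdiv _ h (by simp)
    rw [pow_succ', mul_assoc] at hxy
    rw [← mul_left_cancel₀ (natCast_prime_ne_zero p A) hxy] at hy
    exact ih hy

theorem mem_span_natCast_pow_iff
    (hdiv : ∀ x ∈ C, IsLocalRing.residue A x = 0 → ∃ y ∈ C, x = p * y) {n : ℕ} {x : C} :
    x ∈ Ideal.span {(p : C)} ^ n ↔ (x : A) ∈ Ideal.span {(p : A)} ^ n := by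
  rw [Ideal.span_singleton_pow, Ideal.mem_span_singleton, Ideal.span_singleton_pow,
    Ideal.mem_span_singleton]
  constructor
  · rintro ⟨z, rfl⟩
    exact ⟨z, by push_cast; rfl⟩
  · rintro ⟨z, hz⟩
    exact ⟨⟨z, mem_of_p_pow_mul_mem hdiv (hz ▸ x.2)⟩, Subtype.ext (by push_cast; exact hz)⟩

theorem irreducible_natCast_of_subring
    (hdiv : ∀ x ∈ C, IsLocalRing.residue A x = 0 → ∃ y ∈ C, x = p * y)
    (hinv : ∀ x ∈ C, IsLocalRing.residue A x ≠ 0 → ∃ y ∈ C, x * y = 1) :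
    Irreducible (p : C) := by
  have isUnit_of_residue_ne_zero (x : C) (hx : IsLocalRing.residue A (x : A) ≠ 0) : IsUnit x := by
    obtain ⟨y, hy, hxy⟩ := hinv x x.2 hx
    exact IsUnit.of_mul_eq_one ⟨y, hy⟩ (Subtype.ext hxy)
  refine ⟨fun h => ?_, fun x y hxy => ?_⟩
  · simpa using h.map ((IsLocalRing.residue A).comp C.subtype)
  · by_contra! hunit
    obtain ⟨x', -, hx'⟩ := hdiv x x.2 (not_not.1 (mt (isUnit_of_residue_ne_zero x) hunit.1))
    obtain ⟨y', -, hy'⟩ := hdiv y y.2 (not_not.1 (mt (isUnit_of_residue_ne_zero y) hunit.2))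
    have hp : (p : A) = x * y := congrArg Subtype.val hxy
    have one_eq : (1 : A) = p * (x' * y') := by
      apply mul_left_cancel₀ (natCast_prime_ne_zero p A)
      rw [hx', hy'] at hp
      linear_combination hp
    simpa using congrArg (IsLocalRing.residue A) one_eq

theorem isDiscreteValuationRing_of_subring
    (hdiv : ∀ x ∈ C, IsLocalRing.residue A x = 0 → ∃ y ∈ C, x = p * y)
    (hinv : ∀ x ∈ C, IsLocalRing.residue A x ≠ 0 → ∃ y ∈ C, x * y = 1) :
    IsDiscreteValuationRing C := by
  refine IsDiscreteValuationRing.ofHasUnitMulPowIrreducibleFactorization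
    ⟨(p : C), irreducible_natCast_of_subring hdiv hinv, fun {x} hx => ?_⟩
  obtain ⟨n, hn⟩ : ∃ n, (x : A) ∉ IsLocalRing.maximalIdeal A ^ n := by
    by_contra! h
    exact hx (Subtype.ext (eq_of_forall_sub_mem (IsLocalRing.maximalIdeal A)
      (fun n => by simpa using h n)))
  induction n generalizing x with
  | zero => exact absurd (by simp) hn
  | succ n ih =>
    by_cases hr : IsLocalRing.residue A (x : A) = 0
    · obtain ⟨y, hy, hxy⟩ := hdiv x x.2 hr
      lift y to C using hy
      obtain rfl : x = p * y := Subtype.ext hxy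
      have hyn : (y : A) ∉ IsLocalRing.maximalIdeal A ^ n := fun h => hn (by
        rw [hxy, pow_succ']
        exact Ideal.mul_mem_mul natCast_mem_maximalIdeal h)
      obtain ⟨m, hm⟩ := ih (right_ne_zero_of_mul hx) hyn
      exact ⟨m + 1, pow_succ' (p : C) m ▸ hm.mul_left _⟩
    · obtain ⟨y, hy, hxy⟩ := hinv x x.2 hr
      exact ⟨0, by
        simpa using (associated_one_iff_isUnit.2
          (IsUnit.of_mul_eq_one (⟨y, hy⟩ : C) (Subtype.ext hxy))).symm⟩

theorem isAdicComplete_of_subring [IsAdicComplete (IsLocalRing.maximalIdeal A) A]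
    (hdiv : ∀ x ∈ C, IsLocalRing.residue A x = 0 → ∃ y ∈ C, x = p * y)
    (hclosed : ∀ x, (∀ n, ∃ y ∈ C, x - y ∈ IsLocalRing.maximalIdeal A ^ n) → x ∈ C) :
    IsAdicComplete (Ideal.span {(p : C)}) C := by
  obtain ⟨e, he⟩ := exists_span_singleton_eq_maximalIdeal_pow (natCast_prime_ne_zero p A)
  have hJ := isCompleteFiltration_pow (p := p) (I := IsLocalRing.maximalIdeal A)
    inferInstance natCast_mem_maximalIdeal
  have coe_mem {n : ℕ} {x : C} (hx : x ∈ Ideal.span {(p : C)} ^ n) :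
      (x : A) ∈ IsLocalRing.maximalIdeal A ^ n :=
    Ideal.pow_right_mono ((Ideal.span_singleton_le_iff_mem _).2 natCast_mem_maximalIdeal) n
      ((mem_span_natCast_pow_iff hdiv).1 hx)
  refine isAdicComplete_of_exists_limit
    (fun x hx => Subtype.ext (hJ.eq_zero _ fun n => coe_mem (hx n))) fun x hx => ?_
  obtain ⟨L, hL⟩ := hJ.exists_limit (fun n => (x n : A)) fun n => coe_mem (hx n)
  refine ⟨⟨L, hclosed L fun n => ⟨x n, (x n).2, hL n⟩⟩,
    fun n => (mem_span_natCast_pow_iff hdiv).2 ?_⟩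
  have hLn : L - x (n + e * n) ∈ Ideal.span {(p : A)} ^ n := by
    rw [he, ← pow_mul]
    exact Ideal.pow_le_pow_right (Nat.le_add_left _ _) (hL _)
  have hxn (m : ℕ) : x (n + m) - x n ∈ Ideal.span {(p : C)} ^ n := by
    induction m with
    | zero => simp
    | succ m ih =>
      have := add_mem (Ideal.pow_le_pow_right (Nat.le_add_right n m) (hx (n + m))) ih
      rwa [sub_add_sub_cancel] at this
  simpa using add_mem hLn ((mem_span_natCast_pow_iff hdiv).1 (hxn (e * n)))

end Subring

section Existence

variable [IsAdicComplete (IsLocalRing.maximalIdeal A) A]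

theorem exists_eq_p_mul_of_mem_limitSubring_of_residue_eq_zero [CharZero A]
    (hT : IsPBasis p (fun t : T => IsLocalRing.residue A t)) {x : A}
    (hx : x ∈ limitSubring p (IsLocalRing.maximalIdeal A ^ ·) (Subtype.val : T → A))
    (hx0 : IsLocalRing.residue A x = 0) :
    ∃ y ∈ limitSubring p (IsLocalRing.maximalIdeal A ^ ·) (Subtype.val : T → A), x = p * y := by
  have hp := natCast_prime_ne_zero p A
  obtain ⟨e, he⟩ := exists_span_singleton_eq_maximalIdeal_pow hp
  have approx := exists_eq_p_mul_of_mem_limitSubring (p := p) (isCompleteFiltration_pow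
    inferInstance natCast_mem_maximalIdeal) hT.isFrobeniusBasis IsLocalRing.residue_surjective
    (by rw [IsLocalRing.ker_residue, pow_one]) (fun _ => rfl) hx hx0
  obtain ⟨y, rfl⟩ : (p : A) ∣ x := by
    obtain ⟨h, -, hxh⟩ := approx e
    rw [← he, Ideal.mem_span_singleton] at hxh
    exact (dvd_sub_left (dvd_mul_right _ _)).1 hxh
  refine ⟨y, mem_limitSubring_of_forall_exists fun n => ?_, rfl⟩
  obtain ⟨h, hh, hyh⟩ := approx (e + n)
  rw [← mul_sub, pow_add, ← he, Ideal.mem_span_singleton_mul] at hyh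
  obtain ⟨z, hz, hyz⟩ := hyh
  exact ⟨h, hh, mul_left_cancel₀ hp hyz ▸ hz⟩

theorem exists_isCohenSubring [CharZero A]
    (hT : IsPBasis p (fun t : T => IsLocalRing.residue A t)) :
    ∃ C : Subring A, IsCohenSubring p T C := by
  let G := limitSubring p (IsLocalRing.maximalIdeal A ^ ·) (Subtype.val : T → A)
  have hdiv (x : A) (hx : x ∈ G) (hx0 : IsLocalRing.residue A x = 0) : ∃ y ∈ G, x = p * y :=
    exists_eq_p_mul_of_mem_limitSubring_of_residue_eq_zero hT hx hx0
  have hinv (x : A) (hx : x ∈ G) (hx0 : IsLocalRing.residue A x ≠ 0) : ∃ y ∈ G, x * y = 1 := by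
    obtain ⟨y, hxy⟩ := ((IsLocalRing.residue_ne_zero_iff_isUnit x).1 hx0).exists_right_inv
    exact ⟨y, inv_mem_limitSubring (Fact.out : p.Prime).ne_zero hx hxy, hxy⟩
  have := isDiscreteValuationRing_of_subring hdiv hinv
  have hmax : IsLocalRing.maximalIdeal G = Ideal.span {(p : G)} :=
    (irreducible_natCast_of_subring hdiv hinv).maximalIdeal_eq
  refine ⟨G, ⟨fun t ht => lift_mem_limitSubring (⟨t, ht⟩ : T), hmax,
    hmax ▸ isAdicComplete_of_subring hdiv fun _ => mem_limitSubring_of_forall_exists,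
    fun x => ?_⟩⟩
  obtain ⟨c, hc, hcx⟩ := exists_mem_limitSubring_map_eq (p := p) (isCompleteFiltration_pow
    inferInstance natCast_mem_maximalIdeal) hT.isFrobeniusBasis IsLocalRing.residue_surjective
    (by rw [IsLocalRing.ker_residue, pow_one]) (fun _ => rfl) x
  exact ⟨⟨c, hc⟩, hcx⟩

end Existence

namespace IsCohenSubring

variable (hC : IsCohenSubring p T C) (hT : IsPBasis p (fun t : T => IsLocalRing.residue A t))
  {D S : Type*} [CommRing D] [CommRing S] {J : ℕ → Ideal D}

include hC hT

theorem ringHom_ext (hJ : IsFiltration p J) (heq_zero : ∀ x, (∀ n, x ∈ J n) → x = 0)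
    {g g' : C →+* D} (hmod : ∀ c, g c - g' c ∈ J 1)
    (hgT : ∀ t : T, g ⟨t, hC.subset t.2⟩ = g' ⟨t, hC.subset t.2⟩) : g = g' :=
  hT.isFrobeniusBasis.ringHom_ext (ρ := cohenResidue C) hC.residue_surjective hC.ker_cohenResidue
    (t := fun t : T => ⟨t, hC.subset t.2⟩) (fun _ => rfl) hJ heq_zero hmod hgT

theorem exists_lift [CharZero A] (hJ : IsCompleteFiltration p J) {q : D →+* S}
    (hq : Function.Surjective q) (hqJ : RingHom.ker q = J 1)
    (f : IsLocalRing.ResidueField A →+* S) (d : T → D)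
    (hd : ∀ t : T, q (d t) = f (IsLocalRing.residue A t)) :
    ∃ g : C →+* D, (∀ c : C, q (g c) = f (IsLocalRing.residue A c)) ∧
      ∀ t : T, g ⟨t, hC.subset t.2⟩ = d t := by
  have := hC.isAdicComplete
  have torsionFree (c : C) (hc : p * c = 0) : c = 0 :=
    (mul_eq_zero.1 hc).resolve_left (natCast_prime_ne_zero p C)
  exact exists_ringHom_lift hT.isFrobeniusBasis (ρ := cohenResidue C) hC.residue_surjective
    hC.ker_cohenResidue (t := fun t : T => ⟨t, hC.subset t.2⟩) (fun _ => rfl) hJ hq hqJ f d hd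
    (Or.inl torsionFree)

theorem le [IsAdicComplete (IsLocalRing.maximalIdeal A) A] [CharZero A] {C' : Subring A}
    (hC' : IsCohenSubring p T C') : C ≤ C' := by
  obtain ⟨g, hg, hgt⟩ := hC.exists_lift hT
    (isCompleteFiltration_pow hC'.isAdicComplete (Ideal.mem_span_singleton_self _))
    (q := cohenResidue C') hC'.residue_surjective
    (by rw [hC'.ker_cohenResidue, pow_one]) (RingHom.id _)
    (fun t => ⟨t, hC'.subset t.2⟩) (fun _ => rfl)
  have hA := isCompleteFiltration_pow (p := p) (I := IsLocalRing.maximalIdeal A) inferInstance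
    natCast_mem_maximalIdeal
  have comp_eq_subtype : C'.subtype.comp g = C.subtype := by
    refine hC.ringHom_ext hT hA.toIsFiltration hA.eq_zero (fun c => ?_) (fun t => ?_)
    · rw [pow_one, ← IsLocalRing.residue_eq_zero_iff, map_sub, sub_eq_zero]
      exact hg c
    · rw [RingHom.comp_apply, hgt]
      rfl
  intro c hc
  have hgc : (g ⟨c, hc⟩ : A) = c := RingHom.congr_fun comp_eq_subtype ⟨c, hc⟩
  exact hgc ▸ (g ⟨c, hc⟩).2

end IsCohenSubring

theorem existsUnique_isCohenSubring [IsAdicComplete (IsLocalRing.maximalIdeal A) A] [CharZero A]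
    (hT : IsPBasis p (fun t : T => IsLocalRing.residue A t)) :
    ∃! C : Subring A, IsCohenSubring p T C :=
  existsUnique_of_exists_of_unique (exists_isCohenSubring hT)
    fun _ _ h h' => le_antisymm (h.le hT h') (h'.le hT h)

end Cohen

/-! ### Tensor products along a surjection -/

theorem exists_ringEquiv_of_ker_eq {R S S' : Type*} [CommRing R] [CommRing S] [CommRing S']
    {f : R →+* S} {g : R →+* S'} (hf : Function.Surjective f) (hg : Function.Surjective g)
    (h : RingHom.ker f = RingHom.ker g) : ∃ e : S ≃+* S', ∀ x, e (f x) = g x := by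
  refine ⟨(RingHom.quotientKerEquivOfSurjective hf).symm.trans
    ((Ideal.quotEquivOfEq h).trans (RingHom.quotientKerEquivOfSurjective hg)), fun x => ?_⟩
  have hx : (RingHom.quotientKerEquivOfSurjective hf).symm (f x) = Ideal.Quotient.mk _ x :=
    (RingEquiv.symm_apply_eq _).2 rfl
  rw [RingEquiv.trans_apply, hx]
  rfl

namespace TensorRing

variable {P A D : Type u} [CommRing P] [CommRing A] [CommRing D] {f : P →+* A} {g : P →+* D}

theorem inr_apply (x : P) : inr f g (g x) = algebraMap A (TensorRing f g) (f x) := by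
  let := f.toAlgebra
  let := g.toAlgebra
  exact (Algebra.TensorProduct.includeRight : D →ₐ[P] TensorProduct P A D).commutes x

theorem exists_lift {E : Type u} [CommRing E] [Algebra A E] (k : D →+* E)
    (hk : k.comp g = (algebraMap A E).comp f) :
    ∃ h : TensorRing f g →ₐ[A] E, ∀ d, h (inr f g d) = k d := by
  let := f.toAlgebra
  let := g.toAlgebra
  let : Algebra P E := ((algebraMap A E).comp f).toAlgebra
  have : IsScalarTower P A E := IsScalarTower.of_algebraMap_eq fun _ => rfl
  let k' : D →ₐ[P] E := { toRingHom := k, commutes' := fun x => RingHom.congr_fun hk x }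
  refine ⟨Algebra.TensorProduct.lift (Algebra.ofId A E) k' fun _ _ => Commute.all _ _, fun d => ?_⟩
  exact (Algebra.TensorProduct.lift_tmul (A := A) ..).trans (by rw [map_one, one_mul]; rfl)

theorem inr_surjective (hf : Function.Surjective f) : Function.Surjective (inr f g) := by
  let := f.toAlgebra
  let := g.toAlgebra
  exact Algebra.TensorProduct.includeRight_surjective D hf

theorem ker_inr (hf : Function.Surjective f) :
    RingHom.ker (inr f g) = (RingHom.ker f).map g := by
  refine le_antisymm (fun d hd => ?_) (Ideal.map_le_iff_le_comap.2 fun x hx => ?_)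
  · let K := (RingHom.ker f).map g
    let m : {m : P →+* D ⧸ K // RingHom.ker f ≤ RingHom.ker m} :=
      ⟨(Ideal.Quotient.mk K).comp g, fun x hx =>
        Ideal.Quotient.eq_zero_iff_mem.2 (Ideal.mem_map_of_mem g hx)⟩
    let := (f.liftOfSurjective hf m).toAlgebra
    obtain ⟨k, hk⟩ := exists_lift (f := f) (g := g) (E := D ⧸ K) (Ideal.Quotient.mk K)
      (f.liftOfRightInverse_comp _ (Function.rightInverse_surjInv hf) m).symm
    rw [← Ideal.Quotient.eq_zero_iff_mem, ← hk, RingHom.mem_ker.1 hd, map_zero]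
  · rw [Ideal.mem_comap, RingHom.mem_ker, inr_apply, RingHom.mem_ker.1 hx, map_zero]

end TensorRing

/-! ### Quotients of adically complete rings by an element -/

section PrincipalQuotient

variable {D V : Type*} [CommRing D] [CommRing V] {x ψ : D} {i : D →+* V}

theorem pow_dvd_of_pow_dvd_mul (hreg : IsLeftRegular x) (hψ : ∀ d, x ∣ ψ * d → x ∣ d) {n : ℕ}
    {d : D} (h : x ^ n ∣ ψ * d) : x ^ n ∣ d := by
  induction n generalizing d with
  | zero => simp
  | succ n ih =>
    obtain ⟨y, rfl⟩ := hψ d ((dvd_pow_self x (Nat.succ_ne_zero n)).trans h)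
    obtain ⟨z, hz⟩ := h
    rw [pow_succ']
    exact mul_dvd_mul_left x (ih ⟨z, hreg (by dsimp only; linear_combination hz)⟩)

theorem dvd_of_forall_pow_dvd_sub_mul [IsAdicComplete (Ideal.span {x}) D]
    (hreg : IsLeftRegular x) (hψ : ∀ d, x ∣ ψ * d → x ∣ d) {d : D}
    (h : ∀ n, ∃ g, x ^ n ∣ d - ψ * g) : ψ ∣ d := by
  have hJ := isCompleteFiltration_pow (p := 0) (I := Ideal.span {x}) inferInstance (by simp)
  simp only [Ideal.span_singleton_pow] at hJ
  choose g hg using h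
  obtain ⟨L, hL⟩ := hJ.exists_limit g fun n => Ideal.mem_span_singleton.2 <|
    pow_dvd_of_pow_dvd_mul hreg hψ <| by
      have hstep := dvd_sub (hg n) ((pow_dvd_pow x n.le_succ).trans (hg (n + 1)))
      rwa [sub_sub_sub_cancel_left, ← mul_sub] at hstep
  refine ⟨L, sub_eq_zero.1 (hJ.eq_zero _ fun n => Ideal.mem_span_singleton.2 ?_)⟩
  have hLn := dvd_sub (hg n) ((Ideal.mem_span_singleton.1 (hL n)).mul_left ψ)
  rwa [mul_sub, sub_sub, add_sub_cancel] at hLn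

variable (hi : Function.Surjective i) (hker : RingHom.ker i = Ideal.span {ψ})
  (hreg : IsLeftRegular x) (hψ : ∀ d, x ∣ ψ * d → x ∣ d)

include hi hker hreg hψ

theorem isLeftRegular_map_of_ker_eq_span : IsLeftRegular (i x) := by
  refine isLeftRegular_of_non_zero_divisor _ fun v hv => ?_
  obtain ⟨d, rfl⟩ := hi v
  rw [← map_mul, ← RingHom.mem_ker, hker, Ideal.mem_span_singleton] at hv
  obtain ⟨g, hg⟩ := hv
  obtain ⟨y, rfl⟩ := hψ g ⟨d, hg.symm⟩
  rw [← RingHom.mem_ker, hker, Ideal.mem_span_singleton]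
  exact ⟨y, hreg (by dsimp only; linear_combination hg)⟩

theorem isAdicComplete_of_ker_eq_span [IsAdicComplete (Ideal.span {x}) D] :
    IsAdicComplete (Ideal.span {i x}) V := by
  have exists_of_mem_pow {n : ℕ} {v : V} (hv : v ∈ Ideal.span {i x} ^ n) :
      ∃ y, v = i (x ^ n * y) := by
    rw [Ideal.span_singleton_pow, Ideal.mem_span_singleton] at hv
    obtain ⟨w, rfl⟩ := hv
    obtain ⟨y, rfl⟩ := hi w
    exact ⟨y, by rw [map_mul, map_pow]⟩
  refine isAdicComplete_of_exists_limit (fun v hv => ?_) fun v hv => ?_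
  · obtain ⟨d, rfl⟩ := hi v
    rw [← RingHom.mem_ker, hker, Ideal.mem_span_singleton]
    refine dvd_of_forall_pow_dvd_sub_mul hreg hψ fun n => ?_
    obtain ⟨y, hy⟩ := exists_of_mem_pow (hv n)
    rw [← sub_eq_zero, ← map_sub, ← RingHom.mem_ker, hker, Ideal.mem_span_singleton] at hy
    obtain ⟨g, hg⟩ := hy
    exact ⟨g, y, by linear_combination hg⟩
  · choose y hy using fun n => exists_of_mem_pow (hv n)
    obtain ⟨L, hL⟩ := exists_isAdicSum (Ideal.mem_span_singleton_self x) y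
    refine ⟨v 0 + i L, fun n => ?_⟩
    have htelescope : v n - v 0 = i (∑ m ∈ Finset.range n, y m * x ^ m) := by
      rw [← Finset.sum_range_sub, map_sum]
      exact Finset.sum_congr rfl fun m _ => by rw [hy, mul_comm]
    rw [show v 0 + i L - v n = i (L - ∑ m ∈ Finset.range n, y m * x ^ m) by
      rw [map_sub, ← htelescope]; ring, ← Set.image_singleton, ← Ideal.map_span, ← Ideal.map_pow]
    exact Ideal.mem_map_of_mem i (hL n)

end PrincipalQuotient

/-! ### The presentation of `A` over its Cohen subring -/

section Presentation

variable {p : ℕ} {A : Type u} [CommRing A] {π : A} {C : Subring A}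

theorem polyToA_C (c : C) : polyToA π C (Polynomial.C c) = c := Polynomial.eval₂_C _ _

theorem polyToA_X : polyToA π C Polynomial.X = π := Polynomial.eval₂_X _ _

variable [IsDomain A] [IsDiscreteValuationRing A]

theorem residue_polyToA (hπ : Irreducible π) (Q : Polynomial C) :
    IsLocalRing.residue A (polyToA π C Q) = cohenResidue C (Q.coeff 0) := by
  have hπ0 : IsLocalRing.residue A π = 0 := (IsLocalRing.residue_eq_zero_iff π).2 hπ.not_isUnit
  conv_lhs => rw [← Polynomial.X_mul_divX_add Q]
  rw [map_add, map_mul, polyToA_X, polyToA_C, map_add, map_mul, hπ0, zero_mul, zero_add]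
  rfl

namespace IsCohenSubring

variable {T : Set A}

theorem isUnit_of_residue_ne_zero [CharP (IsLocalRing.ResidueField A) p]
    (hC : IsCohenSubring p T C) {c : C} (hc : cohenResidue C c ≠ 0) : IsUnit c := by
  have := hC.isDVR
  by_contra h
  rw [← mem_nonunits_iff, ← IsLocalRing.mem_maximalIdeal, hC.maximalIdeal_eq,
    ← hC.ker_cohenResidue] at h
  exact hc h

theorem exists_surjective_evalSeries [IsAdicComplete (IsLocalRing.maximalIdeal A) A]
    (hC : IsCohenSubring p T C) (hπ : Irreducible π) :
    ∃ ev : PowerSeries C →+* A, Function.Surjective ev ∧ ev PowerSeries.X = π ∧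
      ∀ c, ev (PowerSeries.C c) = c := by
  obtain ⟨ev, hevX, hevC, hev⟩ := exists_evalSeries
    (hπ.maximalIdeal_eq ▸ Ideal.mem_span_singleton_self π) C.subtype
  choose s hs using hC.residue_surjective
  refine ⟨ev, fun a => ?_, hevX, hevC⟩
  obtain ⟨c, hc, -⟩ := existsUnique_coeffs hπ.maximalIdeal_eq
    (fun _ _ => mul_left_cancel₀ hπ.ne_zero) (s := fun r => (s r : A)) hs a
  exact ⟨PowerSeries.mk fun i => s (c i), (hev _).unique (by simpa using hc)⟩

variable [Fact p.Prime] [IsAdicComplete (IsLocalRing.maximalIdeal A) A] [CharZero A]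

/-- Weierstrass division of series over `C` by `p u⁻¹ - X ^ e`, where `p = u π ^ e`, leaves a
polynomial with the same value at `π`. -/
theorem polyToA_surjective (hC : IsCohenSubring p T C) (hπ : Irreducible π) :
    Function.Surjective (polyToA π C) := by
  have := hC.isDVR
  have := hC.complete
  obtain ⟨ev, hev, hevX, hevC⟩ := hC.exists_surjective_evalSeries hπ
  have ev_coe (Q : Polynomial C) : ev Q = polyToA π C Q :=
    RingHom.congr_fun (Polynomial.ringHom_ext (f := ev.comp Polynomial.coeToPowerSeries.ringHom)
      (fun c => by simp [hevC, polyToA_C]) (by simp [hevX, polyToA_X])) Q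
  obtain ⟨e, u, hu⟩ :=
    IsDiscreteValuationRing.eq_unit_mul_pow_irreducible (natCast_prime_ne_zero p A) hπ
  obtain ⟨v, hv⟩ := hev ((u⁻¹ : Aˣ) : A)
  let g : PowerSeries C := PowerSeries.C (p : C) * v - PowerSeries.X ^ e
  have ev_g : ev g = 0 := by
    simp only [g, map_sub, map_mul, map_pow, hevX, hevC, hv, Subring.coe_natCast, hu]
    linear_combination π ^ e * u.mul_inv
  have g_ne : g.map (IsLocalRing.residue C) ≠ 0 := by
    have hp : IsLocalRing.residue C (p : C) = 0 := by
      rw [IsLocalRing.residue_eq_zero_iff, hC.maximalIdeal_eq]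
      exact Ideal.mem_span_singleton_self _
    simp only [g, map_sub, map_mul, map_pow, PowerSeries.map_C, PowerSeries.map_X, hp, map_zero,
      zero_mul, zero_sub, neg_ne_zero]
    exact pow_ne_zero _ PowerSeries.X_ne_zero
  intro a
  obtain ⟨f, rfl⟩ := hev a
  obtain ⟨q, r, h⟩ := PowerSeries.exists_isWeierstrassDivision f g_ne
  exact ⟨r, by rw [h.eq_mul_add, map_add, map_mul, ev_g, zero_mul, zero_add, ev_coe]⟩

variable [CharP (IsLocalRing.ResidueField A) p]

theorem exists_eisenstein (hC : IsCohenSubring p T C) (hπ : Irreducible π) :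
    ∃ (P : Polynomial C) (c : C), polyToA π C P = 0 ∧ IsUnit c ∧ P.coeff 0 = p * c := by
  obtain ⟨e, u, hu⟩ :=
    IsDiscreteValuationRing.eq_unit_mul_pow_irreducible (natCast_prime_ne_zero p A) hπ
  have he : e ≠ 0 := by
    rintro rfl
    exact (IsLocalRing.mem_maximalIdeal _).1 (natCast_mem_maximalIdeal (p := p) (A := A))
      (by simp [hu])
  obtain ⟨Q, hQ⟩ := hC.polyToA_surjective hπ ((u⁻¹ : Aˣ) : A)
  refine ⟨Polynomial.C (p : C) * Q - Polynomial.X ^ e, Q.coeff 0, ?_, ?_, ?_⟩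
  · rw [map_sub, map_mul, hQ, polyToA_C, map_pow, polyToA_X, Subring.coe_natCast, hu]
    linear_combination π ^ e * u.mul_inv
  · refine hC.isUnit_of_residue_ne_zero ?_
    rw [← residue_polyToA hπ, hQ]
    exact (IsLocalRing.residue_ne_zero_iff_isUnit _).2 (u⁻¹).isUnit
  · rw [Polynomial.coeff_sub, Polynomial.coeff_C_mul, Polynomial.coeff_X_pow, if_neg he.symm,
      sub_zero]

end IsCohenSubring

variable [CharP (IsLocalRing.ResidueField A) p] {T : Set A}

theorem IsCohenSubring.exists_eq_C_mul_add_X_mul (hC : IsCohenSubring p T C) (hπ : Irreducible π)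
    {P : Polynomial C} {c : C} (hP : polyToA π C P = 0) (hc : IsUnit c)
    (hPc : P.coeff 0 = p * c) {Q : Polynomial C} (hQ : polyToA π C Q = 0) :
    ∃ (a : C) (Q' : Polynomial C), polyToA π C Q' = 0 ∧
      Q = Polynomial.C a * P + Polynomial.X * Q' := by
  have hQ0 : Q.coeff 0 ∈ RingHom.ker (cohenResidue C) := by
    rw [RingHom.mem_ker, ← residue_polyToA hπ, hQ, map_zero]
  rw [hC.ker_cohenResidue, Ideal.mem_span_singleton, ← hc.mul_right_dvd, ← hPc] at hQ0
  obtain ⟨a, ha⟩ := hQ0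
  obtain ⟨Q', hQ'⟩ : Polynomial.X ∣ Q - Polynomial.C a * P := by
    rw [Polynomial.X_dvd_iff, Polynomial.coeff_sub, Polynomial.coeff_C_mul, ha, mul_comm, sub_self]
  refine ⟨a, Q', ?_, sub_eq_iff_eq_add'.1 hQ'⟩
  have hval := congrArg (polyToA π C) hQ'
  rw [map_sub, map_mul, map_mul, hP, hQ, mul_zero, sub_zero, polyToA_X] at hval
  exact (mul_eq_zero.1 hval.symm).resolve_left hπ.ne_zero

theorem IsCohenSubring.exists_X_pow_dvd_sub_mul (hC : IsCohenSubring p T C) (hπ : Irreducible π)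
    {P : Polynomial C} {c : C} (hP : polyToA π C P = 0) (hc : IsUnit c)
    (hPc : P.coeff 0 = p * c) (n : ℕ) {Q : Polynomial C} (hQ : polyToA π C Q = 0) :
    ∃ G, Polynomial.X ^ n ∣ Q - P * G := by
  induction n generalizing Q with
  | zero => exact ⟨0, by simp⟩
  | succ n ih =>
    obtain ⟨a, Q', hQ', rfl⟩ := hC.exists_eq_C_mul_add_X_mul hπ hP hc hPc hQ
    obtain ⟨G, R, hR⟩ := ih hQ'
    exact ⟨Polynomial.C a + Polynomial.X * G, R, by linear_combination Polynomial.X * hR⟩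

end Presentation

/-! ### Mixed characteristic -/

section Mixed

variable {p : ℕ} [Fact p.Prime]

section WittSeries

variable {S : Type*} [CommRing S]

/-- Reduction of series over Witt vectors modulo `(p, X)`. -/
def wittSeriesRed (p : ℕ) [Fact p.Prime] (S : Type*) [CommRing S] :
    PowerSeries (WittVector p S) →+* S :=
  WittVector.constantCoeff.comp PowerSeries.constantCoeff

theorem wittSeriesRed_teichmuller (x : S) :
    wittSeriesRed p S (PowerSeries.C (WittVector.teichmuller p x)) = x := by
  rw [wittSeriesRed, RingHom.comp_apply, PowerSeries.constantCoeff_C]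
  exact WittVector.teichmuller_coeff_zero p x

theorem wittSeriesRed_surjective : Function.Surjective (wittSeriesRed p S) :=
  fun x => ⟨_, wittSeriesRed_teichmuller x⟩

theorem IsPerfect.isCompleteFiltration_wittVector (hS : IsPerfect p S) :
    IsCompleteFiltration p (fun n => Ideal.span {(p : WittVector p S)} ^ n) :=
  isCompleteFiltration_pow hS.isAdicComplete_wittVector (Ideal.mem_span_singleton_self _)

theorem IsPerfect.ker_wittSeriesRed (hS : IsPerfect p S) : RingHom.ker (wittSeriesRed p S) =
    seriesFiltration hS.isCompleteFiltration_wittVector.toIsFiltration 1 := by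
  ext f
  rw [mem_seriesFiltration_one, pow_one, ← hS.ker_constantCoeff]
  rfl

theorem ker_wittSeriesRed_eq_sup (hS : IsPerfect p S) {ψ : PowerSeries (WittVector p S)}
    {w : WittVector p S} (hw : IsUnit w) (hψ : PowerSeries.constantCoeff ψ = p * w) :
    RingHom.ker (wittSeriesRed p S) = Ideal.span {PowerSeries.X} ⊔ Ideal.span {ψ} := by
  have ker_constantCoeff :
      RingHom.ker (PowerSeries.constantCoeff (R := WittVector p S)) = Ideal.span {PowerSeries.X} :=
    Ideal.ext fun f => by
      rw [RingHom.mem_ker, ← PowerSeries.X_dvd_iff, Ideal.mem_span_singleton]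
  rw [wittSeriesRed, ← RingHom.comap_ker, hS.ker_constantCoeff,
    ← Ideal.span_singleton_mul_right_unit hw, ← hψ, ← Set.image_singleton, ← Ideal.map_span,
    Ideal.comap_map_of_surjective' _ PowerSeries.constantCoeff_surj, ker_constantCoeff, sup_comm]

theorem X_dvd_of_X_dvd_mul (hS : IsPerfect p S) {ψ f : PowerSeries (WittVector p S)}
    {w : WittVector p S} (hw : IsUnit w) (hψ : PowerSeries.constantCoeff ψ = p * w)
    (h : PowerSeries.X ∣ ψ * f) : PowerSeries.X ∣ f := by
  rw [PowerSeries.X_dvd_iff, map_mul, hψ, mul_assoc] at h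
  rw [PowerSeries.X_dvd_iff]
  exact hw.mul_right_eq_zero.1 (hS.eq_zero_of_p_mul_eq_zero h)

end WittSeries

variable {A : Type u} [CommRing A] [IsDomain A] [IsDiscreteValuationRing A]
  [CharP (IsLocalRing.ResidueField A) p] {π : A} {T : Set A} {C : Subring A}
  {hC : IsCohenSubring p T C}

section MixedMap

variable {S : Type u} [CommRing S] [Algebra (RTpf p T) S]

theorem exists_isMixedMap [CharZero A] (hC : IsCohenSubring p T C)
    (hT : IsPBasis p (fun t : T => IsLocalRing.residue A t)) (hS : IsPerfect p S) :
    ∃ χ, IsMixedMap p hC S χ := by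
  obtain ⟨g, hg, hgt⟩ := hC.exists_lift hT hS.isCompleteFiltration_wittVector.seriesFiltration
    wittSeriesRed_surjective hS.ker_wittSeriesRed
    ((algebraMap (RTpf p T) S).comp (resToRTpf p T))
    (fun t => PowerSeries.mk fun j =>
      WittVector.teichmuller p (algebraMap (RTpf p T) S (uCoeff p T t j)))
    fun t => by
      rw [wittSeriesRed, RingHom.comp_apply, ← PowerSeries.coeff_zero_eq_constantCoeff_apply,
        PowerSeries.coeff_mk, uCoeff_zero]
      exact WittVector.teichmuller_coeff_zero p _
  exact ⟨Polynomial.eval₂RingHom g PowerSeries.X, Polynomial.eval₂_X _ _,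
    fun c => by rw [Polynomial.coe_eval₂RingHom, Polynomial.eval₂_C]; exact hg c,
    fun t => by simpa using hgt t⟩

theorem IsMixedMap.unique (hT : IsPBasis p (fun t : T => IsLocalRing.residue A t))
    (hS : IsPerfect p S) {χ χ' : Polynomial C →+* PowerSeries (WittVector p S)}
    (h : IsMixedMap p hC S χ) (h' : IsMixedMap p hC S χ') : χ = χ' := by
  have hF := hS.isCompleteFiltration_wittVector.seriesFiltration
  have heq : χ.comp Polynomial.C = χ'.comp Polynomial.C := by
    refine hC.ringHom_ext hT hF.toIsFiltration hF.eq_zero (fun c => ?_)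
      fun t => (h.map_lift t).trans (h'.map_lift t).symm
    rw [← hS.ker_wittSeriesRed, RingHom.mem_ker, map_sub, sub_eq_zero]
    exact (h.reduction c).trans (h'.reduction c).symm
  exact Polynomial.ringHom_ext (RingHom.congr_fun heq) (h.map_X.trans h'.map_X.symm)

end MixedMap

theorem mixedMapsExistUnique [CharZero A]
    (hT : IsPBasis p (fun t : T => IsLocalRing.residue A t)) : MixedMapsExistUnique hC :=
  fun S => existsUnique_of_exists_of_unique (exists_isMixedMap hC hT S.property)
    fun _ _ h h' => h.unique hT S.property h'

variable (hχ : MixedMapsExistUnique hC) (S : PAlg p (RTpf p T))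

theorem isMixedMap_mixedMap : IsMixedMap p hC S.obj (mixedMap hχ S) := (hχ S).choose_spec.1

namespace VMixed

theorem algebraMap_polyToA (Q : Polynomial C) :
    algebraMap A ((VMixed π hχ).obj S) (polyToA π C Q) = ofSeries π hχ S (mixedMap hχ S Q) :=
  (TensorRing.inr_apply Q).symm

theorem algebraMap_uniformizer :
    algebraMap A ((VMixed π hχ).obj S) π = ofSeries π hχ S PowerSeries.X := by
  rw [← (isMixedMap_mixedMap hχ S).map_X, ← algebraMap_polyToA, polyToA_X]

theorem algebraMap_coe (c : C) :
    algebraMap A ((VMixed π hχ).obj S) c = ofSeries π hχ S (mixedMap hχ S (Polynomial.C c)) := by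
  rw [← algebraMap_polyToA, polyToA_C]

theorem pIdeal_eq (hπ : Irreducible π) : pIdeal A ((VMixed π hχ).obj S) =
    Ideal.span {ofSeries π hχ S PowerSeries.X} := by
  rw [pIdeal_eq_span hπ, algebraMap_uniformizer]

theorem ofSeries_mem_pIdeal_pow (hπ : Irreducible π) {n : ℕ}
    {f : PowerSeries (WittVector p S.obj)} (h : f ∈ Ideal.span {PowerSeries.X} ^ n) :
    ofSeries π hχ S f ∈ pIdeal A ((VMixed π hχ).obj S) ^ n := by
  rw [pIdeal_eq hχ S hπ, ← Set.image_singleton, ← Ideal.map_span, ← Ideal.map_pow]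
  exact Ideal.mem_map_of_mem _ h

/-- The map `x ↦ 1 ⊗ s_W(x)`, as a multiplicative map `S → V(S)` in mixed characteristic. -/
def teichmuller (π : A) {hC : IsCohenSubring p T C} (hχ : MixedMapsExistUnique hC)
    (S : PAlg p (RTpf p T)) : S.obj →* (VMixed π hχ).obj S :=
  ((ofSeries π hχ S).comp PowerSeries.C : _ →* _).comp (WittVector.teichmuller p)

theorem teichmuller_apply (x : S.obj) : teichmuller π hχ S x =
    ofSeries π hχ S (PowerSeries.C (WittVector.teichmuller p x)) := rfl

variable [IsAdicComplete (IsLocalRing.maximalIdeal A) A] [CharZero A] (hπ : Irreducible π)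

include hπ

theorem ofSeries_surjective : Function.Surjective (ofSeries π hχ S) :=
  TensorRing.inr_surjective (hC.polyToA_surjective hπ)

theorem exists_ker_ofSeries_eq_span : ∃ (ψ : PowerSeries (WittVector p S.obj))
    (w : WittVector p S.obj), IsUnit w ∧ PowerSeries.constantCoeff ψ = p * w ∧
      RingHom.ker (ofSeries π hχ S) = Ideal.span {ψ} := by
  obtain ⟨P, c, hP, hc, hPc⟩ := hC.exists_eisenstein hπ
  have hX := (isMixedMap_mixedMap hχ S).map_X
  let w := PowerSeries.constantCoeff (mixedMap hχ S (Polynomial.C c))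
  have hw : IsUnit w :=
    hc.map ((PowerSeries.constantCoeff.comp (mixedMap hχ S)).comp Polynomial.C)
  have hψ : PowerSeries.constantCoeff (mixedMap hχ S P) = p * w := by
    rw [← Polynomial.X_mul_divX_add P, hPc]
    simp [hX, w]
  refine ⟨mixedMap hχ S P, w, hw, hψ, le_antisymm ?_ ?_⟩
  · refine (TensorRing.ker_inr (hC.polyToA_surjective hπ)).le.trans
      (Ideal.map_le_iff_le_comap.2 fun Q hQ => Ideal.mem_span_singleton.2 ?_)
    refine dvd_of_forall_pow_dvd_sub_mul (x := PowerSeries.X)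
      (fun _ _ h => PowerSeries.X_mul_cancel h) (fun _ => X_dvd_of_X_dvd_mul S.property hw hψ)
      fun n => ?_
    obtain ⟨G, hG⟩ := hC.exists_X_pow_dvd_sub_mul hπ hP hc hPc n hQ
    have hdvd := map_dvd (mixedMap hχ S) hG
    rw [map_pow, hX, map_sub, map_mul] at hdvd
    exact ⟨_, hdvd⟩
  · rw [Ideal.span_singleton_le_iff_mem, RingHom.mem_ker, ← algebraMap_polyToA, hP, map_zero]

theorem ofSeries_mem_pIdeal (f : PowerSeries (WittVector p S.obj)) :
    ofSeries π hχ S f ∈ pIdeal A ((VMixed π hχ).obj S) ↔ wittSeriesRed p S.obj f = 0 := by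
  obtain ⟨ψ, w, hw, hψ, hker⟩ := exists_ker_ofSeries_eq_span hχ S hπ
  rw [pIdeal_eq hχ S hπ, ← Set.image_singleton, ← Ideal.map_span, ← Ideal.mem_comap,
    Ideal.comap_map_of_surjective' _ (ofSeries_surjective hχ S hπ), hker,
    ← ker_wittSeriesRed_eq_sup S.property hw hψ, RingHom.mem_ker]

theorem exists_redEquiv : ∃ e : S.obj ≃+* Red A ((VMixed π hχ).obj S), ∀ f,
    e (wittSeriesRed p S.obj f) = Ideal.Quotient.mk _ (ofSeries π hχ S f) :=
  exists_ringEquiv_of_ker_eq (g := (Ideal.Quotient.mk _).comp (ofSeries π hχ S))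
    wittSeriesRed_surjective
    (Ideal.Quotient.mk_surjective.comp (ofSeries_surjective hχ S hπ))
    (Ideal.ext fun f => (ofSeries_mem_pIdeal hχ S hπ f).symm.trans
      Ideal.Quotient.eq_zero_iff_mem.symm)

theorem isCRP : isCRP p A ((VMixed π hχ).obj S) := by
  obtain ⟨ψ, w, hw, hψ, hker⟩ := exists_ker_ofSeries_eq_span hχ S hπ
  have hi := ofSeries_surjective hχ S hπ
  have hX : IsLeftRegular (PowerSeries.X : PowerSeries (WittVector p S.obj)) :=
    fun _ _ h => PowerSeries.X_mul_cancel h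
  have hdvd := fun f => X_dvd_of_X_dvd_mul (f := f) S.property hw hψ
  obtain ⟨e, -⟩ := exists_redEquiv hχ S hπ
  refine ⟨flat_of_isSMulRegular_uniformizer hπ fun x y hxy => ?_, ?_,
    IsPerfect.of_bijective S.property e.toRingHom e.bijective⟩
  · simp only [Algebra.smul_def, algebraMap_uniformizer] at hxy
    exact isLeftRegular_map_of_ker_eq_span hi hker hX hdvd hxy
  · rw [pIdeal_eq hχ S hπ]
    exact isAdicComplete_of_ker_eq_span hi hker hX hdvd

theorem isCoefficientSystem : IsCoefficientSystem hπ ((ResidualPerfection.isCRP p A).lift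
    (VMixed π hχ) fun S => VMixed.isCRP hχ S hπ) (teichmuller π hχ) where
  natural {S S'} f x := by
    refine (TensorRing.map_inr _ _ (map_comp_mixedMap hχ f) _).trans ?_
    rw [PowerSeries.map_C, WittVector.map_teichmuller]
    rfl
  bijective S := by
    obtain ⟨e, he⟩ := exists_redEquiv hχ S hπ
    have hmk : (fun x => Ideal.Quotient.mk (pIdeal A ((VMixed π hχ).obj S))
        (teichmuller π hχ S x)) = e :=
      funext fun x => by rw [teichmuller_apply, ← he, wittSeriesRed_teichmuller]
    exact (congrArg Function.Bijective hmk).mpr e.bijective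
  map_add S x y := by
    change teichmuller π hχ S (x + y) - (teichmuller π hχ S x + teichmuller π hχ S y) ∈
      pIdeal A ((VMixed π hχ).obj S)
    simp only [teichmuller_apply]
    rw [← map_add (ofSeries π hχ S), ← map_sub (ofSeries π hχ S), ofSeries_mem_pIdeal hχ S hπ]
    simp only [map_sub (wittSeriesRed p S.obj), map_add (wittSeriesRed p S.obj),
      wittSeriesRed_teichmuller, sub_self]
  residue S a := by
    change algebraMap A ((VMixed π hχ).obj S) a - teichmuller π hχ S _ ∈
      pIdeal A ((VMixed π hχ).obj S)
    obtain ⟨c, hc⟩ := hC.residue_surjective (IsLocalRing.residue A a)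
    obtain ⟨z, hz⟩ := exists_eq_add_uniformizer_mul hπ hc.symm
    rw [← hc, hz, map_add, map_mul, add_sub_right_comm]
    refine add_mem ?_ (Ideal.mul_mem_right _ _ (algebraMap_uniformizer_mem hπ _))
    rw [algebraMap_coe, teichmuller_apply, ← map_sub, ofSeries_mem_pIdeal hχ S hπ, map_sub,
      wittSeriesRed_teichmuller, sub_eq_zero]
    exact (isMixedMap_mixedMap hχ S).reduction c
  expansion S t n := by
    change algebraMap A ((VMixed π hχ).obj S) t - ∑ i ∈ Finset.range n, teichmuller π hχ S
      (algebraMap (RTpf p T) S.obj (uCoeff p T t i)) * algebraMap A ((VMixed π hχ).obj S) π ^ i ∈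
      pIdeal A ((VMixed π hχ).obj S) ^ n
    rw [algebraMap_coe hχ S ⟨t, hC.subset t.2⟩, algebraMap_uniformizer]
    simp only [teichmuller_apply, ← map_pow, ← map_mul, ← map_sum, ← map_sub]
    refine ofSeries_mem_pIdeal_pow hχ S hπ (mem_span_X_pow.2 fun i hi => ?_)
    rw [(isMixedMap_mixedMap hχ S).map_lift]
    simp [PowerSeries.coeff_C_mul, PowerSeries.coeff_X_pow, hi]

end VMixed

omit [CharP (IsLocalRing.ResidueField A) p] in
theorem CRP.sec_eq_apply_teichmuller (B : CRP p A) {θ : WittVector p (Red A B.obj) →+* B.obj}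
    (hθ : IsWittLift B θ) (x : Red A B.obj) : B.sec x = θ (WittVector.teichmuller p x) := by
  have hsec := B.existsUnique_section.unique B.mk_sec
    (y₂ := (θ : _ →* B.obj).comp (WittVector.teichmuller p))
    fun x => (hθ _).trans (WittVector.teichmuller_coeff_zero p x)
  exact DFunLike.congr_fun hsec x

section Counit

variable (hπ : Irreducible π)
  (hT : IsPBasis p (fun t : T => IsLocalRing.residue A t)) (B : CRP p A)
  {θ : WittVector p (Red A B.obj) →+* B.obj}

include hT

theorem CRP.comp_mixedMap_eq (hθ : IsWittLift B θ)
    {ev : PowerSeries (WittVector p ((U hπ T).obj B).obj) →+* B.obj}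
    (hevX : ev PowerSeries.X = algebraMap A B.obj π)
    (hev : ∀ f, IsAdicSum (pIdeal A B.obj) (algebraMap A B.obj π)
      (fun i => θ (WittVector.map (U.toRed hπ T B).toRingHom (PowerSeries.coeff i f))) (ev f)) :
    ev.comp (mixedMap hχ ((U hπ T).obj B)) = (algebraMap A B.obj).comp (polyToA π C) := by
  have := B.property.complete
  have hB := B.isCompleteFiltration
  have hmap := isMixedMap_mixedMap hχ ((U hπ T).obj B)
  have heq : (ev.comp (mixedMap hχ ((U hπ T).obj B))).comp Polynomial.C =
      ((algebraMap A B.obj).comp (polyToA π C)).comp Polynomial.C := by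
    refine hC.ringHom_ext hT hB.toIsFiltration hB.eq_zero (fun c => ?_) (fun t => ?_) <;>
      simp only [RingHom.comp_apply, polyToA_C]
    · have h := Ideal.Quotient.eq.2 (hev (mixedMap hχ _ (Polynomial.C c))).sub_zero_mem
      rw [hθ, PowerSeries.coeff_zero_eq_constantCoeff_apply] at h
      rw [pow_one, ← Ideal.Quotient.eq]
      exact (h.trans (congrArg (U.toRed hπ T B) (hmap.reduction c))).trans
        (structureMap_resToRTpf hπ B _)
    · have h := hev (mixedMap hχ _ (Polynomial.C ⟨t, hC.subset t.2⟩))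
      refine IsAdicSum.unique (I := pIdeal A B.obj) (ϖ := algebraMap A B.obj π)
        (c := fun i => B.sec (B.coeff hπ (algebraMap A B.obj t) i)) ?_ (B.isAdicSum_coeff hπ _)
      rw [hmap.map_lift] at h ⊢
      simp only [PowerSeries.coeff_mk, WittVector.map_teichmuller] at h
      simp only [← structureMap_uCoeff, B.sec_eq_apply_teichmuller hθ]
      exact h
  refine Polynomial.ringHom_ext (RingHom.congr_fun heq) ?_
  rw [RingHom.comp_apply, RingHom.comp_apply, hmap.map_X, polyToA_X, hevX]

theorem CRP.exists_mixed_counit (hθ : IsWittLift B θ) :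
    ∃ ε : (VMixed π hχ).obj ((U hπ T).obj B) ⟶ B.obj,
      ∀ f : PowerSeries (WittVector p ((U hπ T).obj B).obj),
        IsAdicSum (pIdeal A B.obj) (algebraMap A B.obj π)
          (fun i => θ (WittVector.map (U.toRed hπ T B).toRingHom (PowerSeries.coeff i f)))
          (ε.hom (VMixed.ofSeries π hχ _ f)) := by
  have := B.property.complete
  obtain ⟨ev, hevX, -, hev⟩ := exists_evalSeries (algebraMap_uniformizer_mem hπ B.obj)
    (θ.comp (WittVector.map (U.toRed hπ T B).toRingHom))
  obtain ⟨ε, hε⟩ := TensorRing.exists_lift ev (B.comp_mixedMap_eq hχ hπ hT hθ hevX hev)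
  refine ⟨CommAlgCat.ofHom ε, fun f => ?_⟩
  have hεf : (CommAlgCat.ofHom ε).hom (VMixed.ofSeries π hχ _ f) = ev f := hε f
  exact Eq.mpr (congrArg (IsAdicSum _ _ _) hεf) (hev f)

end Counit

theorem exists_mixed_adjunction [IsAdicComplete (IsLocalRing.maximalIdeal A) A] [CharZero A]
    (hC : IsCohenSubring p T C) (hπ : Irreducible π)
    (hT : IsPBasis p (fun t : T => IsLocalRing.residue A t)) :
    ∃ (hχ : MixedMapsExistUnique hC)
      (hV : ∀ S, isCRP p A ((VMixed π hχ).obj S))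
      (adj : (isCRP p A).lift (VMixed π hχ) hV ⊣ U hπ T),
      IsIso adj.unit ∧ IsIso adj.counit ∧
      (∀ (S : PAlg p (RTpf p T)) (x : S.obj),
        U.toRed hπ T _ ((adj.unit.app S).hom.hom x) =
          Ideal.Quotient.mk (pIdeal A ((VMixed π hχ).obj S))
            (VMixed.ofSeries π hχ S (PowerSeries.C (WittVector.teichmuller p x)))) ∧
      (∀ B : CRP p A,
        ∃ θ : WittVector p (Red A B.obj) →+* B.obj,
          IsWittLift B θ ∧ (∀ θ', IsWittLift B θ' → θ' = θ) ∧
          ∀ f : PowerSeries (WittVector p ((U hπ T).obj B).obj),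
            IsAdicSum (pIdeal A B.obj) (algebraMap A B.obj π)
              (fun i => θ (WittVector.map (U.toRed hπ T B).toRingHom (PowerSeries.coeff i f)))
              ((adj.counit.app B).hom.hom (VMixed.ofSeries π hχ _ f))) ∧
      DescribesUniversalAndGeneric T ((isCRP p A).lift (VMixed π hχ) hV) := by
  have hχ : MixedMapsExistUnique hC := mixedMapsExistUnique hT
  have hκ := VMixed.isCoefficientSystem hχ hπ
  have existsUnique_θ (B : CRP p A) : ∃! θ, IsWittLift B θ :=
    have := B.property.complete
    existsUnique_wittLift B.property.perfect
  choose θ hθ hθ_unique using existsUnique_θ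
  choose ε hε using fun B => CRP.exists_mixed_counit hχ hπ hT B (hθ B)
  have ε_teichmuller (B : CRP p A) (x : ((U hπ T).obj B).obj) : Ideal.Quotient.mk (pIdeal A B.obj)
      ((ε B).hom (VMixed.teichmuller π hχ _ x)) = U.toRed hπ T B x := by
    have h := Ideal.Quotient.eq.2
      (hε B (PowerSeries.C (WittVector.teichmuller p x))).sub_zero_mem
    rw [hθ, PowerSeries.coeff_zero_C, WittVector.map_teichmuller] at h
    exact h.trans (WittVector.teichmuller_coeff_zero p _)
  obtain ⟨adj, hunit, hcounit, hunit_app, hcounit_app, hdesc⟩ :=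
    hκ.exists_adjunction (ε := fun B => ObjectProperty.homMk (ε B)) (by exact ε_teichmuller)
  exact ⟨hχ, _, adj, hunit, hcounit, hunit_app, fun B => ⟨θ B, hθ B, hθ_unique B, fun f =>
    (hcounit_app B).symm ▸ hε B f⟩, hdesc⟩

end Mixed

end

end ResidualPerfection

theorem mainTheorem2 (p : ℕ) [Fact p.Prime] {A : Type u} [CommRing A] [IsDomain A]
    [IsDiscreteValuationRing A] [IsAdicComplete (IsLocalRing.maximalIdeal A) A]
    [CharP (IsLocalRing.ResidueField A) p]
    (π : A) (hπ : Irreducible π)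
    (T : Set A) (hT : IsPBasis p (fun t : T => IsLocalRing.residue A t)) :
    -- equal characteristic
    (CharP A p →
      ∃ (hφ : EqualMapsExistUnique p π T)
        (hV : ∀ S, isCRP p A ((VEqual hφ).obj S))
        (adj : (isCRP p A).lift (VEqual hφ) hV ⊣ U hπ T),
        IsIso adj.unit ∧ IsIso adj.counit ∧
        (∀ (S : PAlg p (RTpf p T)) (x : S.obj),
          U.toRed hπ T _ ((adj.unit.app S).hom.hom x) =
            Ideal.Quotient.mk (pIdeal A ((VEqual hφ).obj S))
              (VEqual.ofSeries hφ S (PowerSeries.C x))) ∧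
        (∀ (B : CRP p A) (f : PowerSeries ((U hπ T).obj B).obj),
          IsAdicSum (pIdeal A B.obj) (algebraMap A B.obj π)
            (fun i => B.sec (U.toRed hπ T B (PowerSeries.coeff i f)))
            ((adj.counit.app B).hom.hom (VEqual.ofSeries hφ _ f))) ∧
        DescribesUniversalAndGeneric T ((isCRP p A).lift (VEqual hφ) hV)) ∧
    -- mixed characteristic
    (CharZero A →
      (∃! C : Subring A, IsCohenSubring p T C) ∧
      ∀ (C : Subring A) (hC : IsCohenSubring p T C),
      ∃ (hχ : MixedMapsExistUnique hC)
        (hV : ∀ S, isCRP p A ((VMixed π hχ).obj S))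
        (adj : (isCRP p A).lift (VMixed π hχ) hV ⊣ U hπ T),
        IsIso adj.unit ∧ IsIso adj.counit ∧
        (∀ (S : PAlg p (RTpf p T)) (x : S.obj),
          U.toRed hπ T _ ((adj.unit.app S).hom.hom x) =
            Ideal.Quotient.mk (pIdeal A ((VMixed π hχ).obj S))
              (VMixed.ofSeries π hχ S (PowerSeries.C (WittVector.teichmuller p x)))) ∧
        (∀ B : CRP p A,
          ∃ θ : WittVector p (Red A B.obj) →+* B.obj,
            IsWittLift B θ ∧ (∀ θ', IsWittLift B θ' → θ' = θ) ∧
            ∀ f : PowerSeries (WittVector p ((U hπ T).obj B).obj),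
              IsAdicSum (pIdeal A B.obj) (algebraMap A B.obj π)
                (fun i => θ (WittVector.map (U.toRed hπ T B).toRingHom (PowerSeries.coeff i f)))
                ((adj.counit.app B).hom.hom (VMixed.ofSeries π hχ _ f))) ∧
        DescribesUniversalAndGeneric T ((isCRP p A).lift (VMixed π hχ) hV)) := by
  exact ⟨fun _ => exists_equal_adjunction hπ hT, fun _ => ⟨existsUnique_isCohenSubring hT,
    fun _ hC => exists_mixed_adjunction hC hπ hT⟩⟩
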